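/- **Setting.** Let $(\mathcal C,d,m,\pi)$ be a finite-dimensional, unital, graded commutative differential graded algebra over $\mathbb R$, graded in non-negative degrees, with a non-degenerate graded symmetric pairing $\pi$ of degree $-3$ such that $\pi(da,b)+(-1)^{|a|}\pi(a,db)=0$ and $\pi(a,bc)=\pi(ab,c)$, and with $\dim H^0(\mathcal C)=1$. Let $\mathfrak g$ be a finite-dimensional real Lie algebra with a non-degenerate invariant symmetric bilinear form $\pi_{\mathfrak g}$. On $\mathfrak g\otimes\mathcal C$ put $d(X\otimes a)=X\otimes da$, $l(X\otimes a,Y\otimes b)=[X,Y]\otimes ab$ and $\pi(X\otimes a,Y\otimes b)=\pi_{\mathfrak g}(X,Y)\,\pi(a,b)$. An *embedding of cohomology* is a degree $0$ linear map $\iota:H^\bullet(\mathcal C)\to\mathcal C$ with $\iota[a]-a\in d\,\mathcal C$ for each cocycle $a$; $\iota^T$ denotes its transpose for $\pi$ and the induced pairing $\pi(\iota\cdot,\iota\cdot)$ on $H^\bullet(\mathcal C)$. A *relaxed chain homotopy* for $\iota$ is a linear map $\hat K:\mathcal C^\bullet\to\mathcal C^{\bullet-1}$ with $$d\hat K+\hat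 Kd=\mathrm{id}-\iota\iota^T,\qquad \pi(\hat Ka,b)=(-1)^{|a|}\pi(a,\hat Kb),\qquad \hat K\iota=0;$$ it is called *strict* if moreover $\hat K^2=0$. Let $\mathcal F=\mathfrak g\otimes\mathcal C[1]$, $\mathcal F'=\mathfrak g\otimes H^\bullet(\mathcal C)[1]$ and $\mathcal F''=\mathfrak g\otimes\iota(H^\bullet(\mathcal C))^\perp[1]$, with canonical fields $\omega,\alpha,\omega''$ (so that the coordinate along a vector of degree $n$ of $\mathfrak g\otimes\mathcal C$ has ghost number $1-n$, and coordinates commute or anticommute according to ghost number), and $\mathrm{Fun}$ the algebra of formal functions. Let $$S(\omega)=\tfrac12\pi(\omega,d\omega)+\tfrac16\pi(\omega,l(\omega,\omega)),\qquad S_0(\omega'')=\tfrac12\pi(\omega'',d\omega''),$$ $$\mathrm{Ind}_{\iota,\hat K}(S)(\alpha)=\hbar\log\Big(e^{-\hbar\frac12\pi^{-1}(\frac{\partial}{\partial\omega''},\hat K\frac{\partial}{\partial\omega''})}\Big|_{\omega''=0}\,e^{(S(\iota(\alpha)+\omega'')-S_0(\omega''))/\hbar}\Big).$$ This is the *relaxed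 effective action*, and the *strict* one if $\hat K$ is strict. It is understood as a formal expansion in the number of interaction vertices. Here $\pi^{-1}(\frac{\partial}{\partial\omega''},\hat K\frac{\partial}{\partial\omega''})=\sum \hat K^{MN}(\pi_{\mathfrak g}^{-1})^{ab}\frac{\partial}{\partial\omega''^{Ma}}\frac{\partial}{\partial\omega''^{Nb}}$ with left derivatives, where $\hat K^{MN}=\sum_L\hat K^M{}_L(\pi^{-1})^{LN}$ in a homogeneous basis of $\iota(H^\bullet(\mathcal C))^\perp$. **Statement.** Let $\mathcal C$ be formal, that is, let $\iota:H^\bullet(\mathcal C)\to\mathcal C$ be an embedding of cohomology that is a homomorphism of algebras, and let $\hat K$ be a relaxed chain homotopy for $\iota$. Then: 1. The relaxed effective action contains no negative powers of $\hbar$, and $$\mathrm{Ind}_{\iota,\hat K}(S)(\alpha)=W_{\mathrm{prod}}(\alpha)+\hbar\,\hat F^{(1)}(\alpha)+O(\hbar^2),\qquad W_{\mathrm{prod}}(\alpha)=\tfrac16\pi\big(\iota(\alpha),l(\iota(\alpha),\iota(\alpha))\big),$$ $$\hat F^{(1)}(\alpha)=\tfrac12\,\mathrm{Str}_{\mathfrak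 g\otimes\mathcal C}\log\big(1+\hat K\circ l(\iota(\alpha),\bullet)\big).$$ 2. Let $\mathrm{MC}\subset H^1(\mathcal C,\mathfrak g)[1]$ be the set of points $\alpha=\sum_j e_j\alpha^j$ (with $\{e_j\}$ a basis of $H^1(\mathcal C)$ and $\alpha^j\in\mathfrak g$) such that $\sum_{j,k}\mu_{ijk}[\alpha^j,\alpha^k]=0$ for all $i$, where $\mu_{ijk}=\pi(\iota(e_i),\iota(e_j)\iota(e_k))$. The restriction of a formal function to this cone is understood separately for each homogeneous component. Then $\hat K d\hat K$ is a strict chain homotopy for $\iota$, and for every strict chain homotopy $K$ for $\iota$ (in particular for $\hat Kd\hat K$) one has $\hat F^{(1)}|_{\mathrm{MC}}=F^{(1)}|_{\mathrm{MC}}$, where $F^{(1)}$ is the coefficient of $\hbar$ in $\mathrm{Ind}_{\iota,K}(S)$. 3. $\hat F^{(1)}|_{\mathrm{MC}}$ is invariant under deformations of $(\iota,\hat K)$ preserving the homomorphism property of $\iota$: it is the same at both ends of every differentiable family $(\iota_s,\hat K_s)_{s\in[0,1]}$ of embeddings of cohomology that are algebra homomorphisms and relaxed chain homotopies for them; and for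 every infinitesimal deformation, that is, a pair $(\delta\iota,\delta\hat K)$ such that $(\iota+\varepsilon\,\delta\iota,\hat K+\varepsilon\,\delta\hat K)$ satisfies all these conditions modulo $\varepsilon^2$, the first-order variation of $\frac12\mathrm{Str}_{\mathfrak g\otimes\mathcal C}\log(1+\hat K\circ l(\iota(\alpha),\bullet))$ on $\mathrm{MC}$ vanishes. -/

import Mathlib

noncomputable section

namespace AbstractCS

/-! ## dg Frobenius algebras, cohomology, induction data -/

/-- A dg Frobenius algebra structure, with pairing of degree `-3`, on a unital associative
`ℝ`-algebra `A` graded by `𝒞` in non-negative degrees: a differential `d`, graded commutativity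
of the product, and a non-degenerate graded symmetric pairing compatible with `d` and the
product. -/
structure DGFrobenius {A : Type*} [Ring A] [Algebra ℝ A] (𝒞 : ℕ → Submodule ℝ A)
    [GradedAlgebra 𝒞] where
  /-- the differential -/
  d : A →ₗ[ℝ] A
  /-- the pairing `π` -/
  pair : LinearMap.BilinForm ℝ A
  d_mem : ∀ {n : ℕ} {a : A}, a ∈ 𝒞 n → d a ∈ 𝒞 (n + 1)
  d_d : ∀ a : A, d (d a) = 0
  graded_comm : ∀ {i j : ℕ} {a b : A}, a ∈ 𝒞 i → b ∈ 𝒞 j → a * b = (-1 : ℝ) ^ (i * j) • (b * a)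
  leibniz : ∀ {i : ℕ} {a : A} (b : A), a ∈ 𝒞 i → d (a * b) = d a * b + (-1 : ℝ) ^ i • (a * d b)
  pair_degree : ∀ {i j : ℕ} {a b : A}, a ∈ 𝒞 i → b ∈ 𝒞 j → pair a b ≠ 0 → i + j = 3
  pair_symm : ∀ {i j : ℕ} {a b : A}, a ∈ 𝒞 i → b ∈ 𝒞 j →
    pair a b = (-1 : ℝ) ^ (i * j) * pair b a
  pair_nondegenerate : pair.Nondegenerate
  d_skew : ∀ {i : ℕ} {a : A} (b : A), a ∈ 𝒞 i → pair (d a) b + (-1 : ℝ) ^ i * pair a (d b) = 0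
  cyclic : ∀ a b c : A, pair a (b * c) = pair (a * b) c

section Cohomology

variable {A : Type*} [Ring A] [Algebra ℝ A] {𝒞 : ℕ → Submodule ℝ A} [GradedAlgebra 𝒞]
  (D : DGFrobenius 𝒞)

namespace DGFrobenius

/-- The space of cocycles. -/
abbrev Cocycles : Submodule ℝ A := LinearMap.ker D.d

/-- The cohomology `H(𝒞) = ker d / im d`. -/
abbrev Cohomology : Type _ := D.Cocycles ⧸ (LinearMap.range D.d).submoduleOf D.Cocycles

/-- The cohomology class of a cocycle. -/
def cls : D.Cocycles →ₗ[ℝ] D.Cohomology := Submodule.mkQ _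

/-- The degree `n` part of the cohomology. -/
def cohomologyDeg (n : ℕ) : Submodule ℝ D.Cohomology :=
  ((𝒞 n).submoduleOf D.Cocycles).map D.cls

theorem d_decompose (a : A) (i : ℕ) :
    (DirectSum.decompose 𝒞 (D.d a) (i + 1) : A) = D.d (DirectSum.decompose 𝒞 a i : A) := by
  induction a using DirectSum.Decomposition.inductionOn 𝒞 with
  | zero => simp
  | @homogeneous j m =>
    by_cases h : j = i
    · subst h
      rw [DirectSum.decompose_of_mem_same 𝒞 (D.d_mem m.2), DirectSum.decompose_of_mem_same 𝒞 m.2]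
    · rw [DirectSum.decompose_of_mem_ne 𝒞 (D.d_mem m.2) (by omega),
        DirectSum.decompose_of_mem_ne 𝒞 m.2 h, map_zero]
  | add x y hx hy => simp [DirectSum.decompose_add, hx, hy]

theorem mul_mem_cocycles {a b : A} (ha : a ∈ D.Cocycles) (hb : b ∈ D.Cocycles) :
    a * b ∈ D.Cocycles := by
  classical
  rw [LinearMap.mem_ker] at *
  rw [← DirectSum.sum_support_decompose 𝒞 a, Finset.sum_mul, map_sum]
  refine Finset.sum_eq_zero fun i _ => ?_
  rw [D.leibniz b (DirectSum.decompose 𝒞 a i).2, ← D.d_decompose, ha, hb]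
  simp

theorem one_mem_cocycles : (1 : A) ∈ D.Cocycles := by
  have h := D.leibniz (1 : A) (SetLike.GradedOne.one_mem (A := 𝒞))
  rw [LinearMap.mem_ker]
  simpa using h

/-- A (degree-preserving) embedding `ι : H(𝒞) → 𝒞` of the cohomology by representatives,
i.e. `ι [a] = a + d(…)` for each cocycle `a`. -/
structure IsEmbedding (ι : D.Cohomology →ₗ[ℝ] A) : Prop where
  mem : ∀ {n : ℕ} {x : D.Cohomology}, x ∈ D.cohomologyDeg n → ι x ∈ 𝒞 n
  represents : ∀ a : D.Cocycles, ι (D.cls a) - (a : A) ∈ LinearMap.range D.d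

/-- `ι : H(𝒞) → 𝒞` is a homomorphism of unital algebras, for the product
`[a][b] = [ab]` on cohomology. -/
structure IsAlgHom (ι : D.Cohomology →ₗ[ℝ] A) : Prop where
  map_one : ι (D.cls ⟨1, D.one_mem_cocycles⟩) = 1
  map_mul : ∀ a b : D.Cocycles,
    ι (D.cls ⟨(a : A) * b, D.mul_mem_cocycles a.2 b.2⟩) = ι (D.cls a) * ι (D.cls b)

/-- A relaxed chain homotopy for `ι`: a map `K` of degree `-1` with
`dK + Kd = 1 - ι ιᵀ`, graded self-adjoint, and with `K ι = 0`. Here `ρ = ιᵀ` is the transpose of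
`ι` for `π` on `𝒞` and the induced pairing `π(ι ·, ι ·)` on cohomology. -/
structure IsRelaxed (ι : D.Cohomology →ₗ[ℝ] A) (K : A →ₗ[ℝ] A) : Prop where
  mem : ∀ {n : ℕ} {a : A}, a ∈ 𝒞 (n + 1) → K a ∈ 𝒞 n
  mem_zero : ∀ {a : A}, a ∈ 𝒞 0 → K a = 0
  homotopy : ∃ ρ : A →ₗ[ℝ] D.Cohomology,
    (∀ a x, D.pair (ι (ρ a)) (ι x) = D.pair a (ι x)) ∧
    ∀ a, D.d (K a) + K (D.d a) = a - ι (ρ a)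
  symm : ∀ {i : ℕ} {a : A} (b : A), a ∈ 𝒞 i → D.pair (K a) b = (-1 : ℝ) ^ i * D.pair a (K b)
  comp_embedding : ∀ x, K (ι x) = 0

/-- A strict chain homotopy for `ι`: in addition `K² = 0`. -/
structure IsStrict (ι : D.Cohomology →ₗ[ℝ] A) (K : A →ₗ[ℝ] A) : Prop extends
    D.IsRelaxed ι K where
  sq_zero : ∀ a, K (K a) = 0

/-- `(δι, δK)` is an infinitesimal deformation of the relaxed induction data `(ι, K)` that
preserves the homomorphism property of `ι`: all the defining relations of the data hold for
`(ι + ε δι, K + ε δK)` modulo `ε²` (with `ρ + ε δρ` in the role of the transpose of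
`ι + ε δι`). -/
structure IsInfinitesimalDeformation (ι : D.Cohomology →ₗ[ℝ] A) (K : A →ₗ[ℝ] A)
    (δι : D.Cohomology →ₗ[ℝ] A) (δK : A →ₗ[ℝ] A) : Prop where
  embedding_mem : ∀ {n : ℕ} {x : D.Cohomology}, x ∈ D.cohomologyDeg n → δι x ∈ 𝒞 n
  represents : ∀ x, δι x ∈ LinearMap.range D.d
  map_one : δι (D.cls ⟨1, D.one_mem_cocycles⟩) = 0
  map_mul : ∀ a b : D.Cocycles,
    δι (D.cls ⟨(a : A) * b, D.mul_mem_cocycles a.2 b.2⟩) =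
      δι (D.cls a) * ι (D.cls b) + ι (D.cls a) * δι (D.cls b)
  mem : ∀ {n : ℕ} {a : A}, a ∈ 𝒞 (n + 1) → δK a ∈ 𝒞 n
  mem_zero : ∀ {a : A}, a ∈ 𝒞 0 → δK a = 0
  homotopy : ∃ ρ δρ : A →ₗ[ℝ] D.Cohomology,
    (∀ a x, D.pair (ι (ρ a)) (ι x) = D.pair a (ι x)) ∧
    (∀ a x, D.pair (δι (ρ a) + ι (δρ a)) (ι x) + D.pair (ι (ρ a)) (δι x) = D.pair a (δι x)) ∧
    ∀ a, D.d (δK a) + δK (D.d a) = -(δι (ρ a) + ι (δρ a))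
  symm : ∀ {i : ℕ} {a : A} (b : A), a ∈ 𝒞 i → D.pair (δK a) b = (-1 : ℝ) ^ i * D.pair a (δK b)
  comp_embedding : ∀ x, δK (ι x) + K (δι x) = 0

/-- The orthogonal complement `𝒞'' = ι(H)^⊥`. -/
def complement (ι : D.Cohomology →ₗ[ℝ] A) : Submodule ℝ A where
  carrier := {a | ∀ x, D.pair a (ι x) = 0}
  add_mem' ha hb x := by rw [map_add, LinearMap.add_apply, ha x, hb x, add_zero]
  zero_mem' x := by simp
  smul_mem' c a ha x := by rw [map_smul, LinearMap.smul_apply, ha x, smul_zero]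

/-- The degree `n` part of `𝒞''`. -/
def complementDeg (ι : D.Cohomology →ₗ[ℝ] A) (n : ℕ) : Submodule ℝ (D.complement ι) :=
  (𝒞 n).submoduleOf (D.complement ι)

end DGFrobenius

end Cohomology

/-- An invariant non-degenerate symmetric form on a Lie algebra (a quadratic Lie algebra). -/
structure IsQuadraticForm {g : Type*} [LieRing g] [LieAlgebra ℝ g]
    (κ : LinearMap.BilinForm ℝ g) : Prop where
  symm : ∀ x y, κ x y = κ y x
  nondegenerate : κ.Nondegenerate
  invariant : ∀ x y z, κ ⁅x, y⁆ z = κ x ⁅y, z⁆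

/-- A basis of a graded vector space consisting of homogeneous vectors. -/
structure HomogeneousBasis {V : Type*} [AddCommGroup V] [Module ℝ V] (gr : ℕ → Submodule ℝ V)
    (J : Type*) where
  basis : Module.Basis J ℝ V
  deg : J → ℕ
  mem : ∀ j, basis j ∈ gr (deg j)

/-! ## Formal functions on a graded vector space -/

/-- Formal functions in coordinates `x ∈ X` of ghost numbers `gh x`: power series in the
coordinates of even ghost number, with coefficients in the exterior algebra generated by the
coordinates of odd ghost number. -/
abbrev SFun {X : Type*} (gh : X → ℤ) : Type _ :=
  MvPowerSeries {x : X // Even (gh x)} (ExteriorAlgebra ℝ ({x : X // ¬ Even (gh x)} → ℝ))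

open Classical in
/-- The coordinate function `x`. -/
def coord {X : Type*} (gh : X → ℤ) (x : X) : SFun gh :=
  if h : Even (gh x) then MvPowerSeries.X ⟨x, h⟩
  else MvPowerSeries.C (ExteriorAlgebra.ι ℝ (Pi.single ⟨x, h⟩ (1 : ℝ)))

/-- Partial derivative along an even coordinate. -/
def evenDeriv {X : Type*} (gh : X → ℤ) (x : {x : X // Even (gh x)}) : SFun gh →ₗ[ℝ] SFun gh where
  toFun f := fun μ => (μ x + 1) • MvPowerSeries.coeff (μ + Finsupp.single x 1) f
  map_add' f f' := by
    funext μ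
    exact (congrArg _ (map_add (MvPowerSeries.coeff _) f f')).trans (smul_add _ _ _)
  map_smul' c f := by
    funext μ
    exact smul_comm (μ x + 1) c (MvPowerSeries.coeff (μ + Finsupp.single x 1) f)

/-- Left partial derivative along an odd coordinate: contraction on the coefficients. -/
def oddDeriv {X : Type*} (gh : X → ℤ) (x : {x : X // ¬ Even (gh x)}) :
    SFun gh →ₗ[ℝ] SFun gh :=
  (CliffordAlgebra.contractLeft (Q := (0 : QuadraticForm ℝ ({x : X // ¬ Even (gh x)} → ℝ)))
    (LinearMap.proj (R := ℝ) x)).compLeft ({x : X // Even (gh x)} →₀ ℕ)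

/-- Left partial derivative `∂/∂x`. -/
def deriv {X : Type*} (gh : X → ℤ) (x : X) : SFun gh →ₗ[ℝ] SFun gh :=
  if h : Even (gh x) then evenDeriv gh ⟨x, h⟩ else oddDeriv gh ⟨x, h⟩

/-- The restriction of a function of coordinates `X ⊕ Y` to the subspace where all coordinates
in `Y` vanish. -/
def setZero {X Y : Type*} (gh : X ⊕ Y → ℤ) (f : SFun gh) : SFun (fun x : X => gh (Sum.inl x)) :=
  fun μ => ExteriorAlgebra.map
    (LinearMap.funLeft ℝ ℝ fun x : {x : X // ¬ Even (gh (Sum.inl x))} =>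
      (⟨Sum.inl x.1, x.2⟩ : {z : X ⊕ Y // ¬ Even (gh z)}))
    (MvPowerSeries.coeff (μ.mapDomain fun x : {x : X // Even (gh (Sum.inl x))} =>
      (⟨Sum.inl x.1, x.2⟩ : {z : X ⊕ Y // Even (gh z)})) f)

/-- The sum of a sequence of formal functions, each monomial in the even coordinates of which
receives only finitely many non-zero contributions. -/
def formalSum {X : Type*} {gh : X → ℤ} (f : ℕ → SFun gh) : SFun gh :=
  fun μ => ∑ᶠ n, MvPowerSeries.coeff μ (f n)

/-- The restriction of a formal function to the line through a point `x` whose odd coordinates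
vanish, as a formal power series in the parameter of the line: `f (s x) = ∑ sⁿ fₙ(x)`, where `fₙ`
is the homogeneous component of degree `n`. -/
def restrictLine {X : Type*} [Fintype X] {gh : X → ℤ} (f : SFun gh) (x : X → ℝ) : PowerSeries ℝ :=
  open Classical in
  PowerSeries.mk fun n =>
    ∑ μ ∈ (Finset.univ : Finset {x : X // Even (gh x)}).finsuppAntidiag n,
      ExteriorAlgebra.algebraMapInv (MvPowerSeries.coeff μ f) * ∏ i, x i.1 ^ μ i

/-- The logarithm of a power series in `t` with constant term `1`. -/
def logSeries {R : Type*} [Ring R] [Module ℝ R] (Z : PowerSeries R) : PowerSeries R :=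
  PowerSeries.mk fun v =>
    ∑ j ∈ Finset.Icc 1 v, ((-1 : ℝ) ^ (j + 1) / j) • PowerSeries.coeff v ((Z - 1) ^ j)

/-! ## The abstract Chern--Simons action -/

section Action

variable {A : Type*} [Ring A] [Algebra ℝ A] {𝒞 : ℕ → Submodule ℝ A} [GradedAlgebra 𝒞]
  (D : DGFrobenius 𝒞) {g : Type*} [LieRing g] [LieAlgebra ℝ g] (κ : LinearMap.BilinForm ℝ g)

/-- The ghost number of the coordinate along a vector of degree `n` of `g ⊗ 𝒞`. -/
def ghost {X : Type*} (deg : X → ℕ) (x : X) : ℤ := 1 - (deg x : ℤ)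

/-- `½ π(φ, dφ)` for the field `φ = ∑ₓ (τ x ⊗ c x) · x` with homogeneous `c x` of degree
`deg x`. -/
def quadraticAction {X : Type*} [Fintype X] (deg : X → ℕ) (τ : X → g) (c : X → A) :
    SFun (ghost deg) :=
  (1 / 2 : ℝ) • ∑ x, ∑ y, ((-1 : ℝ) ^ (deg x + 1) * (κ (τ x) (τ y) * D.pair (c x) (D.d (c y)))) •
    (coord (ghost deg) x * coord (ghost deg) y)

/-- `⅙ π(φ, l(φ, φ))` for the field `φ = ∑ₓ (τ x ⊗ c x) · x` with homogeneous `c x` of degree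
`deg x`, where `l(τ ⊗ c, τ' ⊗ c') = [τ, τ'] ⊗ c c'`. -/
def cubicAction {X : Type*} [Fintype X] (deg : X → ℕ) (τ : X → g) (c : X → A) :
    SFun (ghost deg) :=
  (1 / 6 : ℝ) • ∑ x, ∑ y, ∑ z,
    ((-1 : ℝ) ^ (deg y * (deg z + 1)) *
      (κ (τ x) ⁅τ y, τ z⁆ * D.pair (c x) (c y * c z))) •
    (coord (ghost deg) x * coord (ghost deg) y * coord (ghost deg) z)

/-- The abstract Chern--Simons action `S(φ) = ½ π(φ, dφ) + ⅙ π(φ, l(φ, φ))`. -/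
def action {X : Type*} [Fintype X] (deg : X → ℕ) (τ : X → g) (c : X → A) : SFun (ghost deg) :=
  quadraticAction D κ deg τ c + cubicAction D κ deg τ c

/-! ## The effective action on cohomology

`T` is a basis of `g`, `h` a homogeneous basis of `H(𝒞)`, `u` a homogeneous basis of
`𝒞'' = ι(H)^⊥`. The coordinates on `F' = g ⊗ H[1]` are indexed by `J × 𝔞` (the field `α`), those
on `F'' = g ⊗ 𝒞''[1]` by `M × 𝔞` (the field `ω''`). -/

variable {𝔞 J M : Type*} [Fintype 𝔞] [Fintype J] [Fintype M] (T : Module.Basis 𝔞 ℝ g)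
  (h : HomogeneousBasis D.cohomologyDeg J) (ι : D.Cohomology →ₗ[ℝ] A) (K : A →ₗ[ℝ] A)
  (u : HomogeneousBasis (D.complementDeg ι) M)

/-- The degrees of the basis `T_a ⊗ h_p` of `g ⊗ H(𝒞)`. -/
def degH (𝔞 : Type*) (x : J × 𝔞) : ℕ := h.deg x.1

/-- The algebra `Fun(F')` of formal functions of `α`. -/
abbrev FunH (𝔞 : Type*) : Type _ := SFun (ghost (degH D h 𝔞))

/-- `W_prod(α) = ⅙ π(ι(α), l(ι(α), ι(α)))`. -/
def Wprod : FunH D h 𝔞 :=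
  cubicAction D κ (degH D h 𝔞) (fun x => T x.2) (fun x => ι (h.basis x.1))

/-- The degrees of the coordinates on `F' ⊕ F''`. -/
def degTotal (𝔞 : Type*) : (J × 𝔞) ⊕ (M × 𝔞) → ℕ :=
  Sum.elim (fun x => h.deg x.1) (fun x => u.deg x.1)

/-- `S(ι(α) + ω'') - S₀(ω'')` as a function of `(α, ω'')`, where `S₀(ω'') = ½ π(ω'', dω'')`. -/
def interaction : SFun (ghost (degTotal D h ι u 𝔞)) :=
  action D κ (degTotal D h ι u 𝔞) (Sum.elim (fun x => T x.2) (fun x => T x.2))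
      (Sum.elim (fun x => ι (h.basis x.1)) (fun x => (u.basis x.1 : A))) -
    quadraticAction D κ (degTotal D h ι u 𝔞) (Sum.elim (fun x => T x.2) (fun x => T x.2))
      (Sum.elim (fun _ => 0) (fun x => (u.basis x.1 : A)))

open Classical in
/-- The components `K^{mn} = ∑ₗ K^m_l (π⁻¹)^{ln}` of the propagator in the basis `u` of `𝒞''`,
where `π⁻¹` is the inverse of the matrix of `π` on `𝒞''`. The matrix `K^m_l` of `K` in this basis
is itself `∑ₖ (π⁻¹)^{mk} π(u_k, K u_l)`. -/
def propagator : Matrix M M ℝ :=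
  (Matrix.of fun m n => D.pair (u.basis m : A) (u.basis n : A))⁻¹ *
    (Matrix.of fun m n => D.pair (u.basis m : A) (K (u.basis n : A))) *
    (Matrix.of fun m n => D.pair (u.basis m : A) (u.basis n : A))⁻¹

open Classical in
/-- The operator `-½ π⁻¹(∂/∂ω'', K ∂/∂ω'')`, i.e.
`-½ ∑ K^{mn} (κ⁻¹)^{ab} ∂/∂ω''^{ma} ∂/∂ω''^{nb}`. -/
def wickOperator : Module.End ℝ (SFun (ghost (degTotal D h ι u 𝔞))) :=
  (-1 / 2 : ℝ) • ∑ m, ∑ n, ∑ a, ∑ b,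
    (propagator D ι K u m n * (Matrix.of fun a b => κ (T a) (T b))⁻¹ a b) •
      (deriv (ghost (degTotal D h ι u 𝔞)) (Sum.inr (m, a)) ∘ₗ
        deriv (ghost (degTotal D h ι u 𝔞)) (Sum.inr (n, b)))

/-- The term of order `ħᵐ` of `e^{-ħ ½ π⁻¹(∂/∂ω'', K ∂/∂ω'')}|_{ω''=0} ∘ Vᵛ / v!`, with
`V = S(ι(α) + ω'') - S₀(ω'')`. -/
def wickTerm (v m : ℕ) : FunH D h 𝔞 :=
  (1 / ((v.factorial : ℝ) * (m.factorial : ℝ))) •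
    setZero (ghost (degTotal D h ι u 𝔞))
      ((wickOperator D κ T h ι K u ^ m) (interaction D κ T h ι u ^ v))

/-- The series `e^{-ħ ½ π⁻¹(∂/∂ω'', K ∂/∂ω'')}|_{ω''=0} ∘ e^{t (S(ι(α)+ω'') - S₀(ω'')) / ħ}`,
with values in Laurent series in `ħ` over `Fun(F')`. The formal variable `t` in front of the
interaction organises the expansion: the coefficient of `tᵛ` is the contribution of `v`
vertices. -/
def partitionSeries : PowerSeries (LaurentSeries (FunH D h 𝔞)) :=
  PowerSeries.mk fun v =>
    HahnSeries.single (-(v : ℤ)) 1 *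
      HahnSeries.ofPowerSeries ℤ (FunH D h 𝔞) (PowerSeries.mk fun m => wickTerm D κ T h ι K u v m)

/-- The coefficient of `ħˡ` in the effective action
`Ind_{ι,K}(S)(α) = ħ log (e^{-ħ ½ π⁻¹(∂/∂ω'', K ∂/∂ω'')}|_{ω''=0} ∘
  e^{(S(ι(α)+ω'') - S₀(ω'')) / ħ})`.
The variable `t` is set to `1` by summing over all orders `v` in `t`; for given `l` the order `v`
is homogeneous of degree `v - 2 (l - 1)` in `α`, so each monomial receives finitely many
contributions. -/
def effectiveAction (l : ℤ) : FunH D h 𝔞 :=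
  formalSum fun v =>
    (PowerSeries.coeff v (logSeries (partitionSeries D κ T h ι K u))).coeff (l - 1)

/-! ## The super-trace formula and the Maurer--Cartan set -/

variable {I : Type*} [Fintype I] (e : HomogeneousBasis 𝒞 I)

/-- The matrix over `Fun(F')` of the operator `K ∘ l(ι(α), •)` on `(g ⊗ 𝒞) ⊗ Fun(F')`, in the
basis `T_a ⊗ e_i`, with coefficients in `Fun(F')` written on the right:
`l(ι(α), T_b ⊗ e_j) = ∑ (-1)^{gh(α^{pc}) |e_j|} ([T_c, T_b] ⊗ ι(h_p) e_j) α^{pc}`. -/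
def superMatrix : Matrix (I × 𝔞) (I × 𝔞) (FunH D h 𝔞) :=
  Matrix.of fun r s => ∑ x : J × 𝔞,
    ((-1 : ℝ) ^ ((h.deg x.1 + 1) * e.deg s.1) *
      (e.basis.repr (K (ι (h.basis x.1) * e.basis s.1)) r.1 * T.repr ⁅T x.2, T s.2⁆ r.2)) •
    coord (ghost (degH D h 𝔞)) x

/-- The super-trace over `g ⊗ 𝒞`. -/
def superTrace (N : Matrix (I × 𝔞) (I × 𝔞) (FunH D h 𝔞)) : FunH D h 𝔞 :=
  ∑ r, (-1 : ℝ) ^ e.deg r.1 • N r r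

open Classical in
/-- `½ Str_{g ⊗ 𝒞} log (1 + K ∘ l(ι(α), •))`, with
`log (1 + N) = ∑_{n ≥ 0} (-1)ⁿ Nⁿ⁺¹ / (n + 1)`. -/
def halfStrLog : FunH D h 𝔞 :=
  (1 / 2 : ℝ) • formalSum fun n =>
    ((-1 : ℝ) ^ n / ((n : ℝ) + 1)) • superTrace D h e (superMatrix D T h ι K e ^ (n + 1))

/-- The Maurer--Cartan set in `H¹(𝒞, g)[1]`: the points with real coordinates `x (p, a)`,
supported on the classes `h_p` of degree `1`, such that `∑_{j,k} μ_{ijk} [α^j, α^k] = 0` for all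
`i` with `h_i` of degree `1`, where `α^j = ∑ₐ x (j, a) T_a` and
`μ_{ijk} = π(ι(h_i), ι(h_j) ι(h_k))`. -/
def MC : Set (J × 𝔞 → ℝ) :=
  {x | (∀ p a, h.deg p ≠ 1 → x (p, a) = 0) ∧
    ∀ i, h.deg i = 1 →
      ∑ j, ∑ k, D.pair (ι (h.basis i)) (ι (h.basis j) * ι (h.basis k)) •
        ⁅∑ a, x (j, a) • T a, ∑ a, x (k, a) • T a⁆ = 0}

end Action

end AbstractCS

end

open AbstractCS

set_option linter.unusedSectionVars false

noncomputable section

namespace AbstractCS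

/-! ## Calculus of formal functions -/

section Calculus

variable {X Y : Type*}

/-! The integral over `ω''` is Gaussian with a cubic interaction. Because `ι` is a homomorphism, a
product of two elements of `ι(H)` lies in `ι(H)`, hence is orthogonal to `𝒞''`, and the interaction
has no term linear in `ω''` (`interactionCoeff_eq_zero`). It is the sum of `W_prod(α)`, a quadratic
form in `ω''` with coefficients linear in `α`, and a cubic form in `ω''`. The first summand factors
out of the integral. Every other vertex carries at least two `ω''` legs, so `v` vertices need at
least `v` propagators: no negative power of `ħ` survives, and the one-loop coefficient sees only the
quadratic form (`logSeries_cubic`). Wick's theorem gives a Schwinger-Dyson recursion for the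
Gaussian integral (`gauss_recursion`), whose logarithm is a sum of super-traces of powers of
propagator times quadratic form. That product is the matrix of `K ∘ l(ι(α), •)` on `g ⊗ 𝒞''`, and
cyclicity carries its super-traces over to `g ⊗ 𝒞` (`effectiveAction_one`).

On the line through a Maurer-Cartan point the one-loop term reduces to the numbers `Str (K L)^n`
with `L = l(ω, •)`, `ω = ι(α)`. There `L² = 0`, `d L = -L d`, and `L` commutes with `P = ι ιᵀ`
(`isTwistedRetract`). The first-order variation of such a number is governed by `Str ((δK L + K δL)
(K L)^m)`. For the part with `δK`: `L (K L)^(m+1)` is closed and killed by `P` on both sides, while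
the varied homotopy relation splits `δK` into terms that `P` or cyclicity removes
(`trace_homotopy_variation`). For the part with `δL`: `δω = dβ` is exact, and moving `d` once around
the loop removes a factor `K L` and replaces `β` by `K l(ω, β)` (`trace_exact_variation`). At the
end a loop with one vertex remains, which vanishes since `ad` is traceless on a quadratic Lie
algebra (`trace_exact_eq_zero`).

Relaxed homotopies for a fixed `ι` form an affine space, so a segment joins a relaxed one to any
strict one (`pointTrace_eq_of_relaxed`). Along a family the derivative vanishes at every parameter,
because the Maurer-Cartan equation can be written in `H ⊗ g` without reference to an embedding
(`maurerCartan`) and so holds for every member. -/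

open Classical in
/-- The Koszul sign of two coordinates. -/
def koszul (gh : X → ℤ) (x y : X) : ℝ := if Even (gh x) ∨ Even (gh y) then 1 else -1

theorem coord_even {gh : X → ℤ} {x : X} (hx : Even (gh x)) :
    coord gh x = MvPowerSeries.X ⟨x, hx⟩ := by
  rw [coord, dif_pos hx]

open Classical in
theorem coord_odd {gh : X → ℤ} {x : X} (hx : ¬ Even (gh x)) :
    coord gh x = MvPowerSeries.C (ExteriorAlgebra.ι ℝ (Pi.single ⟨x, hx⟩ (1 : ℝ))) := by
  rw [coord, dif_neg hx]

theorem koszul_even_left {gh : X → ℤ} {x : X} (hx : Even (gh x)) (y : X) :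
    koszul gh x y = 1 := by
  rw [koszul, if_pos (Or.inl hx)]

theorem koszul_even_right {gh : X → ℤ} (x : X) {y : X} (hy : Even (gh y)) :
    koszul gh x y = 1 := by
  rw [koszul, if_pos (Or.inr hy)]

theorem koszul_odd {gh : X → ℤ} {x y : X} (hx : ¬ Even (gh x)) (hy : ¬ Even (gh y)) :
    koszul gh x y = -1 := by
  rw [koszul, if_neg (not_or.mpr ⟨hx, hy⟩)]

theorem coord_mul_coord (gh : X → ℤ) (x y : X) :
    coord gh x * coord gh y = koszul gh x y • (coord gh y * coord gh x) := by
  by_cases hx : Even (gh x)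
  · rw [koszul_even_left hx, one_smul, coord_even hx]
    exact ((MvPowerSeries.commute_X _ _).eq).symm
  by_cases hy : Even (gh y)
  · rw [koszul_even_right x hy, one_smul, coord_even hy]
    exact (MvPowerSeries.commute_X _ _).eq
  classical
  rw [koszul_odd hx hy, neg_one_smul, coord_odd hx, coord_odd hy,
    ← map_mul (MvPowerSeries.C), ← map_mul (MvPowerSeries.C), ← map_neg (MvPowerSeries.C),
    eq_neg_of_add_eq_zero_left (ExteriorAlgebra.ι_add_mul_swap _ _)]

theorem coeff_evenDeriv (gh : X → ℤ) (x : {x : X // Even (gh x)}) (f : SFun gh)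
    (μ : {x : X // Even (gh x)} →₀ ℕ) :
    MvPowerSeries.coeff μ (evenDeriv gh x f) =
      (μ x + 1) • MvPowerSeries.coeff (μ + Finsupp.single x 1) f := rfl

theorem coeff_oddDeriv (gh : X → ℤ) (x : {x : X // ¬ Even (gh x)}) (f : SFun gh)
    (μ : {x : X // Even (gh x)} →₀ ℕ) :
    MvPowerSeries.coeff μ (oddDeriv gh x f) =
      CliffordAlgebra.contractLeft (Q := (0 : QuadraticForm ℝ ({x : X // ¬ Even (gh x)} → ℝ)))
        (LinearMap.proj (R := ℝ) x) (MvPowerSeries.coeff μ f) := rfl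

theorem deriv_even {gh : X → ℤ} {x : X} (hx : Even (gh x)) :
    deriv gh x = evenDeriv gh ⟨x, hx⟩ := by
  rw [deriv, dif_pos hx]

theorem deriv_odd {gh : X → ℤ} {x : X} (hx : ¬ Even (gh x)) :
    deriv gh x = oddDeriv gh ⟨x, hx⟩ := by
  rw [deriv, dif_neg hx]

open Classical in
theorem coeff_X_mul' {σ R : Type*} [Semiring R] (s : σ) (f : MvPowerSeries σ R) (μ : σ →₀ ℕ) :
    MvPowerSeries.coeff μ (MvPowerSeries.X s * f) =
      if μ s = 0 then 0 else MvPowerSeries.coeff (μ - Finsupp.single s 1) f := by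
  rw [MvPowerSeries.X_def, MvPowerSeries.coeff_monomial_mul, one_mul]
  have : Finsupp.single s 1 ≤ μ ↔ ¬ μ s = 0 := by
    rw [Finsupp.single_le_iff]; omega
  simp only [this, ite_not]

open Classical in
-- The graded Leibniz rule on a generator. The rules for derivatives of longer products follow by
-- induction on words in the coordinates, so none is needed for arbitrary pairs of series.
theorem deriv_coord_mul (gh : X → ℤ) (x y : X) (f : SFun gh) :
    deriv gh x (coord gh y * f) =
      (if x = y then f else 0) + koszul gh x y • (coord gh y * deriv gh x f) := by
  by_cases hx : Even (gh x)
  · rw [koszul_even_left hx, one_smul, deriv_even hx]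
    by_cases hy : Even (gh y)
    · rw [coord_even hy]
      ext μ : 1
      rw [map_add, coeff_evenDeriv, coeff_X_mul', coeff_X_mul', coeff_evenDeriv]
      by_cases hxy : x = y
      · subst hxy
        simp only [Finsupp.add_apply, Finsupp.single_eq_same, Nat.add_eq_zero_iff, one_ne_zero,
          and_false, if_false, if_true, add_tsub_cancel_right]
        by_cases h0 : μ ⟨x, hx⟩ = 0
        · simp [h0]
        · rw [if_neg h0]
          have : μ - Finsupp.single ⟨x, hx⟩ 1 + Finsupp.single ⟨x, hx⟩ 1 = μ :=
            tsub_add_cancel_of_le (by rw [Finsupp.single_le_iff]; omega)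
          -- The multiplicity `μ x + 1` splits: the `1` is the Kronecker term, and `μ x` is the
          -- multiplicity occurring in the derivative of `f`.
          rw [this, add_smul, one_smul, add_comm]
          congr 2
          simp
          omega
      · have hne : (⟨x, hx⟩ : {x : X // Even (gh x)}) ≠ ⟨y, hy⟩ := by simpa using hxy
        rw [if_neg hxy, map_zero, zero_add]
        rw [show (μ + Finsupp.single (⟨x, hx⟩ : {x : X // Even (gh x)}) 1 : _ →₀ ℕ) ⟨y, hy⟩
            = μ ⟨y, hy⟩ by simp [hne]]
        by_cases h0 : μ ⟨y, hy⟩ = 0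
        · simp [h0]
        · rw [if_neg h0, if_neg h0]
          have h2 : μ + Finsupp.single ⟨x, hx⟩ 1 - Finsupp.single ⟨y, hy⟩ 1 =
              μ - Finsupp.single ⟨y, hy⟩ 1 + Finsupp.single ⟨x, hx⟩ 1 :=
            tsub_add_eq_add_tsub (by rw [Finsupp.single_le_iff]; omega) |>.symm
          rw [h2]
          congr 2
          simp [Ne.symm hne]
    · have hxy : x ≠ y := fun h => hy (h ▸ hx)
      rw [if_neg hxy, zero_add, coord_odd hy]
      ext μ : 1
      rw [coeff_evenDeriv, MvPowerSeries.coeff_C_mul, MvPowerSeries.coeff_C_mul, coeff_evenDeriv,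
        mul_smul_comm]
  · rw [deriv_odd hx]
    by_cases hy : Even (gh y)
    · have hxy : x ≠ y := fun h => hx (h ▸ hy)
      rw [if_neg hxy, zero_add, coord_even hy, koszul_even_right x hy, one_smul]
      ext μ : 1
      rw [coeff_oddDeriv, coeff_X_mul', coeff_X_mul', coeff_oddDeriv]
      split_ifs <;> simp
    · rw [koszul_odd hx hy, neg_one_smul, coord_odd hy]
      ext μ : 1
      rw [map_add, map_neg, coeff_oddDeriv, MvPowerSeries.coeff_C_mul, MvPowerSeries.coeff_C_mul,
        coeff_oddDeriv]
      refine (CliffordAlgebra.contractLeft_ι_mul _ _ _).trans ?_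
      rw [sub_eq_add_neg]
      congr 1
      by_cases hxy : x = y
      · subst hxy; simp
      · have hne : (⟨x, hx⟩ : {x : X // ¬ Even (gh x)}) ≠ ⟨y, hy⟩ := by simpa using hxy
        simp [hxy, hne]

theorem deriv_one (gh : X → ℤ) (x : X) : deriv gh x 1 = 0 := by
  classical
  by_cases hx : Even (gh x)
  · rw [deriv_even hx]
    ext μ : 1
    rw [coeff_evenDeriv, MvPowerSeries.coeff_one, if_neg, smul_zero, map_zero]
    intro h
    have := DFunLike.congr_fun h ⟨x, hx⟩
    simp at this
  · rw [deriv_odd hx]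
    ext μ : 1
    rw [coeff_oddDeriv, MvPowerSeries.coeff_one, map_zero]
    split_ifs
    · exact CliffordAlgebra.contractLeft_one _ _
    · exact map_zero _

/-- Even derivatives act on exponents and odd ones on exterior coefficients, so a sign arises only
between two odd ones, where contractions anticommute. -/
theorem deriv_deriv (gh : X → ℤ) (x y : X) (f : SFun gh) :
    deriv gh x (deriv gh y f) = koszul gh x y • deriv gh y (deriv gh x f) := by
  classical
  by_cases hx : Even (gh x)
  · rw [koszul_even_left hx, one_smul, deriv_even hx]
    by_cases hy : Even (gh y)
    · rw [deriv_even hy]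
      ext μ : 1
      simp only [coeff_evenDeriv, smul_smul]
      rw [add_right_comm]
      by_cases hxy : x = y
      · subst hxy; rfl
      · have hne : (⟨x, hx⟩ : {x : X // Even (gh x)}) ≠ ⟨y, hy⟩ := by simpa using hxy
        congr 1
        simp [hne, Ne.symm hne, mul_comm]
    · rw [deriv_odd hy]
      ext μ : 1
      rw [coeff_evenDeriv, coeff_oddDeriv, coeff_oddDeriv, coeff_evenDeriv, map_nsmul]
  · rw [deriv_odd hx]
    by_cases hy : Even (gh y)
    · rw [deriv_even hy, koszul_even_right x hy, one_smul]
      ext μ : 1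
      rw [coeff_evenDeriv, coeff_oddDeriv, coeff_oddDeriv, coeff_evenDeriv, map_nsmul]
    · rw [deriv_odd hy, koszul_odd hx hy, neg_one_smul]
      ext μ : 1
      rw [map_neg, coeff_oddDeriv, coeff_oddDeriv, coeff_oddDeriv, coeff_oddDeriv]
      exact CliffordAlgebra.contractLeft_comm _ _ _

/-- `setZero` as a linear map. -/
def setZeroL (gh : X ⊕ Y → ℤ) : SFun gh →ₗ[ℝ] SFun (fun x : X => gh (Sum.inl x)) where
  toFun := setZero gh
  map_add' f f' := by
    funext μ
    exact (congrArg _ (map_add (MvPowerSeries.coeff _) f f')).trans (map_add _ _ _)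
  map_smul' c f := by
    funext μ
    exact map_smul (ExteriorAlgebra.map _).toLinearMap c _

theorem coeff_setZeroL (gh : X ⊕ Y → ℤ) (f : SFun gh)
    (μ : {x : X // Even (gh (Sum.inl x))} →₀ ℕ) :
    MvPowerSeries.coeff μ (setZeroL gh f) = ExteriorAlgebra.map
    (LinearMap.funLeft ℝ ℝ fun x : {x : X // ¬ Even (gh (Sum.inl x))} =>
      (⟨Sum.inl x.1, x.2⟩ : {z : X ⊕ Y // ¬ Even (gh z)}))
    (MvPowerSeries.coeff (μ.mapDomain fun x : {x : X // Even (gh (Sum.inl x))} =>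
      (⟨Sum.inl x.1, x.2⟩ : {z : X ⊕ Y // Even (gh z)})) f) := rfl

theorem inl_even_injective (gh : X ⊕ Y → ℤ) : Function.Injective
    (fun x : {x : X // Even (gh (Sum.inl x))} =>
      (⟨Sum.inl x.1, x.2⟩ : {z : X ⊕ Y // Even (gh z)})) := by
  intro a b hab
  simpa [Subtype.ext_iff] using hab

theorem setZeroL_one (gh : X ⊕ Y → ℤ) : setZeroL gh 1 = 1 := by
  classical
  ext μ : 1
  rw [coeff_setZeroL, MvPowerSeries.coeff_one, MvPowerSeries.coeff_one]
  have : (μ.mapDomain fun x : {x : X // Even (gh (Sum.inl x))} =>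
      (⟨Sum.inl x.1, x.2⟩ : {z : X ⊕ Y // Even (gh z)})) = 0 ↔ μ = 0 := by
    constructor
    · intro h
      exact Finsupp.mapDomain_injective (inl_even_injective gh) (h.trans Finsupp.mapDomain_zero.symm)
    · rintro rfl; exact Finsupp.mapDomain_zero
  simp only [this]
  split_ifs <;> simp

/-- Together with `setZeroL_one` and `setZeroL_inr_mul` this determines the restriction on words in
the coordinates, which replaces multiplicativity on all series. -/
theorem setZeroL_inl_mul (gh : X ⊕ Y → ℤ) (x : X) (f : SFun gh) :
    setZeroL gh (coord gh (Sum.inl x) * f) =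
      coord (fun x : X => gh (Sum.inl x)) x * setZeroL gh f := by
  classical
  by_cases hx : Even (gh (Sum.inl x))
  · rw [coord_even hx, coord_even (gh := fun x : X => gh (Sum.inl x)) hx]
    ext μ : 1
    rw [coeff_setZeroL, coeff_X_mul', coeff_X_mul', coeff_setZeroL]
    have h1 := Finsupp.mapDomain_apply (inl_even_injective gh) μ ⟨x, hx⟩
    simp only at h1
    rw [h1]
    split_ifs with h0
    · simp
    · congr 3
      have h3 : Finsupp.single ⟨x, hx⟩ 1 ≤ μ := by rw [Finsupp.single_le_iff]; omega
      obtain ⟨ν, rfl⟩ := exists_add_of_le h3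
      rw [add_tsub_cancel_left, Finsupp.mapDomain_add, Finsupp.mapDomain_single,
        add_tsub_cancel_left]
  · rw [coord_odd hx, coord_odd (gh := fun x : X => gh (Sum.inl x)) hx]
    ext μ : 1
    rw [coeff_setZeroL, MvPowerSeries.coeff_C_mul, MvPowerSeries.coeff_C_mul, coeff_setZeroL,
      map_mul]
    congr 1
    rw [ExteriorAlgebra.map_apply_ι]
    congr 1
    ext z
    by_cases hz : z = ⟨x, hx⟩
    · subst hz; simp [LinearMap.funLeft_apply]
    · have : z.1 ≠ x := fun h => hz (Subtype.ext h)
      simp [LinearMap.funLeft_apply, this, hz]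

theorem setZeroL_inr_mul (gh : X ⊕ Y → ℤ) (y : Y) (f : SFun gh) :
    setZeroL gh (coord gh (Sum.inr y) * f) = 0 := by
  classical
  by_cases hy : Even (gh (Sum.inr y))
  · rw [coord_even hy]
    ext μ : 1
    rw [coeff_setZeroL, coeff_X_mul', if_pos, map_zero, map_zero]
    apply Finsupp.mapDomain_of_notMem_range
    rintro ⟨a, ha⟩
    simp at ha
  · rw [coord_odd hy]
    ext μ : 1
    rw [coeff_setZeroL, MvPowerSeries.coeff_C_mul, map_mul, ExteriorAlgebra.map_apply_ι, map_zero]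
    refine (congrArg (· * _) ((congrArg (ExteriorAlgebra.ι ℝ) ?_).trans (map_zero _))).trans
      (zero_mul _)
    ext z
    simp [LinearMap.funLeft_apply]

end Calculus

/-! ## Polynomials in the coordinates, filtered by weight and graded by parity -/

/-- The bicharacter `(-1)^{ij}` on `ℤ/2`. -/
def eps (i j : ZMod 2) : ℝ := if i = 0 ∨ j = 0 then 1 else -1

theorem eps_symm (i j : ZMod 2) : eps i j = eps j i := by
  simp only [eps, or_comm]

theorem zmod_two_cases (i : ZMod 2) : i = 0 ∨ i = 1 := by
  revert i; decide

@[simp] theorem eps_zero_left (j : ZMod 2) : eps 0 j = 1 := by simp [eps]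

@[simp] theorem eps_zero_right (j : ZMod 2) : eps j 0 = 1 := by simp [eps]

@[simp] theorem eps_one_one : eps 1 1 = -1 := by simp [eps]

theorem one_add_one_zmod_two : (1 : ZMod 2) + 1 = 0 := by decide

theorem eps_add_left (i j k : ZMod 2) : eps (i + j) k = eps i k * eps j k := by
  rcases zmod_two_cases i with rfl | rfl <;> rcases zmod_two_cases j with rfl | rfl <;>
    rcases zmod_two_cases k with rfl | rfl <;> simp [one_add_one_zmod_two]

theorem eps_add_right (i j k : ZMod 2) : eps i (j + k) = eps i j * eps i k := by
  rw [eps_symm, eps_add_left, eps_symm j, eps_symm k]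

theorem eps_mul_self (i j : ZMod 2) : eps i j * eps i j = 1 := by
  rcases zmod_two_cases i with rfl | rfl <;> rcases zmod_two_cases j with rfl | rfl <;> simp

theorem eps_natCast (a b : ℕ) : eps a b = (-1 : ℝ) ^ (a * b) := by
  rcases Nat.even_or_odd a with ha | ha <;> rcases Nat.even_or_odd b with hb | hb
  · rw [(ZMod.natCast_eq_zero_iff_even).2 ha, eps_zero_left, (ha.mul_right b).neg_one_pow]
  · rw [(ZMod.natCast_eq_zero_iff_even).2 ha, eps_zero_left, (ha.mul_right b).neg_one_pow]
  · rw [(ZMod.natCast_eq_zero_iff_even).2 hb, eps_zero_right, (hb.mul_left a).neg_one_pow]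
  · rw [(ZMod.natCast_eq_one_iff_odd).2 ha, (ZMod.natCast_eq_one_iff_odd).2 hb, eps_one_one,
      (ha.mul hb).neg_one_pow]

section Pieces

variable {X Y : Type*}

open Classical in
/-- The parity of a coordinate. -/
def par (gh : X → ℤ) (x : X) : ZMod 2 := if Even (gh x) then 0 else 1

theorem koszul_eq_eps (gh : X → ℤ) (x y : X) : koszul gh x y = eps (par gh x) (par gh y) := by
  by_cases hx : Even (gh x) <;> by_cases hy : Even (gh y) <;> simp [koszul, par, hx, hy]

/-- The span of the products of coordinates of total weight at least `n` and total
parity `i`. -/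
def piece (gh : X → ℤ) (w : X → ℕ) (n : ℕ) (i : ZMod 2) : Submodule ℝ (SFun gh) :=
  Submodule.span ℝ {f | ∃ l : List X, f = (l.map (coord gh)).prod ∧ n ≤ (l.map w).sum ∧
    (l.map (par gh)).sum = i}

variable {gh : X → ℤ} {w : X → ℕ}

theorem list_mem_piece (l : List X) :
    (l.map (coord gh)).prod ∈ piece gh w (l.map w).sum (l.map (par gh)).sum :=
  Submodule.subset_span ⟨l, rfl, le_rfl, rfl⟩

theorem piece_mono {m n : ℕ} (hmn : m ≤ n) (i : ZMod 2) : piece gh w n i ≤ piece gh w m i :=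
  Submodule.span_mono fun _ ⟨l, h1, h2, h3⟩ => ⟨l, h1, hmn.trans h2, h3⟩

theorem coord_mem_piece (x : X) : coord gh x ∈ piece gh w (w x) (par gh x) :=
  Submodule.subset_span ⟨[x], by simp⟩

theorem one_mem_piece : (1 : SFun gh) ∈ piece gh w 0 0 :=
  Submodule.subset_span ⟨[], by simp⟩

theorem mul_mem_piece {m n : ℕ} {i j : ZMod 2} {f f' : SFun gh} (hf : f ∈ piece gh w m i)
    (hf' : f' ∈ piece gh w n j) : f * f' ∈ piece gh w (m + n) (i + j) := by
  refine Submodule.span_induction ?_ ?_ ?_ ?_ hf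
  · rintro _ ⟨l, rfl, h2, rfl⟩
    refine Submodule.span_induction ?_ ?_ ?_ ?_ hf'
    · rintro _ ⟨l', rfl, h2', rfl⟩
      exact Submodule.subset_span ⟨l ++ l', by simp, by simpa using add_le_add h2 h2', by simp⟩
    · simp
    · intro a b _ _ ha hb; rw [mul_add]; exact add_mem ha hb
    · intro c a _ ha; rw [mul_smul_comm]; exact Submodule.smul_mem _ c ha
  · simp
  · intro a b _ _ ha hb; rw [add_mul]; exact add_mem ha hb
  · intro c a _ ha; rw [smul_mul_assoc]; exact Submodule.smul_mem _ c ha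

theorem pow_mem_piece {n : ℕ} {f : SFun gh} (hf : f ∈ piece gh w n 0) (v : ℕ) :
    f ^ v ∈ piece gh w (v * n) 0 := by
  induction v with
  | zero => simpa using one_mem_piece
  | succ v ih =>
    rw [pow_succ, add_mul, one_mul]
    simpa using mul_mem_piece ih hf

theorem coord_mul_list (x : X) (l : List X) :
    coord gh x * (l.map (coord gh)).prod =
      eps (par gh x) (l.map (par gh)).sum • ((l.map (coord gh)).prod * coord gh x) := by
  induction l with
  | nil => simp
  | cons y l ih =>
    simp only [List.map_cons, List.prod_cons, List.sum_cons]
    rw [← mul_assoc, coord_mul_coord, koszul_eq_eps, smul_mul_assoc, mul_assoc, ih, mul_smul_comm,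
      smul_smul, eps_add_right, mul_assoc]

theorem list_mul_list (l l' : List X) :
    (l.map (coord gh)).prod * (l'.map (coord gh)).prod =
      eps (l.map (par gh)).sum (l'.map (par gh)).sum •
        ((l'.map (coord gh)).prod * (l.map (coord gh)).prod) := by
  induction l with
  | nil => simp
  | cons y l ih =>
    simp only [List.map_cons, List.prod_cons, List.sum_cons]
    rw [mul_assoc, ih, mul_smul_comm, ← mul_assoc, coord_mul_list, smul_mul_assoc, smul_smul,
      eps_add_left, mul_assoc, mul_comm (eps _ _)]

/-- Parities are what matters; the weights play no role and may differ for the two factors. -/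
theorem mul_comm_of_mem_piece {w' : X → ℕ} {m n : ℕ} {i j : ZMod 2} {f f' : SFun gh}
    (hf : f ∈ piece gh w m i) (hf' : f' ∈ piece gh w' n j) : f * f' = eps i j • (f' * f) := by
  refine Submodule.span_induction ?_ ?_ ?_ ?_ hf
  · rintro _ ⟨l, rfl, h2, rfl⟩
    refine Submodule.span_induction ?_ ?_ ?_ ?_ hf'
    · rintro _ ⟨l', rfl, h2', rfl⟩
      exact list_mul_list l l'
    · simp
    · intro a b _ _ ha hb; rw [mul_add, add_mul, smul_add, ha, hb]
    · intro c a _ ha; rw [mul_smul_comm, ha, smul_mul_assoc, smul_comm]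
  · simp
  · intro a b _ _ ha hb; rw [mul_add, add_mul, smul_add, ha, hb]
  · intro c a _ ha; rw [mul_smul_comm, smul_mul_assoc, ha, smul_comm]

theorem commute_of_mem_piece {w' : X → ℕ} {m n : ℕ} {f f' : SFun gh}
    (hf : f ∈ piece gh w m 0) (hf' : f' ∈ piece gh w' n 0) : Commute f f' :=
  (mul_comm_of_mem_piece hf hf').trans (by rw [eps_zero_left, one_smul])

theorem par_add_self (x : X) : par gh x + par gh x = 0 := by
  rcases zmod_two_cases (par gh x) with h | h <;> rw [h] <;> decide

theorem add_self_zmod_two (i : ZMod 2) : i + i = 0 := by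
  rcases zmod_two_cases i with h | h <;> rw [h] <;> decide

theorem deriv_mem_piece {n : ℕ} {i : ZMod 2} (x : X) {f : SFun gh} (hf : f ∈ piece gh w n i) :
    deriv gh x f ∈ piece gh w (n - w x) (i + par gh x) := by
  classical
  refine Submodule.span_induction ?_ ?_ ?_ ?_ hf
  · rintro _ ⟨l, rfl, h2, rfl⟩
    refine piece_mono (Nat.sub_le_sub_right h2 _) _ ?_
    clear h2 hf
    induction l with
    | nil => simp [deriv_one]
    | cons y l ih =>
      simp only [List.map_cons, List.prod_cons, List.sum_cons]
      rw [deriv_coord_mul]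
      refine add_mem ?_ (Submodule.smul_mem _ _ ?_)
      · split_ifs with hxy
        · subst hxy
          rw [add_right_comm, par_add_self, zero_add, Nat.add_sub_cancel_left]
          exact list_mem_piece l
        · exact zero_mem _
      · rw [add_assoc]
        exact piece_mono (by omega) _ (mul_mem_piece (coord_mem_piece y) ih)
  · simp
  · intro a b _ _ ha hb; rw [map_add]; exact add_mem ha hb
  · intro c a _ ha; rw [map_smul]; exact Submodule.smul_mem _ c ha

/-- Only the factor that the derivative passes over needs a parity, so `f'` may be any series. -/
theorem deriv_mul {n : ℕ} {i : ZMod 2} (x : X) {f : SFun gh} (hf : f ∈ piece gh w n i)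
    (f' : SFun gh) :
    deriv gh x (f * f') = deriv gh x f * f' + eps (par gh x) i • (f * deriv gh x f') := by
  classical
  refine Submodule.span_induction ?_ ?_ ?_ ?_ hf
  · rintro _ ⟨l, rfl, h2, rfl⟩
    clear h2 hf
    induction l with
    | nil => simp [deriv_one]
    | cons y l ih =>
      simp only [List.map_cons, List.prod_cons, List.sum_cons]
      rw [mul_assoc, deriv_coord_mul, ih, deriv_coord_mul, koszul_eq_eps, eps_add_right, mul_add,
        smul_add, add_mul, smul_mul_assoc, mul_assoc, mul_assoc, mul_smul_comm, smul_smul, ite_mul,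
        zero_mul]
      abel
  · simp
  · intro a b _ _ ha hb; simp only [add_mul, map_add, ha, hb, smul_add]; abel
  · intro c a _ ha; simp only [smul_mul_assoc, map_smul, ha, smul_add, smul_comm c]

/-- An even function commutes with its derivative, so the classical power rule survives. -/
theorem deriv_pow {n : ℕ} (x : X) {f : SFun gh} (hf : f ∈ piece gh w n 0) (v : ℕ) :
    deriv gh x (f ^ (v + 1)) = ((v : ℝ) + 1) • (deriv gh x f * f ^ v) := by
  have hcomm : f * deriv gh x f = deriv gh x f * f := by
    simpa using mul_comm_of_mem_piece hf (deriv_mem_piece x hf)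
  induction v with
  | zero => simp
  | succ v ih =>
    rw [pow_succ', deriv_mul x hf, eps_zero_right, one_smul, ih, mul_smul_comm, ← mul_assoc, hcomm,
      mul_assoc, ← pow_succ']
    push_cast
    module

end Pieces

/-! ### Restriction to the subspace where the coordinates in `Y` vanish -/

section SetZero

variable {X Y : Type*}

/-- The weight counting the coordinates in `Y`. -/
abbrev wt (X Y : Type*) : X ⊕ Y → ℕ := Sum.elim (fun _ => 0) (fun _ => 1)

theorem par_inl (gh : X ⊕ Y → ℤ) (x : X) :
    par gh (Sum.inl x) = par (fun x : X => gh (Sum.inl x)) x := rfl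

/-- A word of positive weight contains a coordinate of `Y`; the coordinates of `X` before it can be
pulled out. -/
theorem setZeroL_eq_zero_of_mem {gh : X ⊕ Y → ℤ} {n : ℕ} {i : ZMod 2} {f : SFun gh}
    (hf : f ∈ piece gh (wt X Y) (n + 1) i) : setZeroL gh f = 0 := by
  refine Submodule.span_induction ?_ ?_ ?_ ?_ hf
  · rintro _ ⟨l, rfl, h2, rfl⟩
    clear hf
    induction l with
    | nil => simp at h2
    | cons y l ih =>
      simp only [List.map_cons, List.prod_cons, List.sum_cons] at h2 ⊢
      rcases y with x | y
      · rw [setZeroL_inl_mul, ih (by simpa using h2), mul_zero]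
      · exact setZeroL_inr_mul gh y _
  · simp
  · intro a b _ _ ha hb; rw [map_add, ha, hb, add_zero]
  · intro c a _ ha; rw [map_smul, ha, smul_zero]

theorem setZeroL_mem_piece {gh : X ⊕ Y → ℤ} {w : X ⊕ Y → ℕ} {n : ℕ} {i : ZMod 2} {f : SFun gh}
    (hf : f ∈ piece gh w n i) :
    setZeroL gh f ∈ piece (fun x : X => gh (Sum.inl x)) (fun _ => 0) 0 i := by
  refine Submodule.span_induction ?_ ?_ ?_ ?_ hf
  · rintro _ ⟨l, rfl, h2, rfl⟩
    clear h2 hf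
    induction l with
    | nil => simpa [setZeroL_one] using one_mem_piece
    | cons y l ih =>
      simp only [List.map_cons, List.prod_cons, List.sum_cons]
      rcases y with x | y
      · rw [setZeroL_inl_mul]
        simpa [par_inl] using mul_mem_piece (coord_mem_piece (gh := fun x : X => gh (Sum.inl x))
          (w := fun _ => 0) x) ih
      · rw [setZeroL_inr_mul]; exact zero_mem _
  · simp
  · intro a b _ _ ha hb; rw [map_add]; exact add_mem ha hb
  · intro c a _ ha; rw [map_smul]; exact Submodule.smul_mem _ c ha

end SetZero

/-! ## Gaussian integration -/

section Wick

variable {X Y : Type*} [Fintype Y]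

/-- The operator `-½ ∑ P^{yy'} ∂_y ∂_{y'}`. -/
def wick (gh : X ⊕ Y → ℤ) (P : Y → Y → ℝ) : Module.End ℝ (SFun gh) :=
  (-1 / 2 : ℝ) • ∑ y, ∑ y', P y y' • (deriv gh (Sum.inr y) ∘ₗ deriv gh (Sum.inr y'))

/-- The compatibility of a propagator with parities and its graded symmetry. -/
structure IsPropagator (gh : X ⊕ Y → ℤ) (P : Y → Y → ℝ) : Prop where
  par_eq : ∀ {y y'}, P y y' ≠ 0 → par gh (Sum.inr y) = par gh (Sum.inr y')
  symm : ∀ y y', P y' y = eps (par gh (Sum.inr y)) (par gh (Sum.inr y)) * P y y'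

variable {gh : X ⊕ Y → ℤ} {P : Y → Y → ℝ}

theorem wick_apply (f : SFun gh) : wick gh P f =
    (-1 / 2 : ℝ) • ∑ y, ∑ y', P y y' • deriv gh (Sum.inr y) (deriv gh (Sum.inr y') f) := by
  simp [wick, LinearMap.sum_apply]

theorem wick_mem_piece (hP : IsPropagator gh P) {n : ℕ} {i : ZMod 2} {f : SFun gh}
    (hf : f ∈ piece gh (wt X Y) n i) : wick gh P f ∈ piece gh (wt X Y) (n - 2) i := by
  rw [wick_apply]
  refine Submodule.smul_mem _ _ (Submodule.sum_mem _ fun y _ => Submodule.sum_mem _ fun y' _ => ?_)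
  by_cases h0 : P y y' = 0
  · simp [h0]
  · have h1 := deriv_mem_piece (Sum.inr y) (deriv_mem_piece (Sum.inr y') hf)
    rw [hP.par_eq h0, add_assoc, add_self_zmod_two, add_zero] at h1
    exact Submodule.smul_mem _ _ h1

theorem wick_pow_mem_piece (hP : IsPropagator gh P) {n : ℕ} {i : ZMod 2} {f : SFun gh}
    (hf : f ∈ piece gh (wt X Y) n i) (m : ℕ) :
    (wick gh P ^ m) f ∈ piece gh (wt X Y) (n - 2 * m) i := by
  induction m with
  | zero => simpa using hf
  | succ m ih =>
    rw [pow_succ', Module.End.mul_apply]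
    have := wick_mem_piece hP ih
    rwa [Nat.sub_sub, ← Nat.mul_succ] at this

/-- The two Koszul signs cancel because the propagator couples only coordinates of equal parity. -/
theorem wick_deriv (hP : IsPropagator gh P) (y : Y) (f : SFun gh) :
    wick gh P (deriv gh (Sum.inr y) f) = deriv gh (Sum.inr y) (wick gh P f) := by
  rw [wick_apply, wick_apply, map_smul]
  simp only [map_sum, map_smul]
  congr 1
  refine Finset.sum_congr rfl fun a _ => Finset.sum_congr rfl fun b _ => ?_
  by_cases h0 : P a b = 0
  · simp [h0]
  · rw [deriv_deriv gh (Sum.inr b), map_smul, deriv_deriv gh (Sum.inr a), smul_smul,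
      koszul_eq_eps, koszul_eq_eps, hP.par_eq h0, smul_smul, mul_assoc, eps_mul_self, mul_one]

theorem wick_pow_deriv (hP : IsPropagator gh P) (y : Y) (f : SFun gh) (m : ℕ) :
    (wick gh P ^ m) (deriv gh (Sum.inr y) f) = deriv gh (Sum.inr y) ((wick gh P ^ m) f) := by
  induction m with
  | zero => simp
  | succ m ih => rw [pow_succ', Module.End.mul_apply, ih, wick_deriv hP, Module.End.mul_apply]

theorem wick_inl_mul (hP : IsPropagator gh P) (x : X) (f : SFun gh) :
    wick gh P (coord gh (Sum.inl x) * f) = coord gh (Sum.inl x) * wick gh P f := by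
  classical
  rw [wick_apply, wick_apply, mul_smul_comm]
  simp only [Finset.mul_sum, mul_smul_comm]
  congr 1
  refine Finset.sum_congr rfl fun a _ => Finset.sum_congr rfl fun b _ => ?_
  by_cases h0 : P a b = 0
  · simp [h0]
  · rw [deriv_coord_mul, if_neg (by simp), zero_add, map_smul, deriv_coord_mul, if_neg (by simp),
      zero_add, smul_smul, koszul_eq_eps, koszul_eq_eps, hP.par_eq h0, smul_smul, mul_assoc,
      eps_mul_self, mul_one]

/-- The commutator with a coordinate is a first-order operator. Either of the two derivatives may
hit the coordinate, and the graded symmetry of `P` makes both contributions equal, which absorbs the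
factor `1/2`. -/
theorem wick_inr_mul (hP : IsPropagator gh P) (y : Y) (f : SFun gh) :
    wick gh P (coord gh (Sum.inr y) * f) =
      coord gh (Sum.inr y) * wick gh P f - ∑ a, P a y • deriv gh (Sum.inr a) f := by
  classical
  rw [wick_apply, wick_apply, mul_smul_comm]
  simp only [Finset.mul_sum, mul_smul_comm]
  have key : ∀ a b, P a b • deriv gh (Sum.inr a) (deriv gh (Sum.inr b) (coord gh (Sum.inr y) * f)) =
      (if b = y then P a y • deriv gh (Sum.inr a) f else 0) +
      (if a = y then P b y • deriv gh (Sum.inr b) f else 0) +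
      P a b • (coord gh (Sum.inr y) * deriv gh (Sum.inr a) (deriv gh (Sum.inr b) f)) := by
    intro a b
    by_cases h0 : P a b = 0
    · have h0' : P b a = 0 := by rw [hP.symm, h0, mul_zero]
      rw [h0, zero_smul, zero_smul, add_zero]
      split_ifs with h1 h2 h2
      · subst h1 h2; simp [h0]
      · subst h1; simp [h0]
      · subst h2; simp [h0']
      · simp
    · rw [deriv_coord_mul, map_add, map_smul, deriv_coord_mul, koszul_eq_eps, koszul_eq_eps,
        hP.par_eq h0]
      simp only [smul_add, smul_smul, Sum.inr.injEq]
      rw [eps_mul_self, mul_one, ← add_assoc]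
      congr 2
      · split_ifs with h1
        · subst h1; rfl
        · simp
      · split_ifs with h1
        · subst h1
          rw [hP.symm a b, mul_comm, hP.par_eq h0]
        · simp
  simp only [key, Finset.sum_add_distrib, Finset.sum_ite_eq', Finset.mem_univ, if_true]
  have h2 : ∑ a, ∑ b, (if a = y then P b y • deriv gh (Sum.inr b) f else 0) =
      ∑ b, P b y • deriv gh (Sum.inr b) f := by
    rw [Finset.sum_comm]
    simp
  rw [h2]
  module

theorem wick_pow_inl_mul (hP : IsPropagator gh P) (x : X) (f : SFun gh) (m : ℕ) :
    (wick gh P ^ m) (coord gh (Sum.inl x) * f) = coord gh (Sum.inl x) * (wick gh P ^ m) f := by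
  induction m with
  | zero => simp
  | succ m ih => rw [pow_succ', Module.End.mul_apply, ih, wick_inl_mul hP, Module.End.mul_apply]

/-- The commutator `[W, y]` of the Wick operator commutes with `W`, whence `[W^(m+1), y] = (m+1) [W,
y] W^m`. -/
theorem wick_pow_inr_mul (hP : IsPropagator gh P) (y : Y) (f : SFun gh) (m : ℕ) :
    (wick gh P ^ (m + 1)) (coord gh (Sum.inr y) * f) =
      coord gh (Sum.inr y) * (wick gh P ^ (m + 1)) f -
        ((m : ℝ) + 1) • ∑ a, P a y • (wick gh P ^ m) (deriv gh (Sum.inr a) f) := by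
  induction m with
  | zero => simp [wick_inr_mul hP]
  | succ m ih =>
    rw [pow_succ', Module.End.mul_apply, ih, map_sub, wick_inr_mul hP, map_smul, map_sum]
    simp only [map_smul, ← wick_pow_deriv hP]
    have : ∀ f, wick gh P ((wick gh P ^ m) f) = (wick gh P ^ (m + 1)) f := fun f => by
      rw [pow_succ', Module.End.mul_apply]
    simp only [this]
    rw [← Module.End.mul_apply (wick gh P), ← pow_succ']
    push_cast
    module

/-- The term of order `m` of `e^W|_{ω''=0}`. -/
def expect (gh : X ⊕ Y → ℤ) (P : Y → Y → ℝ) (m : ℕ) :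
    SFun gh →ₗ[ℝ] SFun (fun x : X => gh (Sum.inl x)) :=
  (1 / (m.factorial : ℝ)) • (setZeroL gh ∘ₗ (wick gh P ^ m))

theorem expect_apply (m : ℕ) (f : SFun gh) :
    expect gh P m f = (1 / (m.factorial : ℝ)) • setZeroL gh ((wick gh P ^ m) f) := rfl

theorem expect_zero_one : expect gh P 0 1 = 1 := by
  simp [expect_apply, setZeroL_one]

theorem expect_inl_mul (hP : IsPropagator gh P) (m : ℕ) (x : X) (f : SFun gh) :
    expect gh P m (coord gh (Sum.inl x) * f) =
      coord (fun x : X => gh (Sum.inl x)) x * expect gh P m f := by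
  rw [expect_apply, wick_pow_inl_mul hP, setZeroL_inl_mul, expect_apply, mul_smul_comm]

/-- Wick's theorem as integration by parts: the term with the coordinate still in front dies at `ω''
= 0`, and `(m+1)/(m+1)! = 1/m!`. -/
theorem expect_succ_inr_mul (hP : IsPropagator gh P) (m : ℕ) (y : Y) (f : SFun gh) :
    expect gh P (m + 1) (coord gh (Sum.inr y) * f) =
      -∑ a, P a y • expect gh P m (deriv gh (Sum.inr a) f) := by
  rw [expect_apply, wick_pow_inr_mul hP, map_sub, setZeroL_inr_mul, zero_sub, map_smul, map_sum,
    smul_neg, smul_smul]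
  congr 1
  have h : (1 / ((m + 1).factorial : ℝ)) * ((m : ℝ) + 1) = 1 / (m.factorial : ℝ) := by
    rw [Nat.factorial_succ]
    have := Nat.factorial_ne_zero m
    push_cast
    field_simp
  rw [h, Finset.smul_sum]
  refine Finset.sum_congr rfl fun a _ => ?_
  rw [map_smul, expect_apply, smul_comm]

/-- Each Wick operator removes two coordinates of `Y`, so after `m` of them at least one is left to
be set to zero. -/
theorem expect_eq_zero_of_mem (hP : IsPropagator gh P) {m n : ℕ} (hmn : 2 * m < n) {i : ZMod 2}
    {f : SFun gh} (hf : f ∈ piece gh (wt X Y) n i) : expect gh P m f = 0 := by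
  rw [expect_apply, setZeroL_eq_zero_of_mem (n := n - 2 * m - 1) (i := i), smul_zero]
  have := wick_pow_mem_piece hP hf m
  rwa [Nat.sub_add_cancel (by omega)]

theorem expect_mem_piece (hP : IsPropagator gh P) {m n : ℕ} {i : ZMod 2}
    {f : SFun gh} (hf : f ∈ piece gh (wt X Y) n i) :
    expect gh P m f ∈ piece (fun x : X => gh (Sum.inl x)) (fun _ => 0) 0 i :=
  Submodule.smul_mem _ _ (setZeroL_mem_piece (wick_pow_mem_piece hP hf m))

end Wick

/-! ### Gaussian integrals of a quadratic form and the Schwinger-Dyson recursion -/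

section Gauss

variable {X Y : Type*} [Fintype X] [Fintype Y]

/-- The compatibility of the coefficients of the quadratic form
`½ ∑ B(x, y, y') x y y'` in the coordinates `y` with parities and its graded symmetry. -/
structure IsQuadratic (gh : X ⊕ Y → ℤ) (B : X → Y → Y → ℝ) : Prop where
  par_eq : ∀ {x y y'}, B x y y' ≠ 0 →
    par gh (Sum.inl x) = par gh (Sum.inr y) + par gh (Sum.inr y')
  symm : ∀ x y y', B x y' y = eps (par gh (Sum.inr y)) (par gh (Sum.inr y')) * B x y y'

/-- The matrix of the quadratic form, as a function of `(α, ω'')`. -/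
def quadCoeffTotal (gh : X ⊕ Y → ℤ) (B : X → Y → Y → ℝ) (y y' : Y) : SFun gh :=
  ∑ x, B x y y' • coord gh (Sum.inl x)

/-- The matrix of the quadratic form, as a function of `α`. -/
def quadCoeff (gh : X ⊕ Y → ℤ) (B : X → Y → Y → ℝ) (y y' : Y) :
    SFun (fun x : X => gh (Sum.inl x)) :=
  ∑ x, B x y y' • coord (fun x : X => gh (Sum.inl x)) x

/-- The quadratic form `½ ∑ B(x, y, y') x y y'`. -/
def quadForm (gh : X ⊕ Y → ℤ) (B : X → Y → Y → ℝ) : SFun gh :=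
  (1 / 2 : ℝ) • ∑ y, ∑ y', quadCoeffTotal gh B y y' *
    (coord gh (Sum.inr y) * coord gh (Sum.inr y'))

/-- The product of the propagator and the matrix of the quadratic form. -/
def loopMatrix (gh : X ⊕ Y → ℤ) (P : Y → Y → ℝ) (B : X → Y → Y → ℝ) :
    Matrix Y Y (SFun (fun x : X => gh (Sum.inl x))) :=
  Matrix.of fun y w => ∑ a, P y a • quadCoeff gh B w a

variable {gh : X ⊕ Y → ℤ} {P : Y → Y → ℝ} {B : X → Y → Y → ℝ}

theorem quadCoeffTotal_mem (hB : IsQuadratic gh B) (y y' : Y) :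
    quadCoeffTotal gh B y y' ∈ piece gh (wt X Y) 0 (par gh (Sum.inr y) + par gh (Sum.inr y')) := by
  refine Submodule.sum_mem _ fun x _ => ?_
  by_cases h0 : B x y y' = 0
  · simp [h0]
  · rw [← hB.par_eq h0]
    exact Submodule.smul_mem _ _ (coord_mem_piece (w := wt X Y) (Sum.inl x))

theorem quadCoeff_mem (hB : IsQuadratic gh B) (y y' : Y) :
    quadCoeff gh B y y' ∈ piece (fun x : X => gh (Sum.inl x)) (fun _ => 0) 0
      (par gh (Sum.inr y) + par gh (Sum.inr y')) := by
  refine Submodule.sum_mem _ fun x _ => ?_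
  by_cases h0 : B x y y' = 0
  · simp [h0]
  · rw [← hB.par_eq h0, par_inl]
    exact Submodule.smul_mem _ _ (coord_mem_piece (w := fun _ => 0) x)

theorem quadCoeffTotal_symm (hB : IsQuadratic gh B) (y y' : Y) :
    quadCoeffTotal gh B y' y =
      eps (par gh (Sum.inr y)) (par gh (Sum.inr y')) • quadCoeffTotal gh B y y' := by
  simp only [quadCoeffTotal, Finset.smul_sum, smul_smul]
  exact Finset.sum_congr rfl fun x _ => by rw [hB.symm]

theorem quadForm_mem (hB : IsQuadratic gh B) : quadForm gh B ∈ piece gh (wt X Y) 2 0 := by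
  refine Submodule.smul_mem _ _ (Submodule.sum_mem _ fun y _ => Submodule.sum_mem _ fun y' _ => ?_)
  have := mul_mem_piece (quadCoeffTotal_mem hB y y') (mul_mem_piece
    (coord_mem_piece (gh := gh) (w := wt X Y) (Sum.inr y))
    (coord_mem_piece (gh := gh) (w := wt X Y) (Sum.inr y')))
  rw [add_self_zmod_two] at this
  exact this

theorem expect_quadCoeffTotal_mul (hP : IsPropagator gh P) (m : ℕ) (y y' : Y) (f : SFun gh) :
    expect gh P m (quadCoeffTotal gh B y y' * f) = quadCoeff gh B y y' * expect gh P m f := by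
  simp only [quadCoeffTotal, quadCoeff, Finset.sum_mul, map_sum, smul_mul_assoc, map_smul,
    expect_inl_mul hP]

theorem deriv_inr_quadCoeffTotal (a y y' : Y) :
    deriv gh (Sum.inr a) (quadCoeffTotal gh B y y') = 0 := by
  classical
  rw [quadCoeffTotal, map_sum]
  refine Finset.sum_eq_zero fun x _ => ?_
  rw [map_smul, ← mul_one (coord gh _), deriv_coord_mul, deriv_one]
  simp

theorem deriv_inr_coord [DecidableEq Y] (a y : Y) :
    deriv gh (Sum.inr a) (coord gh (Sum.inr y)) = if a = y then 1 else 0 := by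
  classical
  rw [← mul_one (coord gh _), deriv_coord_mul, deriv_one]
  simp

/-- The derivative hits either of the two coordinates; graded symmetry identifies the contributions
and cancels the `1/2`. -/
theorem deriv_quadForm (hB : IsQuadratic gh B) (a : Y) :
    deriv gh (Sum.inr a) (quadForm gh B) =
      ∑ y, eps (par gh (Sum.inr a)) (par gh (Sum.inr a)) •
        (quadCoeffTotal gh B y a * coord gh (Sum.inr y)) := by
  classical
  have key : ∀ y y', deriv gh (Sum.inr a) (quadCoeffTotal gh B y y' *
      (coord gh (Sum.inr y) * coord gh (Sum.inr y'))) =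
      (if a = y then eps (par gh (Sum.inr a)) (par gh (Sum.inr a)) •
        (quadCoeffTotal gh B y' a * coord gh (Sum.inr y')) else 0) +
      (if a = y' then eps (par gh (Sum.inr a)) (par gh (Sum.inr a)) •
        (quadCoeffTotal gh B y a * coord gh (Sum.inr y)) else 0) := by
    intro y y'
    rw [deriv_mul _ (quadCoeffTotal_mem hB y y'), deriv_inr_quadCoeffTotal, zero_mul, zero_add,
      deriv_coord_mul, deriv_inr_coord, koszul_eq_eps, mul_add, smul_add]
    congr 1
    · by_cases h : a = y
      · subst h
        rw [if_pos rfl, if_pos rfl, quadCoeffTotal_symm hB y' a, smul_mul_assoc, smul_smul,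
          eps_add_right, eps_symm (par gh (Sum.inr y')), mul_assoc, eps_mul_self, mul_one]
      · rw [if_neg (by simpa using h), if_neg h, mul_zero, smul_zero]
    · by_cases h : a = y'
      · subst h
        rw [if_pos rfl, if_pos rfl, mul_one, mul_smul_comm, smul_smul, eps_add_right,
          mul_right_comm, eps_mul_self, one_mul]
      · rw [if_neg h, if_neg h, mul_zero, smul_zero, mul_zero, smul_zero]
  rw [quadForm, map_smul]
  simp only [map_sum, key, Finset.sum_add_distrib, Finset.sum_ite_eq, Finset.mem_univ, if_true]
  have h2 : ∑ y, ∑ y', (if a = y then eps (par gh (Sum.inr a)) (par gh (Sum.inr a)) •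
        (quadCoeffTotal gh B y' a * coord gh (Sum.inr y')) else 0) =
      ∑ y', eps (par gh (Sum.inr a)) (par gh (Sum.inr a)) •
        (quadCoeffTotal gh B y' a * coord gh (Sum.inr y')) := by
    rw [Finset.sum_comm]
    simp
  rw [h2]
  module

/-- The Gaussian integral, at order `v`. -/
def gauss (gh : X ⊕ Y → ℤ) (P : Y → Y → ℝ) (B : X → Y → Y → ℝ) (v : ℕ) :
    SFun (fun x : X => gh (Sum.inl x)) :=
  (1 / (v.factorial : ℝ)) • expect gh P v (quadForm gh B ^ v)

/-- The Gaussian two-point function, at order `v`. -/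
def gaussTwo (gh : X ⊕ Y → ℤ) (P : Y → Y → ℝ) (B : X → Y → Y → ℝ) (v : ℕ) :
    Matrix Y Y (SFun (fun x : X => gh (Sum.inl x))) :=
  Matrix.of fun y y' => (1 / (v.factorial : ℝ)) •
    expect gh P (v + 1) (coord gh (Sum.inr y) * (coord gh (Sum.inr y') * quadForm gh B ^ v))

theorem gauss_zero : gauss gh P B 0 = 1 := by
  simp [gauss, expect_zero_one]

theorem gaussTwo_zero (hP : IsPropagator gh P) (y y' : Y) :
    gaussTwo gh P B 0 y y' = -(P y' y • (1 : SFun (fun x : X => gh (Sum.inl x)))) := by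
  classical
  simp only [gaussTwo, Matrix.of_apply, pow_zero, mul_one, expect_succ_inr_mul hP,
    deriv_inr_coord]
  rw [Finset.sum_eq_single y']
  · simp [expect_zero_one]
  · intro a _ h; simp [h]
  · simp

/-- The signs collected in `coord_mul_deriv_quadForm`, where `i`, `j`, `k` are the parities of the
differentiated coordinate, the spectator coordinate and the remaining leg. -/
theorem quad_sign (i j k : ZMod 2) : eps i j * eps i i * eps j (k + i) * eps j k = eps i i := by
  rcases zmod_two_cases i with rfl | rfl <;> rcases zmod_two_cases j with rfl | rfl <;>
    rcases zmod_two_cases k with rfl | rfl <;> simp [one_add_one_zmod_two]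

theorem coord_mul_deriv_quadForm (hB : IsQuadratic gh B) (a y : Y) :
    eps (par gh (Sum.inr a)) (par gh (Sum.inr y)) •
        (coord gh (Sum.inr y) * deriv gh (Sum.inr a) (quadForm gh B)) =
      ∑ w, eps (par gh (Sum.inr a)) (par gh (Sum.inr a)) • (quadCoeffTotal gh B w a *
        (coord gh (Sum.inr w) * coord gh (Sum.inr y))) := by
  rw [deriv_quadForm hB, Finset.mul_sum, Finset.smul_sum]
  refine Finset.sum_congr rfl fun w _ => ?_
  rw [mul_smul_comm, ← mul_assoc, mul_comm_of_mem_piece (coord_mem_piece (w := wt X Y) (Sum.inr y))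
    (quadCoeffTotal_mem hB w a), smul_mul_assoc, mul_assoc, coord_mul_coord, koszul_eq_eps,
    mul_smul_comm, smul_smul, smul_smul, smul_smul, quad_sign]

/-- The Schwinger-Dyson equation. The derivative produced by the first coordinate hits either the
second one, which gives the bare propagator, or one of the `v + 1` vertices, which adds a link to
the chain. -/
theorem gaussTwo_succ (hP : IsPropagator gh P) (hB : IsQuadratic gh B) (v : ℕ) (y y' : Y) :
    gaussTwo gh P B (v + 1) y y' = -(P y' y • gauss gh P B (v + 1)) -
      ∑ w, loopMatrix gh P B y w * gaussTwo gh P B v w y' := by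
  classical
  have hf : ((v + 1).factorial : ℝ) = ((v : ℝ) + 1) * v.factorial := by
    rw [Nat.factorial_succ]; push_cast; rfl
  have hv : (v : ℝ) + 1 ≠ 0 := by positivity
  have hv' : (v.factorial : ℝ) ≠ 0 := by positivity
  have hd : ∀ a, P a y • deriv gh (Sum.inr a) (coord gh (Sum.inr y') * quadForm gh B ^ (v + 1)) =
      (if a = y' then P a y • quadForm gh B ^ (v + 1) else 0) +
      ((v : ℝ) + 1) • ∑ w, P y a • (quadCoeffTotal gh B w a * (coord gh (Sum.inr w) *
        (coord gh (Sum.inr y') * quadForm gh B ^ v))) := by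
    intro a
    rw [deriv_coord_mul, deriv_pow _ (quadForm_mem hB), smul_add, koszul_eq_eps]
    congr 1
    · simp
    · rw [mul_smul_comm, smul_comm (eps _ _), ← mul_assoc, ← smul_mul_assoc,
        coord_mul_deriv_quadForm hB, smul_comm]
      congr 1
      rw [Finset.sum_mul, Finset.smul_sum]
      refine Finset.sum_congr rfl fun w _ => ?_
      rw [smul_mul_assoc, smul_smul, hP.symm y a]
      by_cases h0 : P y a = 0
      · simp [h0]
      · rw [hP.par_eq h0, mul_right_comm, eps_mul_self, one_mul]
        simp only [mul_assoc]
  rw [gaussTwo, Matrix.of_apply, expect_succ_inr_mul hP]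
  simp only [← map_smul (expect gh P (v + 1)), ← map_sum, hd, Finset.sum_add_distrib,
    Finset.sum_ite_eq', Finset.mem_univ, if_true]
  rw [map_add, neg_add, smul_add, sub_eq_add_neg]
  congr 1
  · rw [gauss, map_smul, smul_neg, smul_comm]
  · rw [← Finset.smul_sum, map_smul, smul_neg, smul_smul, hf]
    have h1 : 1 / (((v : ℝ) + 1) * v.factorial) * ((v : ℝ) + 1) = 1 / v.factorial := by
      field_simp
    rw [h1]
    congr 1
    simp only [map_sum, map_smul, expect_quadCoeffTotal_mul hP, loopMatrix, Matrix.of_apply,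
      gaussTwo, Finset.smul_sum, Finset.sum_mul, smul_mul_assoc, mul_smul_comm]
    rw [Finset.sum_comm]

/-- Singling out one of the `v + 1` vertices cuts the loop through it open: the remaining factor is
a two-point function. -/
theorem gauss_succ (hP : IsPropagator gh P) (v : ℕ) :
    ((v : ℝ) + 1) • gauss gh P B (v + 1) =
      (1 / 2 : ℝ) • ∑ y, ∑ y', quadCoeff gh B y y' * gaussTwo gh P B v y y' := by
  have hf : ((v + 1).factorial : ℝ) = ((v : ℝ) + 1) * v.factorial := by
    rw [Nat.factorial_succ]; push_cast; rfl
  have hv : (v : ℝ) + 1 ≠ 0 := by positivity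
  have hv' : (v.factorial : ℝ) ≠ 0 := by positivity
  have h1 : ((v : ℝ) + 1) * (1 / (((v : ℝ) + 1) * v.factorial)) = 1 / v.factorial := by
    field_simp
  rw [gauss, pow_succ', smul_smul, hf, h1]
  have h2 : ∀ F, expect gh P (v + 1) (quadForm gh B * F) = (1 / 2 : ℝ) • ∑ y, ∑ y',
      quadCoeff gh B y y' * expect gh P (v + 1) (coord gh (Sum.inr y) *
        (coord gh (Sum.inr y') * F)) := by
    intro F
    simp only [quadForm, smul_mul_assoc, map_smul, Finset.sum_mul, map_sum, mul_assoc,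
      expect_quadCoeffTotal_mul hP]
  rw [h2, smul_comm]
  simp only [Finset.smul_sum, gaussTwo, Matrix.of_apply, mul_smul_comm]

theorem loopMatrix_mem (hP : IsPropagator gh P) (hB : IsQuadratic gh B) (y w : Y) :
    loopMatrix gh P B y w ∈ piece (fun x : X => gh (Sum.inl x)) (fun _ => 0) 0
      (par gh (Sum.inr y) + par gh (Sum.inr w)) := by
  rw [loopMatrix, Matrix.of_apply]
  refine Submodule.sum_mem _ fun a _ => ?_
  by_cases h0 : P y a = 0
  · simp [h0]
  · rw [hP.par_eq h0, add_comm]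
    exact Submodule.smul_mem _ _ (quadCoeff_mem hB w a)

theorem matrix_pow_mem_piece {gh : X → ℤ} {p : Y → ZMod 2} [DecidableEq Y]
    {N : Matrix Y Y (SFun gh)}
    (hN : ∀ y w, N y w ∈ piece gh (fun _ => 0) 0 (p y + p w)) (k : ℕ) (y w : Y) :
    (N ^ k) y w ∈ piece gh (fun _ => 0) 0 (p y + p w) := by
  induction k generalizing y w with
  | zero =>
    rw [pow_zero, Matrix.one_apply]
    split_ifs with h
    · rw [h, add_self_zmod_two]; exact one_mem_piece
    · exact zero_mem _
  | succ k ih =>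
    rw [pow_succ, Matrix.mul_apply]
    refine Submodule.sum_mem _ fun a _ => ?_
    have := mul_mem_piece (ih y a) (hN a w)
    rwa [add_assoc, ← add_assoc (p a), add_self_zmod_two, zero_add, zero_add] at this

variable [DecidableEq Y]

/-- Iteration of `gaussTwo_succ`: up to a global sign this is the Neumann series of `(1 + N)⁻¹`,
with `N` the loop matrix, applied to the transposed propagator and multiplied by the Gaussian
integral. -/
theorem gaussTwo_eq (hP : IsPropagator gh P) (hB : IsQuadratic gh B) (v : ℕ) (y y' : Y) :
    gaussTwo gh P B v y y' = ∑ k ∈ Finset.range (v + 1), (-1 : ℝ) ^ (k + 1) •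
      ((∑ w, P y' w • (loopMatrix gh P B ^ k) y w) * gauss gh P B (v - k)) := by
  have h0 : ∀ y, ∑ w, P y' w • ((1 : Matrix Y Y (SFun (fun x : X => gh (Sum.inl x)))) y w) =
      P y' y • 1 := by
    intro y
    rw [Finset.sum_eq_single y]
    · simp
    · intro b _ hb; rw [Matrix.one_apply_ne (Ne.symm hb), smul_zero]
    · simp
  induction v generalizing y with
  | zero => simp [gaussTwo_zero hP, gauss_zero, h0]
  | succ v ih =>
    rw [gaussTwo_succ hP hB, Finset.sum_range_succ', sub_eq_add_neg, add_comm]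
    congr 1
    · simp only [ih, Finset.mul_sum, Nat.reduceSubDiff]
      rw [Finset.sum_comm, ← Finset.sum_neg_distrib]
      refine Finset.sum_congr rfl fun k _ => ?_
      rw [pow_succ (-1 : ℝ) (k + 1), mul_neg_one, neg_smul, neg_inj]
      simp only [mul_smul_comm]
      rw [← Finset.smul_sum]
      congr 1
      simp only [← mul_assoc]
      rw [← Finset.sum_mul]
      congr 1
      simp only [Finset.mul_sum, mul_smul_comm]
      rw [Finset.sum_comm]
      refine Finset.sum_congr rfl fun a _ => ?_
      rw [← Finset.smul_sum, pow_succ', Matrix.mul_apply]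
    · simp [h0]

theorem quad_sign' (i j k : ZMod 2) (h : j = k) :
    eps (i + j) (i + k) = eps i i * eps k k := by
  subst h
  rcases zmod_two_cases i with rfl | rfl <;> rcases zmod_two_cases j with rfl | rfl <;>
    simp [one_add_one_zmod_two]

/-- Closing the chain into a loop. Moving the vertex coefficient past the chain, together with the
symmetry of `P`, leaves exactly the sign that turns the trace into a super-trace. -/
theorem quadCoeff_mul_loopMatrix (hP : IsPropagator gh P) (hB : IsQuadratic gh B) (k : ℕ) :
    ∑ y, ∑ y', quadCoeff gh B y y' * (∑ w, P y' w • (loopMatrix gh P B ^ k) y w) =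
      ∑ y, eps (par gh (Sum.inr y)) (par gh (Sum.inr y)) • (loopMatrix gh P B ^ (k + 1)) y y := by
  refine Finset.sum_congr rfl fun y _ => ?_
  rw [pow_succ, Matrix.mul_apply, Finset.smul_sum]
  simp only [Finset.mul_sum]
  rw [Finset.sum_comm]
  refine Finset.sum_congr rfl fun w _ => ?_
  rw [loopMatrix, Matrix.of_apply, ← loopMatrix, Finset.mul_sum, Finset.smul_sum]
  refine Finset.sum_congr rfl fun y' _ => ?_
  rw [mul_smul_comm, mul_smul_comm]
  by_cases h0 : P w y' = 0
  · rw [hP.symm w y', h0]; simp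
  · rw [mul_comm_of_mem_piece (quadCoeff_mem hB y y')
      (matrix_pow_mem_piece (p := fun y => par gh (Sum.inr y)) (loopMatrix_mem hP hB) k y w),
      quad_sign' _ _ _ (hP.par_eq h0).symm, hP.symm w y', smul_smul, smul_smul]
    congr 1
    have := eps_mul_self (par gh (Sum.inr w)) (par gh (Sum.inr w))
    linear_combination (eps (par gh (Sum.inr y)) (par gh (Sum.inr y)) * P w y') * this

/-- The recursion for the Gaussian integral. -/
theorem gauss_recursion (hP : IsPropagator gh P) (hB : IsQuadratic gh B) (v : ℕ) :
    ((v : ℝ) + 1) • gauss gh P B (v + 1) = ∑ k ∈ Finset.range (v + 1),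
      ((1 / 2 : ℝ) * (-1) ^ (k + 1)) • ((∑ y, eps (par gh (Sum.inr y)) (par gh (Sum.inr y)) •
        (loopMatrix gh P B ^ (k + 1)) y y) * gauss gh P B (v - k)) := by
  rw [gauss_succ hP]
  simp only [gaussTwo_eq hP hB, Finset.mul_sum, mul_smul_comm]
  rw [Finset.smul_sum]
  simp only [← Finset.smul_sum (r := (1 / 2 : ℝ))]
  have : ∀ y, ∑ y', ∑ k ∈ Finset.range (v + 1), (-1 : ℝ) ^ (k + 1) • (quadCoeff gh B y y' *
      ((∑ w, P y' w • (loopMatrix gh P B ^ k) y w) * gauss gh P B (v - k))) =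
      ∑ k ∈ Finset.range (v + 1), (-1 : ℝ) ^ (k + 1) • ((∑ y', quadCoeff gh B y y' *
      (∑ w, P y' w • (loopMatrix gh P B ^ k) y w)) * gauss gh P B (v - k)) := by
    intro y
    rw [Finset.sum_comm]
    refine Finset.sum_congr rfl fun k _ => ?_
    rw [← Finset.smul_sum, Finset.sum_mul]
    simp only [mul_assoc]
  simp only [this]
  rw [Finset.sum_comm, Finset.smul_sum]
  refine Finset.sum_congr rfl fun k _ => ?_
  rw [← Finset.smul_sum, ← Finset.sum_mul, quadCoeff_mul_loopMatrix hP hB, smul_smul]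

end Gauss

/-! ## Logarithms of power series with commuting coefficients -/

section Log

variable {R : Type*} [Ring R] [Algebra ℝ R]

theorem coeff_real_smul (v : ℕ) (c : ℝ) (f : PowerSeries R) :
    PowerSeries.coeff v (c • f) = c • PowerSeries.coeff v f := rfl

/-- The Euler operator `t d/dt`. -/
def euler : PowerSeries R →ₗ[ℝ] PowerSeries R where
  toFun f := PowerSeries.mk fun v => (v : ℝ) • PowerSeries.coeff v f
  map_add' f f' := by ext v; simp
  map_smul' c f := by
    ext v
    rw [PowerSeries.coeff_mk, coeff_real_smul, RingHom.id_apply, coeff_real_smul,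
      PowerSeries.coeff_mk, smul_comm]

theorem coeff_euler (v : ℕ) (f : PowerSeries R) :
    PowerSeries.coeff v (euler f) = (v : ℝ) • PowerSeries.coeff v f :=
  PowerSeries.coeff_mk v fun v => (v : ℝ) • PowerSeries.coeff v f

theorem euler_mul (f f' : PowerSeries R) : euler (f * f') = euler f * f' + f * euler f' := by
  ext v
  rw [map_add, coeff_euler, PowerSeries.coeff_mul, PowerSeries.coeff_mul, PowerSeries.coeff_mul,
    ← Finset.sum_add_distrib, Finset.smul_sum]
  refine Finset.sum_congr rfl fun p hp => ?_
  rw [coeff_euler, coeff_euler, smul_mul_assoc, mul_smul_comm, ← add_smul]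
  congr 1
  rw [← Finset.HasAntidiagonal.mem_antidiagonal.mp hp]
  push_cast
  rfl

theorem powerSeries_commute {f f' : PowerSeries R}
    (h : ∀ i j, Commute (PowerSeries.coeff i f) (PowerSeries.coeff j f')) : Commute f f' := by
  ext v
  rw [PowerSeries.coeff_mul, PowerSeries.coeff_mul, ← Finset.Nat.sum_antidiagonal_swap]
  exact Finset.sum_congr rfl fun p _ => (h _ _).eq

theorem euler_pow {w : PowerSeries R} (hw : Commute w (euler w)) (j : ℕ) :
    euler (w ^ (j + 1)) = ((j : ℝ) + 1) • (w ^ j * euler w) := by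
  induction j with
  | zero => simp
  | succ j ih =>
    rw [pow_succ, euler_mul, ih, smul_mul_assoc, mul_assoc, ← hw.eq, ← mul_assoc, ← pow_succ]
    push_cast
    module

theorem coeff_pow_eq_zero {w : PowerSeries R} (hw : PowerSeries.coeff 0 w = 0) {j v : ℕ}
    (h : v < j) : PowerSeries.coeff v (w ^ j) = 0 := by
  induction j generalizing v with
  | zero => omega
  | succ j ih =>
    rw [pow_succ', PowerSeries.coeff_mul]
    refine Finset.sum_eq_zero fun p hp => ?_
    have hp := Finset.HasAntidiagonal.mem_antidiagonal.mp hp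
    rcases Nat.eq_zero_or_pos p.1 with h0 | h0
    · rw [h0, hw, zero_mul]
    · rw [ih (by omega), mul_zero]

theorem coeff_logSeries_of_le (Z : PowerSeries R) (hZ : PowerSeries.coeff 0 Z = 1) {v N : ℕ}
    (h : v ≤ N) : PowerSeries.coeff v (logSeries Z) =
      PowerSeries.coeff v (∑ j ∈ Finset.range N, ((-1 : ℝ) ^ j / (j + 1)) • (Z - 1) ^ (j + 1)) := by
  have hw : PowerSeries.coeff 0 (Z - 1) = 0 := by rw [map_sub, hZ]; simp
  rw [logSeries, PowerSeries.coeff_mk, map_sum]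
  have h1 : ∑ j ∈ Finset.range N, PowerSeries.coeff v
      (((-1 : ℝ) ^ j / (j + 1)) • (Z - 1) ^ (j + 1)) =
      ∑ j ∈ Finset.range v, PowerSeries.coeff v
      (((-1 : ℝ) ^ j / (j + 1)) • (Z - 1) ^ (j + 1)) := by
    symm
    refine Finset.sum_subset (Finset.range_mono h) fun j _ hj => ?_
    rw [coeff_real_smul, coeff_pow_eq_zero hw (by simpa [Nat.lt_succ_iff] using hj), smul_zero]
  have h2 : Finset.Icc 1 v = Finset.Ico (0 + 1) (v + 1) := by ext; simp
  rw [h1, h2, ← Finset.sum_Ico_add', Finset.range_eq_Ico]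
  refine Finset.sum_congr rfl fun k _ => ?_
  rw [coeff_real_smul, pow_add (-1 : ℝ) (k + 1), pow_succ (-1 : ℝ) k]
  congr 2
  · ring
  · push_cast; rfl

theorem coeff_zero_logSeries (Z : PowerSeries R) (hZ : PowerSeries.coeff 0 Z = 1) :
    PowerSeries.coeff 0 (logSeries Z) = 0 := by
  rw [coeff_logSeries_of_le Z hZ le_rfl]; simp

/-- The differential equation of the logarithm needs only that the coefficients of `Z` commute with
one another; `R` may be noncommutative. Up to order `v` the logarithm is a polynomial in `w = Z -
1`, whose Euler derivative is a finite geometric sum times that of `w`. -/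
theorem euler_logSeries (Z : PowerSeries R) (hZ : PowerSeries.coeff 0 Z = 1)
    (hc : ∀ i j, Commute (PowerSeries.coeff i Z) (PowerSeries.coeff j Z)) :
    euler Z = euler (logSeries Z) * Z := by
  set w := Z - 1 with hw
  have hw0 : PowerSeries.coeff 0 w = 0 := by rw [hw, map_sub, hZ]; simp
  have hθ : euler Z = euler w := by
    ext v
    rw [hw, map_sub, map_sub, coeff_euler v 1, PowerSeries.coeff_one]
    split_ifs with h <;> simp [h]
  have hZw : Commute Z (euler Z) := powerSeries_commute fun i j => by
    rw [coeff_euler]; exact (hc i j).smul_right _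
  have hcomm : Commute w (euler w) := by
    rw [← hθ]; exact hZw.sub_left (Commute.one_left _)
  ext v
  set LN := ∑ j ∈ Finset.range v, ((-1 : ℝ) ^ j / (j + 1)) • w ^ (j + 1) with hLN
  have h1 : PowerSeries.coeff v (euler (logSeries Z) * Z) = PowerSeries.coeff v (euler LN * Z) := by
    rw [PowerSeries.coeff_mul, PowerSeries.coeff_mul]
    refine Finset.sum_congr rfl fun p hp => ?_
    have hp := Finset.HasAntidiagonal.mem_antidiagonal.mp hp
    rw [coeff_euler, coeff_euler, coeff_logSeries_of_le Z hZ (N := v) (by omega)]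
  have h2 : euler LN = (∑ j ∈ Finset.range v, (-w) ^ j) * euler w := by
    rw [hLN, map_sum, Finset.sum_mul]
    refine Finset.sum_congr rfl fun j _ => ?_
    have hj : (j : ℝ) + 1 ≠ 0 := by positivity
    rw [map_smul, euler_pow hcomm, smul_smul, div_mul_cancel₀ _ hj, ← neg_one_smul ℝ w, smul_pow,
      smul_mul_assoc]
  have h3 : euler LN * Z = euler w - (-w) ^ v * euler w := by
    rw [h2, mul_assoc, ← hθ, ← hZw.eq, ← mul_assoc, show Z = 1 - -w by rw [hw]; abel,
      geom_sum_mul_neg, sub_mul, one_mul]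
  -- The remainder of the geometric sum has order greater than `v`, since both `w` and `euler w`
  -- have zero constant coefficient.
  suffices h4 : PowerSeries.coeff v ((-w) ^ v * euler w) = 0 by
    rw [h1, h3, hθ, map_sub _ (euler w), h4, sub_zero]
  rw [PowerSeries.coeff_mul]
  refine Finset.sum_eq_zero fun p hp => ?_
  have hp := Finset.HasAntidiagonal.mem_antidiagonal.mp hp
  rcases Nat.eq_zero_or_pos p.2 with h0 | h0
  · rw [h0, coeff_euler, Nat.cast_zero, zero_smul, mul_zero]
  · rw [coeff_pow_eq_zero (by rw [map_neg, hw0, neg_zero]) (by omega), zero_mul]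

/-- In the coefficient of `t^v` the new unknown `v L_v` is multiplied by `Z_0 = 1`; everything else
is known by induction. -/
theorem euler_mul_cancel {Z L L' : PowerSeries R} (hZ : PowerSeries.coeff 0 Z = 1)
    (h0 : PowerSeries.coeff 0 L = PowerSeries.coeff 0 L') (h : euler L * Z = euler L' * Z) :
    L = L' := by
  have key : ∀ v, PowerSeries.coeff v L = PowerSeries.coeff v L' := by
    intro v
    induction v using Nat.strong_induction_on with
    | _ v ih =>
      rcases Nat.eq_zero_or_pos v with rfl | hv
      · exact h0
      · have h1 := congrArg (PowerSeries.coeff v) h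
        rw [PowerSeries.coeff_mul, PowerSeries.coeff_mul,
          ← Finset.sum_erase_add _ (fun p : ℕ × ℕ => PowerSeries.coeff p.1 (euler L) *
            PowerSeries.coeff p.2 Z) (a := (v, 0)) (by simp),
          ← Finset.sum_erase_add _ (fun p : ℕ × ℕ => PowerSeries.coeff p.1 (euler L') *
            PowerSeries.coeff p.2 Z) (a := (v, 0)) (by simp)] at h1
        have h2 : ∑ p ∈ (Finset.HasAntidiagonal.antidiagonal v).erase (v, 0),
            PowerSeries.coeff p.1 (euler L) * PowerSeries.coeff p.2 Z =
            ∑ p ∈ (Finset.HasAntidiagonal.antidiagonal v).erase (v, 0),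
            PowerSeries.coeff p.1 (euler L') * PowerSeries.coeff p.2 Z := by
          refine Finset.sum_congr rfl fun p hp => ?_
          rw [Finset.mem_erase, Finset.HasAntidiagonal.mem_antidiagonal] at hp
          have : p.1 < v := by
            rcases Nat.lt_or_ge p.1 v with h' | h'
            · exact h'
            · exact absurd (Prod.ext (by simp; omega) (by simp; omega)) hp.1
          rw [coeff_euler, coeff_euler, ih _ this]
        rw [h2, add_left_cancel_iff, coeff_euler, coeff_euler, hZ, mul_one, mul_one] at h1
        have hv' : (v : ℝ) ≠ 0 := by positivity
        have h3 := congrArg ((v : ℝ)⁻¹ • ·) h1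
        simpa [smul_smul, inv_mul_cancel₀ hv'] using h3
  ext v
  exact key v

/-- Characterises the logarithm by its differential equation, so that neither exponentials nor a
product rule for logarithms have to be developed. -/
theorem logSeries_unique {Z L : PowerSeries R} (hZ : PowerSeries.coeff 0 Z = 1)
    (hc : ∀ i j, Commute (PowerSeries.coeff i Z) (PowerSeries.coeff j Z))
    (hL : PowerSeries.coeff 0 L = 0) (h : euler Z = euler L * Z) : logSeries Z = L :=
  euler_mul_cancel hZ (by rw [hL, coeff_zero_logSeries Z hZ]) (by rw [← euler_logSeries Z hZ hc, h])

/-- The coefficients of the logarithm are universal polynomials in those of `Z`. The relevant map is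
evaluation at `ħ = 0`. -/
theorem logSeries_map {S : Type*} [Ring S] [Algebra ℝ S] (φ : R →ₐ[ℝ] S) (Z : PowerSeries R) :
    logSeries (PowerSeries.map (φ : R →+* S) Z) =
      PowerSeries.map (φ : R →+* S) (logSeries Z) := by
  ext v
  rw [PowerSeries.coeff_map, logSeries, logSeries, PowerSeries.coeff_mk, PowerSeries.coeff_mk,
    map_sum]
  refine Finset.sum_congr rfl fun j _ => ?_
  rw [← map_one (PowerSeries.map (φ : R →+* S)), ← map_sub, ← map_pow, PowerSeries.coeff_map]
  exact (map_smul φ _ _).symm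

end Log

/-! ## The perturbative expansion -/

section Series

variable {R : Type*} [Ring R] [Algebra ℝ R]

theorem hahn_commute_single_one (k : ℤ) (f : LaurentSeries R) :
    Commute (HahnSeries.single k (1 : R)) f := by
  ext n
  rw [HahnSeries.coeff_single_mul, HahnSeries.coeff_mul_single, one_mul, mul_one]

/-- Bookkeeping of `ħ`: the factor `ħ^(-i)` of `i` vertices with two or more `ω''` legs is
compensated by the `i` propagators they need at least; only the `j` vertices without such legs keep
negative powers. -/
theorem hahn_single_pow_mul (i j : ℕ) (f : PowerSeries R) (c : R) :
    HahnSeries.single (-((i + j : ℕ) : ℤ)) (1 : R) *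
      HahnSeries.ofPowerSeries ℤ R (PowerSeries.X ^ i * (f * PowerSeries.C c)) =
    HahnSeries.ofPowerSeries ℤ R f * HahnSeries.single (-(j : ℤ)) c := by
  rw [map_mul, map_mul, HahnSeries.ofPowerSeries_X_pow, HahnSeries.ofPowerSeries_C, ← mul_assoc,
    HahnSeries.single_mul_single, one_mul, ← mul_assoc, (hahn_commute_single_one _ _).eq, mul_assoc,
    HahnSeries.C_apply, HahnSeries.single_mul_single, one_mul, add_zero,
    show -((i + j : ℕ) : ℤ) + i = -j by omega]

theorem euler_map {S : Type*} [Ring S] [Algebra ℝ S] (φ : R →ₐ[ℝ] S) (f : PowerSeries R) :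
    euler (PowerSeries.map (φ : R →+* S) f) = PowerSeries.map (φ : R →+* S) (euler f) := by
  ext v
  rw [coeff_euler, PowerSeries.coeff_map, PowerSeries.coeff_map, coeff_euler]
  exact (map_smul φ _ _).symm

theorem hahn_ofPowerSeries_commute {f f' : PowerSeries R}
    (h : ∀ i j, Commute (PowerSeries.coeff i f) (PowerSeries.coeff j f')) :
    Commute (HahnSeries.ofPowerSeries ℤ R f) (HahnSeries.ofPowerSeries ℤ R f') :=
  (powerSeries_commute h).map (HahnSeries.ofPowerSeries ℤ R)

/-- The series `exp (t c / ħ)`. -/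
def expSeries (c : R) : PowerSeries (LaurentSeries R) :=
  PowerSeries.mk fun v => HahnSeries.single (-(v : ℤ)) ((1 / (v.factorial : ℝ)) • c ^ v)

/-- The series `t c / ħ`. -/
def linearSeries (c : R) : PowerSeries (LaurentSeries R) :=
  PowerSeries.C (HahnSeries.single (-1 : ℤ) c) * PowerSeries.X

theorem coeff_linearSeries (c : R) (v : ℕ) :
    PowerSeries.coeff v (linearSeries c) = if v = 1 then HahnSeries.single (-1 : ℤ) c else 0 := by
  have := PowerSeries.coeff_C_mul_X_pow (HahnSeries.single (-1 : ℤ) c) 1 v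
  rwa [pow_one] at this

theorem euler_linearSeries (c : R) : euler (linearSeries c) = linearSeries c := by
  ext v : 1
  rw [coeff_euler, coeff_linearSeries]
  split_ifs with h
  · rw [h, Nat.cast_one, one_smul]
  · rw [smul_zero]

theorem euler_expSeries (c : R) : euler (expSeries c) = linearSeries c * expSeries c := by
  ext v : 1
  rw [coeff_euler, linearSeries, mul_assoc, PowerSeries.coeff_C_mul]
  rcases v with _ | v
  · simp
  · rw [PowerSeries.coeff_succ_X_mul, expSeries, PowerSeries.coeff_mk, PowerSeries.coeff_mk,
      HahnSeries.single_mul_single]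
    have h1 : ((v + 1 : ℕ) : ℝ) * (1 / (v + 1).factorial) = 1 / v.factorial := by
      have := Nat.factorial_ne_zero v
      rw [Nat.factorial_succ]
      push_cast
      field_simp
    have h2 : (-1 : ℤ) + -(v : ℤ) = -((v + 1 : ℕ) : ℤ) := by omega
    rw [h2, mul_smul_comm, ← pow_succ', ← h1, mul_smul]
    ext n : 2
    rw [HahnSeries.coeff_smul, HahnSeries.coeff_single, HahnSeries.coeff_single]
    split_ifs
    · rfl
    · rw [smul_zero]

end Series

/-! ### Splitting off the part of the interaction that does not involve `ω''` -/

section Expansion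

variable {X Y : Type*} [Fintype X] [Fintype Y] {gh : X ⊕ Y → ℤ} {P : Y → Y → ℝ}
  {B : X → Y → Y → ℝ}

theorem expect_succ_one (m : ℕ) : expect gh P (m + 1) 1 = 0 := by
  rw [expect_apply, pow_succ, Module.End.mul_apply, wick_apply]
  simp [deriv_one]

/-- The term of order `ħ^m` with `v` vertices. -/
def vertexTerm (gh : X ⊕ Y → ℤ) (P : Y → Y → ℝ) (V : SFun gh) (v m : ℕ) :
    SFun (fun x : X => gh (Sum.inl x)) :=
  (1 / (v.factorial : ℝ)) • expect gh P m (V ^ v)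

/-- The perturbative expansion of the integral of `exp (t V / ħ)`. -/
def vertexSeries (gh : X ⊕ Y → ℤ) (P : Y → Y → ℝ) (V : SFun gh) :
    PowerSeries (LaurentSeries (SFun (fun x : X => gh (Sum.inl x)))) :=
  PowerSeries.mk fun v => HahnSeries.single (-(v : ℤ)) 1 *
    HahnSeries.ofPowerSeries ℤ _ (PowerSeries.mk fun m => vertexTerm gh P V v m)

/-- The expansion of the integral of `exp (t V / ħ)` for `V` without terms of order less than
two in `ω''`. -/
def reducedSeries (gh : X ⊕ Y → ℤ) (P : Y → Y → ℝ) (V : SFun gh) :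
    PowerSeries (PowerSeries (SFun (fun x : X => gh (Sum.inl x)))) :=
  PowerSeries.mk fun v => PowerSeries.mk fun n => vertexTerm gh P V v (n + v)

theorem vertexTerm_mem (hP : IsPropagator gh P) {V : SFun gh} {n : ℕ}
    (hV : V ∈ piece gh (wt X Y) n 0) (v m : ℕ) :
    vertexTerm gh P V v m ∈ piece (fun x : X => gh (Sum.inl x)) (fun _ => 0) 0 0 :=
  Submodule.smul_mem _ _ (expect_mem_piece hP (pow_mem_piece hV v))

/-- There are at least `2v` legs, and `m < v` propagators cannot absorb them. This is why negative
powers of `ħ` are absent. -/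
theorem vertexTerm_eq_zero (hP : IsPropagator gh P) {V : SFun gh}
    (hV : V ∈ piece gh (wt X Y) 2 0) {v m : ℕ} (h : m < v) : vertexTerm gh P V v m = 0 := by
  rw [vertexTerm, expect_eq_zero_of_mem hP (by omega) (pow_mem_piece hV v), smul_zero]

/-- The hypothesis `hE` expresses that `V₀` is a function of `α` alone, with `W₀` its restriction to
`ω'' = 0`. -/
theorem expect_pow_mul {V₀ : SFun gh} {W₀ : SFun (fun x : X => gh (Sum.inl x))}
    (hV₀ : V₀ ∈ piece gh (wt X Y) 0 0)
    (hE : ∀ m, ∀ f ∈ piece gh (wt X Y) 0 0, expect gh P m (f * V₀) = expect gh P m f * W₀)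
    (m j : ℕ) {f : SFun gh} (hf : f ∈ piece gh (wt X Y) 0 0) :
    expect gh P m (f * V₀ ^ j) = expect gh P m f * W₀ ^ j := by
  induction j with
  | zero => simp
  | succ j ih =>
    have h := mul_mem_piece hf (pow_mem_piece hV₀ j)
    rw [mul_zero, add_zero, add_zero] at h
    rw [pow_succ, ← mul_assoc, hE _ _ h, ih, pow_succ, mul_assoc]

theorem vertexTerm_add {V V₀ : SFun gh} {W₀ : SFun (fun x : X => gh (Sum.inl x))}
    (hV : V ∈ piece gh (wt X Y) 2 0) (hV₀ : V₀ ∈ piece gh (wt X Y) 0 0)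
    (hE : ∀ m, ∀ f ∈ piece gh (wt X Y) 0 0, expect gh P m (f * V₀) = expect gh P m f * W₀)
    (v m : ℕ) :
    vertexTerm gh P (V + V₀) v m = ∑ p ∈ Finset.HasAntidiagonal.antidiagonal v,
      vertexTerm gh P V p.1 m * ((1 / (p.2.factorial : ℝ)) • W₀ ^ p.2) := by
  rw [vertexTerm, (commute_of_mem_piece hV hV₀).add_pow', map_sum, Finset.smul_sum]
  refine Finset.sum_congr rfl fun p hp => ?_
  have hp := Finset.HasAntidiagonal.mem_antidiagonal.mp hp
  rw [map_nsmul, expect_pow_mul hV₀ hE _ _ (piece_mono (Nat.zero_le _) _ (pow_mem_piece hV p.1)),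
    vertexTerm, smul_mul_assoc, mul_smul_comm, smul_smul,
    ← Nat.cast_smul_eq_nsmul ℝ, smul_smul]
  congr 1
  have h1 := Nat.choose_mul_factorial_mul_factorial (show p.1 ≤ v by omega)
  rw [show v - p.1 = p.2 by omega] at h1
  have h2 : (v.choose p.1 : ℝ) * p.1.factorial * p.2.factorial = v.factorial := by
    exact_mod_cast h1
  have h3 : (v.factorial : ℝ) ≠ 0 := by positivity
  have h4 : (p.1.factorial : ℝ) ≠ 0 := by positivity
  have h5 : (p.2.factorial : ℝ) ≠ 0 := by positivity
  field_simp
  linarith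

theorem vertexSeries_eq_mul (hP : IsPropagator gh P) {V V₀ : SFun gh}
    {W₀ : SFun (fun x : X => gh (Sum.inl x))}
    (hV : V ∈ piece gh (wt X Y) 2 0) (hV₀ : V₀ ∈ piece gh (wt X Y) 0 0)
    (hE : ∀ m, ∀ f ∈ piece gh (wt X Y) 0 0, expect gh P m (f * V₀) = expect gh P m f * W₀) :
    vertexSeries gh P (V + V₀) =
      PowerSeries.map (HahnSeries.ofPowerSeries ℤ _) (reducedSeries gh P V) * expSeries W₀ := by
  ext v : 1
  rw [PowerSeries.coeff_mul, vertexSeries, PowerSeries.coeff_mk]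
  have h1 : (PowerSeries.mk fun m => vertexTerm gh P (V + V₀) v m) =
      ∑ p ∈ Finset.HasAntidiagonal.antidiagonal v, PowerSeries.X ^ p.1 *
        (PowerSeries.coeff p.1 (reducedSeries gh P V) *
          PowerSeries.C ((1 / (p.2.factorial : ℝ)) • W₀ ^ p.2)) := by
    ext m : 1
    rw [PowerSeries.coeff_mk, vertexTerm_add hV hV₀ hE, map_sum]
    refine Finset.sum_congr rfl fun p hp => ?_
    -- The factor `X ^ p.1` undoes the shift `n + v` built into `reducedSeries`; the orders lost in
    -- the shift are zero by `vertexTerm_eq_zero`.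
    rw [PowerSeries.coeff_X_pow_mul', reducedSeries, PowerSeries.coeff_mk, PowerSeries.coeff_mul_C]
    split_ifs with h
    · rw [PowerSeries.coeff_mk, Nat.sub_add_cancel h]
    · rw [vertexTerm_eq_zero hP hV (by omega), zero_mul]
  rw [h1, map_sum, Finset.mul_sum]
  refine Finset.sum_congr rfl fun p hp => ?_
  have hp := Finset.HasAntidiagonal.mem_antidiagonal.mp hp
  rw [← hp, hahn_single_pow_mul, PowerSeries.coeff_map, expSeries, PowerSeries.coeff_mk]

theorem coeff_zero_vertexSeries (V : SFun gh) :
    PowerSeries.coeff 0 (vertexSeries gh P V) = 1 := by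
  have h : (PowerSeries.mk fun m => vertexTerm gh P V 0 m) = 1 := by
    ext m : 1
    rw [PowerSeries.coeff_mk, PowerSeries.coeff_one, vertexTerm, pow_zero]
    rcases m with _ | m
    · simp [expect_zero_one]
    · simp [expect_succ_one]
  rw [vertexSeries, PowerSeries.coeff_mk, h, map_one (HahnSeries.ofPowerSeries ℤ _), mul_one]
  rfl

theorem coeff_zero_reducedSeries (V : SFun gh) :
    PowerSeries.coeff 0 (reducedSeries gh P V) = 1 := by
  rw [reducedSeries, PowerSeries.coeff_mk]
  ext m : 1
  rw [PowerSeries.coeff_mk, PowerSeries.coeff_one, vertexTerm, pow_zero]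
  rcases m with _ | m
  · simp [expect_zero_one]
  · rw [add_zero, expect_succ_one]; simp

theorem vertexSeries_commute (hP : IsPropagator gh P) {V : SFun gh} {n : ℕ}
    (hV : V ∈ piece gh (wt X Y) n 0) (i j : ℕ) :
    Commute (PowerSeries.coeff i (vertexSeries gh P V))
      (PowerSeries.coeff j (vertexSeries gh P V)) := by
  rw [vertexSeries, PowerSeries.coeff_mk, PowerSeries.coeff_mk]
  have h := hahn_ofPowerSeries_commute (f := PowerSeries.mk fun m => vertexTerm gh P V i m)
    (f' := PowerSeries.mk fun m => vertexTerm gh P V j m) fun a b => by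
      rw [PowerSeries.coeff_mk, PowerSeries.coeff_mk]
      exact commute_of_mem_piece (vertexTerm_mem hP hV _ _) (vertexTerm_mem hP hV _ _)
  exact ((hahn_commute_single_one _ _).mul_right (hahn_commute_single_one _ _)).mul_left
    ((hahn_commute_single_one _ _).symm.mul_right h)

theorem reducedSeries_commute (hP : IsPropagator gh P) {V : SFun gh} {n : ℕ}
    (hV : V ∈ piece gh (wt X Y) n 0) (i j : ℕ) :
    Commute (PowerSeries.coeff i (reducedSeries gh P V))
      (PowerSeries.coeff j (reducedSeries gh P V)) := by
  rw [reducedSeries, PowerSeries.coeff_mk, PowerSeries.coeff_mk]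
  refine powerSeries_commute fun a b => ?_
  rw [PowerSeries.coeff_mk, PowerSeries.coeff_mk]
  exact commute_of_mem_piece (vertexTerm_mem hP hV _ _) (vertexTerm_mem hP hV _ _)

/-- The logarithm of a product of commuting factors, obtained from the Euler equation of
`vertexSeries_eq_mul`. All negative powers of `ħ` sit in `linearSeries W₀`. -/
theorem logSeries_vertexSeries (hP : IsPropagator gh P) {V V₀ : SFun gh}
    {W₀ : SFun (fun x : X => gh (Sum.inl x))}
    (hV : V ∈ piece gh (wt X Y) 2 0) (hV₀ : V₀ ∈ piece gh (wt X Y) 0 0)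
    (hW₀ : W₀ ∈ piece (fun x : X => gh (Sum.inl x)) (fun _ => 0) 0 0)
    (hE : ∀ m, ∀ f ∈ piece gh (wt X Y) 0 0, expect gh P m (f * V₀) = expect gh P m f * W₀) :
    logSeries (vertexSeries gh P (V + V₀)) = linearSeries W₀ +
      PowerSeries.map (HahnSeries.ofPowerSeries ℤ _) (logSeries (reducedSeries gh P V)) := by
  set Z' := PowerSeries.map (HahnSeries.ofPowerSeries ℤ _) (reducedSeries gh P V) with hZ'
  set L' := PowerSeries.map (HahnSeries.ofPowerSeries ℤ _)
    (logSeries (reducedSeries gh P V)) with hL'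
  have hmap : ∀ f : PowerSeries (PowerSeries (SFun (fun x : X => gh (Sum.inl x)))),
      euler (PowerSeries.map (HahnSeries.ofPowerSeries ℤ _) f) =
        PowerSeries.map (HahnSeries.ofPowerSeries ℤ _) (euler f) := fun f =>
    euler_map (HahnSeries.ofPowerSeriesAlg ℤ ℝ (A := SFun (fun x : X => gh (Sum.inl x)))) f
  have h1 : euler Z' = euler L' * Z' := by
    rw [hZ', hL', hmap, hmap, ← map_mul, ← euler_logSeries _ (coeff_zero_reducedSeries V)
      (reducedSeries_commute hP hV)]
  have h2 : Commute Z' (linearSeries W₀) := by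
    refine powerSeries_commute fun i j => ?_
    rw [coeff_linearSeries, hZ', PowerSeries.coeff_map]
    split_ifs with h
    · have h3 : HahnSeries.single (-1 : ℤ) W₀ = HahnSeries.single (-1 : ℤ) 1 *
          HahnSeries.ofPowerSeries ℤ _ (PowerSeries.C W₀) := by
        rw [HahnSeries.ofPowerSeries_C, HahnSeries.C_apply, HahnSeries.single_mul_single]
        simp
      rw [h3]
      refine (hahn_commute_single_one _ _).symm.mul_right (hahn_ofPowerSeries_commute fun a b => ?_)
      rw [PowerSeries.coeff_C, reducedSeries, PowerSeries.coeff_mk, PowerSeries.coeff_mk]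
      split_ifs
      · exact commute_of_mem_piece (vertexTerm_mem hP hV _ _) hW₀
      · exact Commute.zero_right _
    · exact Commute.zero_right _
  have hmem : V + V₀ ∈ piece gh (wt X Y) 0 0 := add_mem (piece_mono (Nat.zero_le _) _ hV) hV₀
  refine logSeries_unique (coeff_zero_vertexSeries _) (vertexSeries_commute hP hmem) ?_ ?_
  · rw [map_add, coeff_linearSeries, hL', PowerSeries.coeff_map,
      coeff_zero_logSeries _ (coeff_zero_reducedSeries V)]
    simp
  · rw [vertexSeries_eq_mul hP hV hV₀ hE, ← hZ', euler_mul, h1, euler_expSeries, map_add,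
      euler_linearSeries, ← mul_assoc, h2.eq, ← mul_assoc, add_mul, add_mul, add_comm]

end Expansion

/-! ### The one-loop coefficient for a cubic interaction -/

section OneLoop

variable {X Y : Type*} [Fintype X] [Fintype Y] [DecidableEq Y] {gh : X ⊕ Y → ℤ} {P : Y → Y → ℝ}
  {B : X → Y → Y → ℝ}

/-- The logarithm of the Gaussian integral. -/
def gaussLog (gh : X ⊕ Y → ℤ) (P : Y → Y → ℝ) (B : X → Y → Y → ℝ) (v : ℕ) :
    SFun (fun x : X => gh (Sum.inl x)) :=
  ((1 / 2 : ℝ) * (-1) ^ v / v) • ∑ y, eps (par gh (Sum.inr y)) (par gh (Sum.inr y)) •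
    (loopMatrix gh P B ^ v) y y

theorem gauss_mem (hP : IsPropagator gh P) (hB : IsQuadratic gh B) (v : ℕ) :
    gauss gh P B v ∈ piece (fun x : X => gh (Sum.inl x)) (fun _ => 0) 0 0 :=
  Submodule.smul_mem _ _ (expect_mem_piece hP (pow_mem_piece (quadForm_mem hB) v))

/-- `gauss_recursion` is precisely the Euler equation that characterises the logarithm. -/
theorem logSeries_gauss (hP : IsPropagator gh P) (hB : IsQuadratic gh B) :
    logSeries (PowerSeries.mk (gauss gh P B)) = PowerSeries.mk (gaussLog gh P B) := by
  refine logSeries_unique ?_ ?_ ?_ ?_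
  · rw [PowerSeries.coeff_mk, gauss_zero]
  · intro i j
    rw [PowerSeries.coeff_mk, PowerSeries.coeff_mk]
    exact commute_of_mem_piece (gauss_mem hP hB i) (gauss_mem hP hB j)
  · rw [PowerSeries.coeff_mk, gaussLog]
    simp
  · ext v : 1
    rw [coeff_euler, PowerSeries.coeff_mk, PowerSeries.coeff_mul]
    rcases v with _ | v
    · simp [coeff_euler]
    · rw [Finset.Nat.sum_antidiagonal_eq_sum_range_succ_mk, Finset.sum_range_succ', coeff_euler,
        Nat.cast_zero, zero_smul, zero_mul, add_zero]
      have := gauss_recursion (P := P) hP hB v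
      push_cast
      rw [this]
      refine Finset.sum_congr rfl fun k _ => ?_
      rw [coeff_euler, PowerSeries.coeff_mk, PowerSeries.coeff_mk, gaussLog, smul_smul,
        smul_mul_assoc]
      congr 1
      have : ((k : ℝ) + 1) ≠ 0 := by positivity
      push_cast
      field_simp

/-- Every term of the difference contains a factor `V₃`, hence at least one leg more than `2v`. -/
theorem add_pow_sub_pow_mem {Q V₃ : SFun gh} (hQ : Q ∈ piece gh (wt X Y) 2 0)
    (hV₃ : V₃ ∈ piece gh (wt X Y) 3 0) (v : ℕ) :
    (Q + V₃) ^ v - Q ^ v ∈ piece gh (wt X Y) (2 * v + 1) 0 := by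
  induction v with
  | zero => simp
  | succ v ih =>
    have h : (Q + V₃) ^ (v + 1) - Q ^ (v + 1) =
        (Q + V₃) * ((Q + V₃) ^ v - Q ^ v) + V₃ * Q ^ v := by
      rw [pow_succ', pow_succ', mul_sub, add_mul, add_mul]
      abel
    rw [h]
    refine add_mem ?_ ?_
    · have := mul_mem_piece (add_mem hQ (piece_mono (by omega) _ hV₃)) ih
      rw [add_zero] at this
      exact piece_mono (by omega) _ this
    · have := mul_mem_piece hV₃ (pow_mem_piece hQ v)
      rw [add_zero] at this
      exact piece_mono (by omega) _ this

theorem vertexTerm_self (hP : IsPropagator gh P) (hB : IsQuadratic gh B) {V₃ : SFun gh}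
    (hV₃ : V₃ ∈ piece gh (wt X Y) 3 0) (v : ℕ) :
    vertexTerm gh P (quadForm gh B + V₃) v v = gauss gh P B v := by
  have h := expect_eq_zero_of_mem hP (by omega)
    (add_pow_sub_pow_mem (quadForm_mem hB) hV₃ v) (m := v)
  rw [map_sub, sub_eq_zero] at h
  rw [vertexTerm, gauss, h]

/-- The constant coefficient as a homomorphism of algebras. -/
def constCoeffHom (R : Type*) [Ring R] [Algebra ℝ R] : PowerSeries R →ₐ[ℝ] R :=
  { (PowerSeries.constantCoeff : PowerSeries R →+* R) with
    commutes' := fun r => by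
      simp [PowerSeries.algebraMap_apply] }

/-- Setting `ħ = 0` is a homomorphism of algebras and so commutes with the logarithm. At `ħ = 0`
there are as many propagators as vertices, which leaves no room for cubic vertices in `ω''`. -/
theorem constantCoeff_logSeries_reducedSeries (hP : IsPropagator gh P) (hB : IsQuadratic gh B)
    {V₃ : SFun gh} (hV₃ : V₃ ∈ piece gh (wt X Y) 3 0) (v : ℕ) :
    PowerSeries.coeff 0 (PowerSeries.coeff v
      (logSeries (reducedSeries gh P (quadForm gh B + V₃)))) = gaussLog gh P B v := by
  have h1 : PowerSeries.map (constCoeffHom (SFun (fun x : X => gh (Sum.inl x))) :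
      PowerSeries (SFun (fun x : X => gh (Sum.inl x))) →+* _)
      (reducedSeries gh P (quadForm gh B + V₃)) = PowerSeries.mk (gauss gh P B) := by
    ext v : 1
    rw [PowerSeries.coeff_map, reducedSeries, PowerSeries.coeff_mk, PowerSeries.coeff_mk]
    change PowerSeries.constantCoeff (PowerSeries.mk _) = _
    rw [← PowerSeries.coeff_zero_eq_constantCoeff_apply, PowerSeries.coeff_mk, zero_add,
      vertexTerm_self hP hB hV₃]
  have h2 := logSeries_map (constCoeffHom (SFun (fun x : X => gh (Sum.inl x))))
    (reducedSeries gh P (quadForm gh B + V₃))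
  rw [h1, logSeries_gauss hP hB] at h2
  have h3 := congrArg (PowerSeries.coeff v) h2
  rw [PowerSeries.coeff_mk, PowerSeries.coeff_map] at h3
  rw [h3]
  exact PowerSeries.coeff_zero_eq_constantCoeff_apply _

/-- The cubic form with coefficients `C / 6`. -/
def cubicForm {Z : Type*} [Fintype Z] (gh : Z → ℤ) (C : Z → Z → Z → ℝ) : SFun gh :=
  (1 / 6 : ℝ) • ∑ x, ∑ y, ∑ z, C x y z • (coord gh x * coord gh y * coord gh z)

/-- The compatibility of the coefficients of a cubic form with parities and its graded
symmetry. -/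
structure IsCubic {Z : Type*} (gh : Z → ℤ) (C : Z → Z → Z → ℝ) : Prop where
  par_eq : ∀ {x y z}, C x y z ≠ 0 → par gh x + par gh y + par gh z = 0
  swap_left : ∀ x y z, C y x z = eps (par gh x) (par gh y) * C x y z
  swap_right : ∀ x y z, C x z y = eps (par gh y) (par gh z) * C x y z

section

variable {Z : Type*} {gh : Z → ℤ} {C : Z → Z → Z → ℝ}

theorem IsCubic.term_swap_left (hC : IsCubic gh C) (x y z : Z) :
    C y x z • (coord gh y * coord gh x * coord gh z) =
      C x y z • (coord gh x * coord gh y * coord gh z) := by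
  rw [hC.swap_left x y z, coord_mul_coord gh y x, koszul_eq_eps, smul_mul_assoc, smul_smul,
    eps_symm (par gh y), mul_right_comm, eps_mul_self, one_mul]

theorem IsCubic.term_swap_right (hC : IsCubic gh C) (x y z : Z) :
    C x z y • (coord gh x * coord gh z * coord gh y) =
      C x y z • (coord gh x * coord gh y * coord gh z) := by
  rw [hC.swap_right x y z, mul_assoc, coord_mul_coord gh z y, koszul_eq_eps, mul_smul_comm,
    smul_smul, eps_symm (par gh z), mul_right_comm, eps_mul_self, one_mul, mul_assoc]

theorem IsCubic.term_mem (hC : IsCubic gh C) (w : Z → ℕ) (x y z : Z) :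
    C x y z • (coord gh x * coord gh y * coord gh z) ∈ piece gh w (w x + w y + w z) 0 := by
  by_cases h0 : C x y z = 0
  · simp [h0]
  · rw [← hC.par_eq h0]
    exact Submodule.smul_mem _ _ (mul_mem_piece (mul_mem_piece (coord_mem_piece x)
      (coord_mem_piece y)) (coord_mem_piece z))

theorem cubicForm_mem [Fintype Z] (hC : IsCubic gh C) :
    cubicForm gh C ∈ piece gh (fun _ => 0) 0 0 :=
  Submodule.smul_mem _ _ (Submodule.sum_mem _ fun x _ => Submodule.sum_mem _ fun y _ =>
    Submodule.sum_mem _ fun z _ => hC.term_mem (fun _ => 0) x y z)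

end

theorem IsCubic.inl {C : X ⊕ Y → X ⊕ Y → X ⊕ Y → ℝ} (hC : IsCubic gh C) :
    IsCubic (fun x : X => gh (Sum.inl x))
      (fun x y z => C (Sum.inl x) (Sum.inl y) (Sum.inl z)) :=
  ⟨fun h => hC.par_eq h, fun _ _ _ => hC.swap_left _ _ _, fun _ _ _ => hC.swap_right _ _ _⟩

theorem IsCubic.isQuadratic {C : X ⊕ Y → X ⊕ Y → X ⊕ Y → ℝ} (hC : IsCubic gh C) :
    IsQuadratic gh fun x y y' => C (Sum.inl x) (Sum.inr y) (Sum.inr y') where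
  par_eq {x y y'} h := by
    have h1 := hC.par_eq h
    rw [add_assoc] at h1
    have h2 := add_self_zmod_two (par gh (Sum.inl x))
    exact add_left_cancel (h2.trans h1.symm)
  symm x y y' := hC.swap_right _ _ _

/-- By symmetry `h0` removes all terms with a single `ω''`, and the three positions of a single `α`
contribute equally, which turns `1/6` into `1/2`. -/
theorem cubicForm_decompose {C : X ⊕ Y → X ⊕ Y → X ⊕ Y → ℝ} (hC : IsCubic gh C)
    (h0 : ∀ x x' y, C (Sum.inl x) (Sum.inl x') (Sum.inr y) = 0) :
    cubicForm gh C = quadForm gh (fun x y y' => C (Sum.inl x) (Sum.inr y) (Sum.inr y')) +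
      (1 / 6 : ℝ) • (∑ x, ∑ y, ∑ z, C (Sum.inr x) (Sum.inr y) (Sum.inr z) •
        (coord gh (Sum.inr x) * coord gh (Sum.inr y) * coord gh (Sum.inr z))) +
      (1 / 6 : ℝ) • (∑ x, ∑ y, ∑ z, C (Sum.inl x) (Sum.inl y) (Sum.inl z) •
        (coord gh (Sum.inl x) * coord gh (Sum.inl y) * coord gh (Sum.inl z))) := by
  have h1 : ∀ x x' y, C (Sum.inl x) (Sum.inr y) (Sum.inl x') = 0 := fun x x' y => by
    rw [hC.swap_right _ (Sum.inl x') (Sum.inr y), h0, mul_zero]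
  have h2 : ∀ x x' y, C (Sum.inr y) (Sum.inl x) (Sum.inl x') = 0 := fun x x' y => by
    rw [hC.swap_left (Sum.inl x) (Sum.inr y), h1, mul_zero]
  have h3 : ∑ y, ∑ x, ∑ y', C (Sum.inr y) (Sum.inl x) (Sum.inr y') •
      (coord gh (Sum.inr y) * coord gh (Sum.inl x) * coord gh (Sum.inr y')) =
      ∑ x, ∑ y, ∑ y', C (Sum.inl x) (Sum.inr y) (Sum.inr y') •
      (coord gh (Sum.inl x) * coord gh (Sum.inr y) * coord gh (Sum.inr y')) := by
    rw [Finset.sum_comm]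
    simp only [hC.term_swap_left (Sum.inl _) (Sum.inr _)]
  have h4 : ∑ y, ∑ y', ∑ x, C (Sum.inr y) (Sum.inr y') (Sum.inl x) •
      (coord gh (Sum.inr y) * coord gh (Sum.inr y') * coord gh (Sum.inl x)) =
      ∑ x, ∑ y, ∑ y', C (Sum.inl x) (Sum.inr y) (Sum.inr y') •
      (coord gh (Sum.inl x) * coord gh (Sum.inr y) * coord gh (Sum.inr y')) := by
    rw [← h3]
    refine Finset.sum_congr rfl fun y _ => ?_
    rw [Finset.sum_comm]
    simp only [hC.term_swap_right (Sum.inr _) (Sum.inl _) (Sum.inr _)]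
  have h5 : quadForm gh (fun x y y' => C (Sum.inl x) (Sum.inr y) (Sum.inr y')) = (1 / 2 : ℝ) •
      ∑ x, ∑ y, ∑ y', C (Sum.inl x) (Sum.inr y) (Sum.inr y') •
      (coord gh (Sum.inl x) * coord gh (Sum.inr y) * coord gh (Sum.inr y')) := by
    rw [quadForm]
    congr 1
    simp only [quadCoeffTotal, Finset.sum_mul, smul_mul_assoc]
    rw [Finset.sum_comm]
    conv_rhs => rw [Finset.sum_comm]; enter [2, y]; rw [Finset.sum_comm]
    conv_lhs => rw [Finset.sum_comm]
    simp only [mul_assoc]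
  rw [cubicForm, h5]
  simp only [Fintype.sum_sum_type, Finset.sum_add_distrib, h0, h1, h2, h3, h4, zero_smul,
    Finset.sum_const_zero]
  module

variable {C : X ⊕ Y → X ⊕ Y → X ⊕ Y → ℝ}

theorem expect_mul_cubicForm (hP : IsPropagator gh P) (hC : IsCubic gh C) (m : ℕ) {f : SFun gh}
    (hf : f ∈ piece gh (wt X Y) 0 0) :
    expect gh P m (f * (1 / 6 : ℝ) • (∑ x, ∑ y, ∑ z, C (Sum.inl x) (Sum.inl y) (Sum.inl z) •
        (coord gh (Sum.inl x) * coord gh (Sum.inl y) * coord gh (Sum.inl z)))) =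
      expect gh P m f * cubicForm (fun x : X => gh (Sum.inl x))
        (fun x y z => C (Sum.inl x) (Sum.inl y) (Sum.inl z)) := by
  rw [cubicForm, mul_smul_comm, mul_smul_comm, map_smul]
  congr 1
  simp only [Finset.mul_sum, map_sum]
  refine Finset.sum_congr rfl fun x _ => Finset.sum_congr rfl fun y _ =>
    Finset.sum_congr rfl fun z _ => ?_
  have h1 : C (Sum.inl x) (Sum.inl y) (Sum.inl z) • (coord (fun x : X => gh (Sum.inl x)) x *
      coord (fun x : X => gh (Sum.inl x)) y * coord (fun x : X => gh (Sum.inl x)) z) ∈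
      piece (fun x : X => gh (Sum.inl x)) (fun _ => 0) 0 0 :=
    hC.inl.term_mem (fun _ => 0) x y z
  have h2 := expect_mem_piece (m := m) hP hf
  have h3 := hC.term_mem (wt X Y) (Sum.inl x) (Sum.inl y) (Sum.inl z)
  have h4 := commute_of_mem_piece hf h3
  have h5 := commute_of_mem_piece h2 h1
  rw [h4.eq, h5.eq]
  simp only [smul_mul_assoc, map_smul, mul_assoc, expect_inl_mul hP]

/-- The logarithm of the perturbative expansion for a cubic interaction without terms linear
in `ω''`. -/
theorem logSeries_cubic (hP : IsPropagator gh P) (hC : IsCubic gh C)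
    (h0 : ∀ x x' y, C (Sum.inl x) (Sum.inl x') (Sum.inr y) = 0) (v : ℕ) :
    ∃ f : PowerSeries (SFun (fun x : X => gh (Sum.inl x))),
      PowerSeries.coeff v (logSeries (vertexSeries gh P (cubicForm gh C))) =
        (if v = 1 then HahnSeries.single (-1 : ℤ) (cubicForm (fun x : X => gh (Sum.inl x))
          (fun x y z => C (Sum.inl x) (Sum.inl y) (Sum.inl z))) else 0) +
        HahnSeries.ofPowerSeries ℤ _ f ∧
      PowerSeries.coeff 0 f =
        gaussLog gh P (fun x y y' => C (Sum.inl x) (Sum.inr y) (Sum.inr y')) v := by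
  have h3 : (1 / 6 : ℝ) • (∑ x, ∑ y, ∑ z, C (Sum.inr x) (Sum.inr y) (Sum.inr z) •
        (coord gh (Sum.inr x) * coord gh (Sum.inr y) * coord gh (Sum.inr z))) ∈
      piece gh (wt X Y) 3 0 :=
    Submodule.smul_mem _ _ (Submodule.sum_mem _ fun x _ => Submodule.sum_mem _ fun y _ =>
      Submodule.sum_mem _ fun z _ => hC.term_mem (wt X Y) (Sum.inr x) (Sum.inr y) (Sum.inr z))
  have h4 : (1 / 6 : ℝ) • (∑ x, ∑ y, ∑ z, C (Sum.inl x) (Sum.inl y) (Sum.inl z) •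
        (coord gh (Sum.inl x) * coord gh (Sum.inl y) * coord gh (Sum.inl z))) ∈
      piece gh (wt X Y) 0 0 :=
    Submodule.smul_mem _ _ (Submodule.sum_mem _ fun x _ => Submodule.sum_mem _ fun y _ =>
      Submodule.sum_mem _ fun z _ => hC.term_mem (wt X Y) (Sum.inl x) (Sum.inl y) (Sum.inl z))
  have h2 := add_mem (quadForm_mem hC.isQuadratic) (piece_mono (show 2 ≤ 3 by omega) _ h3)
  refine ⟨_, ?_, constantCoeff_logSeries_reducedSeries hP hC.isQuadratic h3 v⟩
  rw [cubicForm_decompose hC h0, logSeries_vertexSeries hP h2 h4 (cubicForm_mem hC.inl)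
    (fun m f hf => expect_mul_cubicForm hP hC m hf), map_add, coeff_linearSeries,
    PowerSeries.coeff_map]

end OneLoop

/-! ## dg Frobenius algebras with relaxed induction data -/

section SignOperator

variable {A : Type*} [Ring A] [Algebra ℝ A] (𝒞 : ℕ → Submodule ℝ A) [GradedAlgebra 𝒞]

/-- The operator multiplying homogeneous elements of degree `i` by `(-1)^i`. -/
def signOp : A →ₗ[ℝ] A :=
  (DirectSum.toModule ℝ ℕ A fun i => (-1 : ℝ) ^ i • (𝒞 i).subtype) ∘ₗ
    (DirectSum.decomposeLinearEquiv 𝒞).toLinearMap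

theorem signOp_of_mem {i : ℕ} {a : A} (ha : a ∈ 𝒞 i) : signOp 𝒞 a = (-1 : ℝ) ^ i • a := by
  change DirectSum.toModule ℝ ℕ A (fun i => (-1 : ℝ) ^ i • (𝒞 i).subtype)
    (DirectSum.decompose 𝒞 a) = _
  rw [DirectSum.decompose_of_mem 𝒞 ha]
  exact DirectSum.toModule_lof ℝ i _

theorem signOp_signOp (a : A) : signOp 𝒞 (signOp 𝒞 a) = a := by
  induction a using DirectSum.Decomposition.inductionOn 𝒞 with
  | zero => simp
  | @homogeneous i a =>
    rw [signOp_of_mem 𝒞 a.2, map_smul, signOp_of_mem 𝒞 a.2, smul_smul, ← mul_pow]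
    simp
  | add a b ha hb => rw [map_add, map_add, ha, hb]

end SignOperator

/-! ### The pairing, the transpose of `ι` and the complement of `ι(H)` -/

section Frobenius

variable {A : Type*} [Ring A] [Algebra ℝ A] {𝒞 : ℕ → Submodule ℝ A} [GradedAlgebra 𝒞]
  {D : DGFrobenius 𝒞}

namespace DGFrobenius

/-- Only degrees with `i + j = 3` pair, and then `i * j` is even, so no sign survives. -/
theorem pair_comm (D : DGFrobenius 𝒞) (a b : A) : D.pair a b = D.pair b a := by
  induction a using DirectSum.Decomposition.inductionOn 𝒞 with
  | zero => simp
  | @homogeneous i a =>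
    induction b using DirectSum.Decomposition.inductionOn 𝒞 with
    | zero => simp
    | @homogeneous j b =>
      by_cases h : D.pair (a : A) b = 0
      · by_cases h' : D.pair (b : A) a = 0
        · rw [h, h']
        · rw [D.pair_symm b.2 a.2, h, mul_zero] at h'
          exact absurd rfl h'
      · have h3 := D.pair_degree a.2 b.2 h
        have : Even (i * j) := by
          rcases Nat.even_or_odd i with hi | hi
          · exact hi.mul_right j
          · refine Even.mul_left ?_ i
            rw [Nat.even_iff]; rw [Nat.odd_iff] at hi; omega
        rw [D.pair_symm a.2 b.2, this.neg_one_pow, one_mul]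
    | add b b' hb hb' => simp only [map_add, LinearMap.add_apply, hb, hb']
  | add a a' ha ha' => simp only [map_add, LinearMap.add_apply, ha, ha']

theorem pair_d (D : DGFrobenius 𝒞) (a b : A) : D.pair (D.d a) b = -D.pair (signOp 𝒞 a) (D.d b) := by
  induction a using DirectSum.Decomposition.inductionOn 𝒞 with
  | zero => simp
  | @homogeneous i a =>
    rw [signOp_of_mem 𝒞 a.2, map_smul, LinearMap.smul_apply, smul_eq_mul]
    exact eq_neg_of_add_eq_zero_left (D.d_skew b a.2)
  | add a a' ha ha' => simp only [map_add, LinearMap.add_apply, ha, ha', neg_add]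

theorem pair_of_ne (D : DGFrobenius 𝒞) {i j : ℕ} {a b : A} (ha : a ∈ 𝒞 i) (hb : b ∈ 𝒞 j)
    (h : i + j ≠ 3) : D.pair a b = 0 := by
  by_contra h0
  exact h (D.pair_degree ha hb h0)

theorem eq_zero_of_pair (D : DGFrobenius 𝒞) {a : A} (h : ∀ b, D.pair b a = 0) : a = 0 :=
  D.pair_nondegenerate.2 a h

theorem cls_surjective (D : DGFrobenius 𝒞) : Function.Surjective D.cls :=
  Submodule.mkQ_surjective _

end DGFrobenius

variable {ι : D.Cohomology →ₗ[ℝ] A} {K : A →ₗ[ℝ] A}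

theorem DGFrobenius.IsEmbedding.d_apply (hι : D.IsEmbedding ι) (x : D.Cohomology) :
    D.d (ι x) = 0 := by
  obtain ⟨a, rfl⟩ := D.cls_surjective x
  obtain ⟨c, hc⟩ := hι.represents a
  have h := congrArg D.d hc
  rwa [D.d_d, map_sub, LinearMap.mem_ker.mp a.2, sub_zero, eq_comm] at h

theorem DGFrobenius.IsEmbedding.pair_d (hι : D.IsEmbedding ι) (x : D.Cohomology) (b : A) :
    D.pair (D.d b) (ι x) = 0 := by
  rw [D.pair_d, hι.d_apply, map_zero, neg_zero]

theorem DGFrobenius.IsEmbedding.injective (hι : D.IsEmbedding ι) : Function.Injective ι := by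
  rw [← LinearMap.ker_eq_bot, LinearMap.ker_eq_bot']
  intro x hx
  obtain ⟨a, rfl⟩ := D.cls_surjective x
  obtain ⟨c, hc⟩ := hι.represents a
  rw [hx, zero_sub] at hc
  refine (Submodule.Quotient.mk_eq_zero _).2 ?_
  exact ⟨-c, by rw [map_neg, hc, neg_neg]; rfl⟩

theorem DGFrobenius.IsAlgHom.exists_mul (hι : D.IsAlgHom ι) (x y : D.Cohomology) :
    ∃ z, ι x * ι y = ι z := by
  obtain ⟨a, rfl⟩ := D.cls_surjective x
  obtain ⟨b, rfl⟩ := D.cls_surjective y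
  exact ⟨_, (hι.map_mul a b).symm⟩

namespace DGFrobenius.IsRelaxed

theorem pair_K (hK : D.IsRelaxed ι K) (a b : A) :
    D.pair (K a) b = D.pair (signOp 𝒞 a) (K b) := by
  induction a using DirectSum.Decomposition.inductionOn 𝒞 with
  | zero => simp
  | @homogeneous i a =>
    rw [signOp_of_mem 𝒞 a.2, map_smul, LinearMap.smul_apply, smul_eq_mul]
    exact hK.symm b a.2
  | add a a' ha ha' => simp only [map_add, LinearMap.add_apply, ha, ha']

theorem pair_K_embedding (hK : D.IsRelaxed ι K) (a : A) (x : D.Cohomology) :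
    D.pair (K a) (ι x) = 0 := by
  rw [hK.pair_K, hK.comp_embedding, map_zero]

/-- The transpose of `ι`. -/
def transpose (hK : D.IsRelaxed ι K) : A →ₗ[ℝ] D.Cohomology := hK.homotopy.choose

theorem pair_transpose (hK : D.IsRelaxed ι K) (a : A) (x : D.Cohomology) :
    D.pair (ι (hK.transpose a)) (ι x) = D.pair a (ι x) := hK.homotopy.choose_spec.1 a x

theorem homotopy_eq (hK : D.IsRelaxed ι K) (a : A) :
    D.d (K a) + K (D.d a) = a - ι (hK.transpose a) := hK.homotopy.choose_spec.2 a

/-- The induced pairing on cohomology is non-degenerate: by the homotopy relation `𝒞` is spanned by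
the images of `d`, `K` and `ι`, and the first two are orthogonal to `ι(H)`. -/
theorem eq_zero_of_pair_embedding (hι : D.IsEmbedding ι) (hK : D.IsRelaxed ι K) {x : D.Cohomology}
    (h : ∀ y, D.pair (ι x) (ι y) = 0) : ι x = 0 := by
  refine D.eq_zero_of_pair fun a => ?_
  have h1 := hK.homotopy_eq a
  rw [eq_sub_iff_add_eq] at h1
  rw [← h1, map_add, map_add, LinearMap.add_apply, LinearMap.add_apply, hι.pair_d,
    hK.pair_K_embedding, D.pair_comm, h, add_zero, add_zero]

/-- The transpose is only known to exist; non-degeneracy on `ι(H)` makes it independent of the chain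
homotopy that provides it. -/
theorem transpose_unique (hι : D.IsEmbedding ι) (hK : D.IsRelaxed ι K) {a : A} {y : D.Cohomology}
    (h : ∀ x, D.pair (ι y) (ι x) = D.pair a (ι x)) : ι y = ι (hK.transpose a) := by
  rw [← sub_eq_zero, ← map_sub]
  refine eq_zero_of_pair_embedding hι hK fun x => ?_
  rw [map_sub, map_sub, LinearMap.sub_apply, h, hK.pair_transpose, sub_self]

theorem sub_transpose_mem (hK : D.IsRelaxed ι K) (a : A) :
    a - ι (hK.transpose a) ∈ D.complement ι := fun x => by
  rw [map_sub, LinearMap.sub_apply, hK.pair_transpose, sub_self]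

theorem K_mem (hK : D.IsRelaxed ι K) (a : A) : K a ∈ D.complement ι :=
  fun x => hK.pair_K_embedding a x

theorem K_sub_transpose (hK : D.IsRelaxed ι K) (a : A) : K (a - ι (hK.transpose a)) = K a := by
  rw [map_sub, hK.comp_embedding, sub_zero]

theorem eq_zero_of_complement (hK : D.IsRelaxed ι K) {w : A} (hw : w ∈ D.complement ι)
    (h : ∀ c ∈ D.complement ι, D.pair c w = 0) : w = 0 := by
  refine D.eq_zero_of_pair fun a => ?_
  have h1 := h _ (hK.sub_transpose_mem a)
  rwa [map_sub, LinearMap.sub_apply, D.pair_comm (ι _), hw, sub_zero] at h1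

end DGFrobenius.IsRelaxed

end Frobenius

/-! ## The coefficients of the action -/

section Coefficients

theorem DGFrobenius.IsEmbedding.mem_of_basis {A : Type*} [Ring A] [Algebra ℝ A]
    {𝒞 : ℕ → Submodule ℝ A} [GradedAlgebra 𝒞] {D : DGFrobenius 𝒞} {ι : D.Cohomology →ₗ[ℝ] A}
    (hι : D.IsEmbedding ι) {J : Type*} (h : HomogeneousBasis D.cohomologyDeg J) (j : J) :
    ι (h.basis j) ∈ 𝒞 (h.deg j) := hι.mem (h.mem j)

theorem par_ghost {Z : Type*} (deg : Z → ℕ) (z : Z) :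
    par (ghost deg) z = ((deg z + 1 : ℕ) : ZMod 2) := by
  have h : Even (ghost deg z) ↔ Even (deg z + 1) := by
    rw [ghost, Int.even_iff, Nat.even_iff]; omega
  rw [par]
  split_ifs with h1
  · rw [(ZMod.natCast_eq_zero_iff_even).2 (h.1 h1)]
  · rw [(ZMod.natCast_eq_one_iff_odd).2 (Nat.not_even_iff_odd.1 (mt h.2 h1))]

variable {A : Type*} [Ring A] [Algebra ℝ A] {𝒞 : ℕ → Submodule ℝ A} [GradedAlgebra 𝒞]
  (D : DGFrobenius 𝒞) {g : Type*} [LieRing g] [LieAlgebra ℝ g] (κ : LinearMap.BilinForm ℝ g)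

/-- The coefficients of the cubic term of the action. -/
def cubicCoeff {Z : Type*} (deg : Z → ℕ) (τ : Z → g) (c : Z → A) (x y z : Z) : ℝ :=
  (-1 : ℝ) ^ (deg y * (deg z + 1)) * (κ (τ x) ⁅τ y, τ z⁆ * D.pair (c x) (c y * c z))

/-- Cyclicity and graded commutativity of the product meet the antisymmetry of `κ(X, [Y, Z])`; the
shift of the degrees by one turns the result into the Koszul signs of the coordinates. -/
theorem isCubic_cubicCoeff (hκ : IsQuadraticForm κ) {Z : Type*} (deg : Z → ℕ) (τ : Z → g)
    (c : Z → A) (hc : ∀ z, c z ∈ 𝒞 (deg z)) : IsCubic (ghost deg) (cubicCoeff D κ deg τ c) where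
  par_eq {x y z} h := by
    have h1 : D.pair (c x) (c y * c z) ≠ 0 := fun h0 => h (by rw [cubicCoeff, h0]; simp)
    have h2 := D.pair_degree (hc x) (SetLike.mul_mem_graded (hc y) (hc z)) h1
    -- The pairing forces total degree `3`, and the three shifts by one make it `6`, which is even.
    rw [par_ghost, par_ghost, par_ghost, ← Nat.cast_add, ← Nat.cast_add,
      show deg x + 1 + (deg y + 1) + (deg z + 1) = 6 by omega]
    decide
  swap_left x y z := by
    rw [cubicCoeff, cubicCoeff, par_ghost, par_ghost]
    by_cases h : deg x + (deg y + deg z) = 3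
    · have h1 : D.pair (c y) (c x * c z) =
          (-1 : ℝ) ^ (deg y * deg x) * D.pair (c x) (c y * c z) := by
        rw [D.cyclic, D.cyclic, D.graded_comm (hc y) (hc x), map_smul, LinearMap.smul_apply,
          smul_eq_mul]
      have h2 : κ (τ y) ⁅τ x, τ z⁆ = -κ (τ x) ⁅τ y, τ z⁆ := by
        rw [← hκ.invariant, ← hκ.invariant, ← lie_skew, map_neg, LinearMap.neg_apply]
      -- The sign in `cubicCoeff` treats `x` and `y` differently; eliminating `deg z` by means of
      -- the total degree `3` makes the comparison possible.
      have h3 : ((deg z : ℕ) : ZMod 2) = 1 + deg x + deg y := by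
        have := congrArg (fun n : ℕ => (n : ZMod 2)) h
        push_cast at this
        generalize (deg z : ZMod 2) = k at *
        generalize (deg x : ZMod 2) = i at *
        generalize (deg y : ZMod 2) = j at *
        revert i j k
        decide
      rw [h1, h2, ← eps_natCast, ← eps_natCast, ← eps_natCast]
      push_cast
      rw [h3]
      rcases zmod_two_cases (deg x) with hx | hx <;> rcases zmod_two_cases (deg y) with hy | hy <;>
        simp [hx, hy, one_add_one_zmod_two]
    · rw [D.pair_of_ne (hc x) (SetLike.mul_mem_graded (hc y) (hc z)) h,
        D.pair_of_ne (hc y) (SetLike.mul_mem_graded (hc x) (hc z)) (by omega)]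
      simp
  swap_right x y z := by
    have h1 : D.pair (c x) (c z * c y) =
        (-1 : ℝ) ^ (deg z * deg y) * D.pair (c x) (c y * c z) := by
      rw [D.graded_comm (hc z) (hc y), map_smul, smul_eq_mul]
    have h2 : κ (τ x) ⁅τ z, τ y⁆ = -κ (τ x) ⁅τ y, τ z⁆ := by
      rw [← lie_skew, map_neg]
    rw [cubicCoeff, cubicCoeff, par_ghost, par_ghost, h1, h2, ← eps_natCast, ← eps_natCast,
      ← eps_natCast]
    push_cast
    rcases zmod_two_cases (deg y) with hx | hx <;> rcases zmod_two_cases (deg z) with hy | hy <;>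
        simp [hx, hy, one_add_one_zmod_two]

end Coefficients

/-! ### The propagator on `𝒞''` and its symmetries -/

section Propagator

variable {A : Type*} [Ring A] [Algebra ℝ A] {𝒞 : ℕ → Submodule ℝ A} [GradedAlgebra 𝒞]
  (D : DGFrobenius 𝒞) {ι : D.Cohomology →ₗ[ℝ] A} (K : A →ₗ[ℝ] A)
  {M : Type*} [Fintype M] (u : HomogeneousBasis (D.complementDeg ι) M)

/-- The matrix of the pairing on `𝒞''`. -/
def gram : Matrix M M ℝ := Matrix.of fun m n => D.pair (u.basis m : A) (u.basis n : A)

/-- The matrix of the form `π(·, K ·)` on `𝒞''`. -/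
def gramK : Matrix M M ℝ := Matrix.of fun m n => D.pair (u.basis m : A) (K (u.basis n : A))

theorem propagator_eq [DecidableEq M] :
    propagator D ι K u = (gram D u)⁻¹ * gramK D K u * (gram D u)⁻¹ := by
  rw [propagator]
  congr!

theorem basis_mem (m : M) : (u.basis m : A) ∈ 𝒞 (u.deg m) := u.mem m

theorem gram_mulVec (v : M → ℝ) (m : M) :
    (gram D u).mulVec v m = D.pair (u.basis m : A) ((∑ n, v n • u.basis n : D.complement ι) : A) := by
  simp [Matrix.mulVec, dotProduct, gram, map_sum, mul_comm]

variable {D K}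

theorem gram_isUnit [DecidableEq M] (hK : D.IsRelaxed ι K) : IsUnit (gram D u) := by
  rw [← Matrix.mulVec_injective_iff_isUnit, ← Matrix.coe_mulVecLin, ← LinearMap.ker_eq_bot,
    LinearMap.ker_eq_bot']
  intro v hv
  set w : D.complement ι := ∑ n, v n • u.basis n with hw
  have h1 : (w : A) = 0 := by
    refine hK.eq_zero_of_complement w.2 fun c hc => ?_
    have h2 := u.basis.sum_repr ⟨c, hc⟩
    have h3 : c = ∑ m, u.basis.repr ⟨c, hc⟩ m • (u.basis m : A) := by
      have h4 := congrArg Subtype.val h2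
      simp only [AddSubmonoidClass.coe_finsetSum, SetLike.val_smul] at h4
      exact h4.symm
    rw [h3, map_sum, LinearMap.sum_apply]
    refine Finset.sum_eq_zero fun m _ => ?_
    rw [map_smul, LinearMap.smul_apply, ← gram_mulVec]
    have := congrFun hv m
    rw [Matrix.mulVecLin_apply] at this
    rw [this]; simp
  have h2 : w = 0 := Subtype.ext h1
  funext n
  exact Fintype.linearIndependent_iff.1 u.basis.linearIndependent v h2 n

/-- The diagonal matrix of signs. -/
def signMat [DecidableEq M] (deg : M → ℕ) : Matrix M M ℝ :=
  Matrix.diagonal fun m => (-1 : ℝ) ^ deg m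

theorem gram_transpose : (gram D u).transpose = gram D u := by
  ext m n
  exact D.pair_comm _ _

/-- Vectors that pair have total degree `3`, hence opposite parities. -/
theorem gram_signMat [DecidableEq M] :
    gram D u * signMat u.deg = -(signMat u.deg * gram D u) := by
  ext m n
  rw [signMat, Matrix.mul_diagonal, Matrix.neg_apply, Matrix.diagonal_mul, gram, Matrix.of_apply]
  by_cases h : u.deg m + u.deg n = 3
  · have h1 : (-1 : ℝ) ^ u.deg m * (-1) ^ u.deg n = -1 := by rw [← pow_add, h]; norm_num
    have h2 : (-1 : ℝ) ^ u.deg m * (-1) ^ u.deg m = 1 := by rw [← mul_pow]; simp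
    have h3 : (-1 : ℝ) ^ u.deg n = -(-1) ^ u.deg m := by
      linear_combination (-1 : ℝ) ^ u.deg m * h1 - (-1 : ℝ) ^ u.deg n * h2
    rw [h3]; ring
  · rw [D.pair_of_ne (basis_mem D u m) (basis_mem D u n) h]; simp

theorem gramK_of_ne (hK : D.IsRelaxed ι K) {m n : M} (h : u.deg m + u.deg n ≠ 4) :
    D.pair (u.basis m : A) (K (u.basis n : A)) = 0 := by
  rcases Nat.eq_zero_or_pos (u.deg n) with h0 | h0
  · rw [hK.mem_zero (by rw [← h0]; exact basis_mem D u n), map_zero]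
  · have h1 : (u.basis n : A) ∈ 𝒞 ((u.deg n - 1) + 1) := by
      rw [Nat.sub_add_cancel h0]; exact basis_mem D u n
    exact D.pair_of_ne (basis_mem D u m) (hK.mem h1) (by omega)

theorem neg_one_pow_congr_of_add_eq {a b : ℕ} (h : a + b = 4) : (-1 : ℝ) ^ a = (-1) ^ b := by
  have h1 : (-1 : ℝ) ^ a * (-1) ^ b = 1 := by rw [← pow_add, h]; norm_num
  have h2 : (-1 : ℝ) ^ b * (-1) ^ b = 1 := by rw [← mul_pow]; simp
  linear_combination (-1 : ℝ) ^ b * h1 - (-1 : ℝ) ^ a * h2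

/-- The form `π(·, K ·)` lives in total degree `4`, so it couples equal parities. -/
theorem gramK_signMat [DecidableEq M] (hK : D.IsRelaxed ι K) :
    gramK D K u * signMat u.deg = signMat u.deg * gramK D K u := by
  ext m n
  rw [signMat, Matrix.mul_diagonal, Matrix.diagonal_mul, gramK, Matrix.of_apply]
  by_cases h : u.deg m + u.deg n = 4
  · rw [neg_one_pow_congr_of_add_eq h, mul_comm]
  · rw [gramK_of_ne u hK h]; simp

theorem gramK_transpose [DecidableEq M] (hK : D.IsRelaxed ι K) :
    (gramK D K u).transpose = signMat u.deg * gramK D K u := by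
  ext m n
  rw [Matrix.transpose_apply, signMat, Matrix.diagonal_mul, gramK, Matrix.of_apply, Matrix.of_apply,
    D.pair_comm, hK.symm _ (basis_mem D u m)]

theorem inv_signMat [DecidableEq M] (hK : D.IsRelaxed ι K) :
    (gram D u)⁻¹ * signMat u.deg = -(signMat u.deg * (gram D u)⁻¹) := by
  have hu := (Matrix.isUnit_iff_isUnit_det _).1 (gram_isUnit u hK)
  have h1 := congrArg (fun N => (gram D u)⁻¹ * N * (gram D u)⁻¹) (gram_signMat (D := D) u)
  simp only [mul_neg, neg_mul] at h1
  rw [← mul_assoc, Matrix.nonsing_inv_mul _ hu, one_mul, mul_assoc, mul_assoc,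
    Matrix.mul_nonsing_inv _ hu, mul_one] at h1
  rw [h1, neg_neg]

theorem propagator_signMat [DecidableEq M] (hK : D.IsRelaxed ι K) :
    propagator D ι K u * signMat u.deg = signMat u.deg * propagator D ι K u := by
  rw [propagator_eq, mul_assoc, inv_signMat u hK, mul_neg, ← mul_assoc, mul_assoc _ (gramK D K u),
    gramK_signMat u hK, ← mul_assoc, inv_signMat u hK, neg_mul, neg_mul, neg_neg]
  simp only [mul_assoc]

/-- Transposition puts the sign matrix next to `gramK`, between two inverse Gram matrices; moving it
out to the left past one of them costs the minus sign. -/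
theorem propagator_transpose [DecidableEq M] (hK : D.IsRelaxed ι K) :
    (propagator D ι K u).transpose = -(signMat u.deg * propagator D ι K u) := by
  rw [propagator_eq, Matrix.transpose_mul, Matrix.transpose_mul, Matrix.transpose_nonsing_inv,
    gram_transpose, gramK_transpose u hK, ← mul_assoc, ← mul_assoc, inv_signMat u hK]
  simp only [mul_assoc, neg_mul]

theorem propagator_symm [DecidableEq M] (hK : D.IsRelaxed ι K) (m n : M) :
    propagator D ι K u n m = -((-1) ^ u.deg m * propagator D ι K u m n) := by
  have h := congrFun (congrFun (propagator_transpose u hK) m) n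
  rwa [Matrix.transpose_apply, Matrix.neg_apply, signMat, Matrix.diagonal_mul] at h

theorem propagator_sign (hK : D.IsRelaxed ι K) {m n : M} (h : propagator D ι K u m n ≠ 0) :
    (-1 : ℝ) ^ u.deg m = (-1) ^ u.deg n := by
  classical
  have h1 := congrFun (congrFun (propagator_signMat u hK) m) n
  rw [signMat, Matrix.mul_diagonal, Matrix.diagonal_mul, mul_comm] at h1
  exact (mul_right_cancel₀ h h1).symm

/-- The propagator contracted with the coefficients of a vector of `𝒞` is given by the chain
homotopy. -/
theorem propagator_mulVec (hK : D.IsRelaxed ι K) (v : A) (m : M) :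
    ∑ k, propagator D ι K u m k * D.pair v (u.basis k : A) =
      u.basis.repr ⟨K v, hK.K_mem v⟩ m := by
  classical
  have hu := (Matrix.isUnit_iff_isUnit_det _).1 (gram_isUnit u hK)
  -- Neither the pairing with `𝒞''` nor `K` sees the component in `ι(H)`, so `v` may be replaced by
  -- its projection to `𝒞''`.
  set v' : D.complement ι := ⟨v - ι (hK.transpose v), hK.sub_transpose_mem v⟩ with hv'
  set w : D.complement ι := ⟨K v, hK.K_mem v⟩ with hw
  have h1 : (fun k => D.pair v (u.basis k : A)) = (gram D u).mulVec (u.basis.repr v') := by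
    funext k
    rw [gram_mulVec, u.basis.sum_repr, hv', map_sub, (u.basis k).2, sub_zero, D.pair_comm]
  have h2 : (gramK D K u).mulVec (u.basis.repr v') = (gram D u).mulVec (u.basis.repr w) := by
    funext k
    rw [gram_mulVec, u.basis.sum_repr, hw]
    have h3 : K v = ∑ n, u.basis.repr v' n • K (u.basis n : A) := by
      rw [← hK.K_sub_transpose v]
      have h4 := congrArg (fun x : D.complement ι => K (x : A)) (u.basis.sum_repr v')
      simp only [AddSubmonoidClass.coe_finsetSum, SetLike.val_smul, map_sum, map_smul] at h4
      exact h4.symm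
    simp only [h3, map_sum, map_smul, Matrix.mulVec, dotProduct, gramK, Matrix.of_apply,
      smul_eq_mul, mul_comm]
  have h5 : (propagator D ι K u).mulVec (fun k => D.pair v (u.basis k : A)) = u.basis.repr w := by
    rw [h1, propagator_eq, Matrix.mulVec_mulVec, mul_assoc, Matrix.nonsing_inv_mul _ hu, mul_one,
      ← Matrix.mulVec_mulVec, h2, Matrix.mulVec_mulVec, Matrix.nonsing_inv_mul _ hu,
      Matrix.one_mulVec]
  exact congrFun h5 m

end Propagator

/-! ### The form `κ` in a basis of `g` -/

section Killing

variable {g : Type*} [LieRing g] [LieAlgebra ℝ g] {κ : LinearMap.BilinForm ℝ g}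
  {𝔞 : Type*} [Fintype 𝔞] (T : Module.Basis 𝔞 ℝ g)

/-- The matrix of the form `κ`. -/
def gramLie (κ : LinearMap.BilinForm ℝ g) (T : Module.Basis 𝔞 ℝ g) : Matrix 𝔞 𝔞 ℝ :=
  Matrix.of fun a b => κ (T a) (T b)

theorem gramLie_mulVec (v : 𝔞 → ℝ) (a : 𝔞) :
    (gramLie κ T).mulVec v a = κ (T a) (∑ b, v b • T b) := by
  simp [Matrix.mulVec, dotProduct, gramLie, map_sum, mul_comm]

theorem gramLie_isUnit [DecidableEq 𝔞] (hκ : IsQuadraticForm κ) : IsUnit (gramLie κ T) := by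
  rw [← Matrix.mulVec_injective_iff_isUnit, ← Matrix.coe_mulVecLin, ← LinearMap.ker_eq_bot,
    LinearMap.ker_eq_bot']
  intro v hv
  have h1 : ∑ n, v n • T n = 0 := by
    refine hκ.nondegenerate.2 _ fun x => ?_
    generalize hw : ∑ n, v n • T n = w
    rw [← T.sum_repr x, map_sum, LinearMap.sum_apply]
    refine Finset.sum_eq_zero fun m _ => ?_
    rw [map_smul, LinearMap.smul_apply, ← hw, ← gramLie_mulVec]
    have := congrFun hv m
    rw [Matrix.mulVecLin_apply] at this
    rw [this]; simp
  funext n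
  exact Fintype.linearIndependent_iff.1 T.linearIndependent v h1 n

theorem gramLie_transpose (hκ : IsQuadraticForm κ) : (gramLie κ T).transpose = gramLie κ T := by
  ext m n
  exact hκ.symm _ _

theorem gramLie_inv_symm [DecidableEq 𝔞] (hκ : IsQuadraticForm κ) (a b : 𝔞) :
    (gramLie κ T)⁻¹ b a = (gramLie κ T)⁻¹ a b := by
  rw [← Matrix.transpose_apply (gramLie κ T)⁻¹ b a, Matrix.transpose_nonsing_inv,
    gramLie_transpose T hκ]

theorem gramLie_inv_mulVec [DecidableEq 𝔞] (hκ : IsQuadraticForm κ) (X : g) (b : 𝔞) :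
    ∑ a, (gramLie κ T)⁻¹ b a * κ X (T a) = T.repr X b := by
  have hu := (Matrix.isUnit_iff_isUnit_det _).1 (gramLie_isUnit T hκ)
  have h1 : (fun a => κ X (T a)) = (gramLie κ T).mulVec (T.repr X) := by
    funext a
    rw [gramLie_mulVec, T.sum_repr, hκ.symm]
  have h2 : (gramLie κ T)⁻¹.mulVec (fun a => κ X (T a)) = T.repr X := by
    rw [h1, Matrix.mulVec_mulVec, Matrix.nonsing_inv_mul _ hu, Matrix.one_mulVec]
  exact congrFun h2 b

end Killing

/-! ## The effective action as a one-loop determinant -/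

section Effective

variable {A : Type*} [Ring A] [Algebra ℝ A] {𝒞 : ℕ → Submodule ℝ A} [GradedAlgebra 𝒞]
  (D : DGFrobenius 𝒞) {g : Type*} [LieRing g] [LieAlgebra ℝ g] (κ : LinearMap.BilinForm ℝ g)
  {𝔞 J M : Type*} [Fintype 𝔞] [Fintype J] [Fintype M] (T : Module.Basis 𝔞 ℝ g)
  (h : HomogeneousBasis D.cohomologyDeg J) (ι : D.Cohomology →ₗ[ℝ] A) (K : A →ₗ[ℝ] A)
  (u : HomogeneousBasis (D.complementDeg ι) M)

/-- The representatives of the coordinates on `F' ⊕ F''`. -/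
def repTotal : (J × 𝔞) ⊕ (M × 𝔞) → A :=
  Sum.elim (fun x => ι (h.basis x.1)) (fun x => (u.basis x.1 : A))

/-- The components in `g` of the coordinates on `F' ⊕ F''`. -/
def lieTotal (J M : Type*) : (J × 𝔞) ⊕ (M × 𝔞) → g :=
  Sum.elim (fun x => T x.2) (fun x => T x.2)

/-- The coefficients of the interaction. -/
def interactionCoeff : (J × 𝔞) ⊕ (M × 𝔞) → (J × 𝔞) ⊕ (M × 𝔞) → (J × 𝔞) ⊕ (M × 𝔞) → ℝ :=
  cubicCoeff D κ (degTotal D h ι u 𝔞) (lieTotal T J M) (repTotal D h ι u)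

open Classical in
/-- The propagator on `F''`. -/
def propagatorTotal (y y' : M × 𝔞) : ℝ :=
  propagator D ι K u y.1 y'.1 * (gramLie κ T)⁻¹ y.2 y'.2

variable {D κ ι K}

theorem repTotal_mem (hι : D.IsEmbedding ι) (z : (J × 𝔞) ⊕ (M × 𝔞)) :
    repTotal D h ι u z ∈ 𝒞 (degTotal D h ι u 𝔞 z) := by
  rcases z with x | y
  · exact hι.mem_of_basis h x.1
  · exact basis_mem D u y.1

/-- Quadratic terms involving `ι(α)` vanish, because `ι(α)` is closed and orthogonal to exact
elements; the remaining one cancels against `S₀`. -/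
theorem interaction_eq (hι : D.IsEmbedding ι) : interaction D κ T h ι u =
    cubicForm (ghost (degTotal D h ι u 𝔞)) (interactionCoeff D κ T h ι u) := by
  rw [interaction, action, add_comm, add_sub_assoc]
  refine (congrArg₂ (· + ·) rfl (sub_eq_zero.2 ?_)).trans (add_zero _)
  rw [quadraticAction, quadraticAction]
  congr 1
  refine Finset.sum_congr rfl fun x _ => Finset.sum_congr rfl fun y _ => ?_
  congr 3
  rcases x with x | x <;> rcases y with y | y
  · simp [hι.d_apply]
  · simp only [Sum.elim_inl, Sum.elim_inr, map_zero, LinearMap.zero_apply]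
    rw [D.pair_comm, hι.pair_d]
  · simp [hι.d_apply]
  · rfl

/-- The sign in `propagator_symm` is the Koszul sign of a coordinate with itself, since ghost
numbers have the parity of the degree plus one. -/
theorem isPropagator_propagatorTotal (hκ : IsQuadraticForm κ) (hK : D.IsRelaxed ι K) :
    IsPropagator (X := J × 𝔞) (ghost (degTotal D h ι u 𝔞)) (propagatorTotal D κ T ι K u) where
  par_eq {y y'} h0 := by
    have h1 : propagator D ι K u y.1 y'.1 ≠ 0 := fun h2 => h0 (by rw [propagatorTotal, h2, zero_mul])
    have h2 := propagator_sign u hK h1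
    rw [par_ghost, par_ghost]
    change ((u.deg y.1 + 1 : ℕ) : ZMod 2) = ((u.deg y'.1 + 1 : ℕ) : ZMod 2)
    rw [← one_mul (u.deg y.1), ← one_mul (u.deg y'.1), ← eps_natCast, ← eps_natCast] at h2
    push_cast
    rcases zmod_two_cases (u.deg y.1) with hx | hx <;>
      rcases zmod_two_cases (u.deg y'.1) with hy | hy <;> rw [hx, hy] at h2 ⊢ <;>
      norm_num at h2
  symm y y' := by
    classical
    rw [propagatorTotal, propagatorTotal, propagator_symm u hK, par_ghost]
    change _ = eps ((u.deg y.1 + 1 : ℕ) : ZMod 2) ((u.deg y.1 + 1 : ℕ) : ZMod 2) * _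
    rw [gramLie_inv_symm T hκ, ← one_mul (u.deg y.1), ← eps_natCast]
    push_cast
    rcases zmod_two_cases (u.deg y.1) with hx | hx <;> rw [hx] <;>
      simp [one_add_one_zmod_two]

theorem wickOperator_eq : wickOperator D κ T h ι K u =
    wick (X := J × 𝔞) (ghost (degTotal D h ι u 𝔞)) (propagatorTotal D κ T ι K u) := by
  classical
  rw [wickOperator, wick]
  congr 1
  simp only [Fintype.sum_prod_type]
  refine Finset.sum_congr rfl fun m _ => ?_
  rw [Finset.sum_comm]
  rfl

theorem partitionSeries_eq (hι : D.IsEmbedding ι) : partitionSeries D κ T h ι K u =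
    vertexSeries (X := J × 𝔞) (ghost (degTotal D h ι u 𝔞)) (propagatorTotal D κ T ι K u)
      (cubicForm (ghost (degTotal D h ι u 𝔞)) (interactionCoeff D κ T h ι u)) := by
  have h1 : ∀ v m, wickTerm D κ T h ι K u v m = vertexTerm (X := J × 𝔞)
      (ghost (degTotal D h ι u 𝔞)) (propagatorTotal D κ T ι K u)
      (cubicForm (ghost (degTotal D h ι u 𝔞)) (interactionCoeff D κ T h ι u)) v m := by
    intro v m
    rw [wickTerm, vertexTerm, expect_apply, interaction_eq T h u hι, wickOperator_eq T h u, smul_smul,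
      one_div_mul_one_div]
    rfl
  rw [partitionSeries]
  simp only [h1]
  rfl

/-- Here formality enters the expansion: a product of two elements of `ι(H)` stays in `ι(H)` and is
therefore orthogonal to `𝒞''`. -/
theorem interactionCoeff_eq_zero (hhom : D.IsAlgHom ι)
    (x x' : J × 𝔞) (y : M × 𝔞) :
    interactionCoeff D κ T h ι u (Sum.inl x) (Sum.inl x') (Sum.inr y) = 0 := by
  have h1 : D.pair (ι (h.basis x.1)) (ι (h.basis x'.1) * u.basis y.1) = 0 := by
    obtain ⟨z, hz⟩ := hhom.exists_mul (h.basis x.1) (h.basis x'.1)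
    rw [D.cyclic, hz, D.pair_comm, (u.basis y.1).2]
  rw [interactionCoeff, cubicCoeff]
  simp only [repTotal, Sum.elim_inl, Sum.elim_inr, h1, mul_zero]

/-- The expansion of the logarithm of the partition function. -/
theorem logSeries_partitionSeries (hκ : IsQuadraticForm κ) (hι : D.IsEmbedding ι)
    (hhom : D.IsAlgHom ι) (hK : D.IsRelaxed ι K) [DecidableEq (M × 𝔞)] (v : ℕ) :
    ∃ f : PowerSeries (FunH D h 𝔞),
      PowerSeries.coeff v (logSeries (partitionSeries D κ T h ι K u)) =
        (if v = 1 then HahnSeries.single (-1 : ℤ) (Wprod D κ T h ι) else 0) +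
        HahnSeries.ofPowerSeries ℤ _ f ∧
      PowerSeries.coeff 0 f = gaussLog (X := J × 𝔞) (ghost (degTotal D h ι u 𝔞))
        (propagatorTotal D κ T ι K u)
        (fun x y y' => interactionCoeff D κ T h ι u (Sum.inl x) (Sum.inr y) (Sum.inr y')) v := by
  rw [partitionSeries_eq T h u hι]
  exact logSeries_cubic (isPropagator_propagatorTotal T h u hκ hK)
    (isCubic_cubicCoeff D κ hκ _ _ _ (repTotal_mem h u hι))
    (interactionCoeff_eq_zero T h u hhom) v

theorem ofPowerSeries_coeff_neg {R : Type*} [Ring R] (f : PowerSeries R) {k : ℤ} (hk : k < 0) :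
    (HahnSeries.ofPowerSeries ℤ R f).coeff k = 0 := by
  rw [HahnSeries.ofPowerSeries_apply]
  refine HahnSeries.embDomain_of_notMem_range ?_
  rintro ⟨n, hn⟩
  simp at hn
  omega

theorem formalSum_zero {X : Type*} {gh : X → ℤ} : formalSum (fun _ => (0 : SFun gh)) = 0 := by
  ext μ : 1
  change ∑ᶠ _ : ℕ, MvPowerSeries.coeff μ (0 : SFun gh) = _
  simp

theorem coeff_formalSum {X : Type*} {gh : X → ℤ} (f : ℕ → SFun gh)
    (μ : {x : X // Even (gh x)} →₀ ℕ) :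
    MvPowerSeries.coeff μ (formalSum f) = ∑ᶠ n, MvPowerSeries.coeff μ (f n) := rfl

theorem effectiveAction_of_neg (hκ : IsQuadraticForm κ) (hι : D.IsEmbedding ι)
    (hhom : D.IsAlgHom ι) (hK : D.IsRelaxed ι K) {l : ℤ} (hl : l < 0) :
    effectiveAction D κ T h ι K u l = 0 := by
  classical
  rw [effectiveAction]
  refine (congrArg formalSum (funext fun v => ?_)).trans formalSum_zero
  obtain ⟨f, hf, -⟩ := logSeries_partitionSeries T h u hκ hι hhom hK v
  rw [hf, HahnSeries.coeff_add, ofPowerSeries_coeff_neg f (by omega), add_zero]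
  split_ifs
  · rw [HahnSeries.coeff_single_of_ne (by omega)]
  · rfl

theorem effectiveAction_zero (hκ : IsQuadraticForm κ) (hι : D.IsEmbedding ι)
    (hhom : D.IsAlgHom ι) (hK : D.IsRelaxed ι K) :
    effectiveAction D κ T h ι K u 0 = Wprod D κ T h ι := by
  classical
  have h1 : ∀ v, (PowerSeries.coeff v (logSeries (partitionSeries D κ T h ι K u))).coeff (0 - 1) =
      if v = 1 then Wprod D κ T h ι else 0 := by
    intro v
    obtain ⟨f, hf, -⟩ := logSeries_partitionSeries T h u hκ hι hhom hK v
    rw [hf, HahnSeries.coeff_add, ofPowerSeries_coeff_neg f (by omega), add_zero]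
    split_ifs
    · exact HahnSeries.coeff_single_same _ _
    · rfl
  rw [effectiveAction]
  simp only [h1]
  ext μ : 1
  rw [coeff_formalSum, finsum_eq_single _ 1]
  · rw [if_pos rfl]
  · intro v hv; rw [if_neg hv, map_zero]

theorem effectiveAction_one_eq (hκ : IsQuadraticForm κ) (hι : D.IsEmbedding ι)
    (hhom : D.IsAlgHom ι) (hK : D.IsRelaxed ι K) [DecidableEq (M × 𝔞)] :
    effectiveAction D κ T h ι K u 1 = formalSum (gaussLog (X := J × 𝔞)
        (ghost (degTotal D h ι u 𝔞)) (propagatorTotal D κ T ι K u)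
        (fun x y y' => interactionCoeff D κ T h ι u (Sum.inl x) (Sum.inr y) (Sum.inr y'))) := by
  rw [effectiveAction]
  refine congrArg formalSum (funext fun v => ?_)
  obtain ⟨f, hf, hf'⟩ := logSeries_partitionSeries T h u hκ hι hhom hK v
  rw [hf, HahnSeries.coeff_add, ← hf', sub_self]
  have h1 : (HahnSeries.ofPowerSeries ℤ (FunH D h 𝔞) f).coeff 0 = PowerSeries.coeff 0 f := by
    have := HahnSeries.ofPowerSeries_apply_coeff (Γ := ℤ) f 0
    rwa [Nat.cast_zero] at this
  rw [h1]
  split_ifs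
  · rw [HahnSeries.coeff_single_of_ne (by omega), zero_add]
  · exact zero_add _

end Effective

/-! ## The super-trace formula -/

section SuperTrace

theorem HomogeneousBasis.deg_eq {A : Type*} [Ring A] [Algebra ℝ A] {𝒞 : ℕ → Submodule ℝ A}
    [GradedAlgebra 𝒞] {I : Type*} [Fintype I] (e : HomogeneousBasis 𝒞 I) {n : ℕ} {a : A}
    (ha : a ∈ 𝒞 n) {i : I} (hi : e.basis.repr a i ≠ 0) : e.deg i = n := by
  classical
  by_contra hne
  refine hi ?_
  have h1 : (DirectSum.decompose 𝒞 a (e.deg i) : A) = 0 :=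
    DirectSum.decompose_of_mem_ne 𝒞 ha (fun h => hne h.symm)
  rw [← e.basis.sum_repr a, DirectSum.decompose_sum, DFinsupp.finsetSum_apply,
    AddSubmonoidClass.coe_finsetSum] at h1
  have h2 : ∀ j, ((DirectSum.decompose 𝒞 (e.basis.repr a j • e.basis j)) (e.deg i) : A) =
      (if e.deg j = e.deg i then e.basis.repr a j else 0) • e.basis j := by
    intro j
    split_ifs with h
    · rw [← h, DirectSum.decompose_of_mem_same 𝒞 (Submodule.smul_mem _ _ (e.mem j))]
    · rw [DirectSum.decompose_of_mem_ne 𝒞 (Submodule.smul_mem _ _ (e.mem j)) h, zero_smul]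
  simp only [h2] at h1
  have := Fintype.linearIndependent_iff.1 e.basis.linearIndependent _ h1 i
  simpa using this

/-- The super-trace of a product with a real intertwiner of the gradings is cyclic. -/
theorem superTrace_mul_comm {R Y Z : Type*} [Ring R] [Algebra ℝ R] [Fintype Y] [Fintype Z]
    [DecidableEq Y] [DecidableEq Z] (γ : Z → ℝ) (γ' : Y → ℝ) (U : Matrix Z Y ℝ)
    (hU : ∀ z y, γ z * U z y = U z y * γ' y) (W : Matrix Y Z R) :
    ∑ z, γ z • (U.map (algebraMap ℝ R) * W) z z = ∑ y, γ' y • (W * U.map (algebraMap ℝ R)) y y := by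
  simp only [Matrix.mul_apply, Matrix.map_apply, Finset.smul_sum]
  rw [Finset.sum_comm]
  refine Finset.sum_congr rfl fun y _ => Finset.sum_congr rfl fun z _ => ?_
  rw [← Algebra.commutes, ← Algebra.smul_def, smul_smul, smul_smul, hU, mul_comm]

theorem matrix_mul_pow_succ {R Y Z : Type*} [Ring R] [Fintype Y] [Fintype Z]
    [DecidableEq Y] [DecidableEq Z] (U : Matrix Z Y R) (Q : Matrix Y Z R) (n : ℕ) :
    (U * Q) ^ (n + 1) = U * ((Q * U) ^ n * Q) := by
  induction n with
  | zero => simp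
  | succ n ih => rw [pow_succ', ih, pow_succ', Matrix.mul_assoc, Matrix.mul_assoc, Matrix.mul_assoc]

/-- Passes between super-traces over `𝒞` and over `𝒞''`. Only the matrix `U` is moved around the
trace, and its entries are real, so the noncommuting entries of `Q` cause no trouble. -/
theorem superTrace_pow_succ {R Y Z : Type*} [Ring R] [Algebra ℝ R] [Fintype Y] [Fintype Z]
    [DecidableEq Y] [DecidableEq Z] (γ : Z → ℝ) (γ' : Y → ℝ) (U : Matrix Z Y ℝ)
    (hU : ∀ z y, γ z * U z y = U z y * γ' y) (Q : Matrix Y Z R) (n : ℕ) :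
    ∑ z, γ z • ((U.map (algebraMap ℝ R) * Q) ^ (n + 1)) z z =
      ∑ y, γ' y • ((Q * U.map (algebraMap ℝ R)) ^ (n + 1)) y y := by
  rw [matrix_mul_pow_succ, superTrace_mul_comm γ γ' U hU, Matrix.mul_assoc, ← pow_succ]

theorem finsum_succ {N : Type*} [AddCommMonoid N] (f : ℕ → N) (h0 : f 0 = 0) :
    ∑ᶠ n, f n = ∑ᶠ n, f (n + 1) := by
  rw [← finsum_mem_range (f := f) (g := fun n : ℕ => n + 1) (fun a b h => Nat.succ_injective h),
    ← finsum_mem_univ]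
  refine finsum_mem_inter_support_eq' _ _ _ fun x hx => ⟨fun _ => ?_, fun _ => trivial⟩
  rcases x with _ | x
  · exact absurd h0 hx
  · exact ⟨x, rfl⟩

theorem formalSum_succ {X : Type*} {gh : X → ℤ} (f : ℕ → SFun gh) (h0 : f 0 = 0) :
    formalSum f = formalSum fun n => f (n + 1) := by
  ext μ : 1
  rw [coeff_formalSum, coeff_formalSum, finsum_succ _ (by rw [h0, map_zero])]

theorem formalSum_smul {X : Type*} {gh : X → ℤ} (c : ℝ) (f : ℕ → SFun gh) :
    (formalSum fun n => c • f n) = c • formalSum f := by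
  ext μ : 1
  rw [coeff_formalSum]
  exact (smul_finsum c _).symm

variable {A : Type*} [Ring A] [Algebra ℝ A] {𝒞 : ℕ → Submodule ℝ A} [GradedAlgebra 𝒞]
  {D : DGFrobenius 𝒞} {g : Type*} [LieRing g] [LieAlgebra ℝ g] {κ : LinearMap.BilinForm ℝ g}
  {𝔞 J M I : Type*} [Fintype 𝔞] [Fintype J] [Fintype M] [Fintype I] (T : Module.Basis 𝔞 ℝ g)
  (h : HomogeneousBasis D.cohomologyDeg J) {ι : D.Cohomology →ₗ[ℝ] A} {K : A →ₗ[ℝ] A}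
  (u : HomogeneousBasis (D.complementDeg ι) M) (e : HomogeneousBasis 𝒞 I)

/-- The matrix of the inclusion of `g ⊗ 𝒞''` into `g ⊗ 𝒞`. -/
def inclusionMatrix [DecidableEq 𝔞] : Matrix (I × 𝔞) (M × 𝔞) ℝ :=
  Matrix.of fun r y => e.basis.repr (u.basis y.1 : A) r.1 * if r.2 = y.2 then 1 else 0

/-- The matrix of `K ∘ l(ι(α), •)` as an operator from `g ⊗ 𝒞` to `g ⊗ 𝒞''`. -/
def corestrictedMatrix (hK : D.IsRelaxed ι K) : Matrix (M × 𝔞) (I × 𝔞) (FunH D h 𝔞) :=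
  Matrix.of fun y s => ∑ x : J × 𝔞, ((-1 : ℝ) ^ ((h.deg x.1 + 1) * e.deg s.1) *
    (u.basis.repr ⟨K (ι (h.basis x.1) * e.basis s.1), hK.K_mem _⟩ y.1 *
      T.repr ⁅T x.2, T s.2⁆ y.2)) • coord (ghost (degH D h 𝔞)) x

/-- Since `K` takes values in `𝒞''`, the operator factors through the inclusion of `g ⊗ 𝒞''`. -/
theorem superMatrix_eq [DecidableEq 𝔞] (hK : D.IsRelaxed ι K) :
    superMatrix D T h ι K e = (inclusionMatrix (𝔞 := 𝔞) u e).map (algebraMap ℝ (FunH D h 𝔞)) *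
      corestrictedMatrix T h u e hK := by
  refine Matrix.ext fun r s => ?_
  rw [Matrix.mul_apply]
  simp only [superMatrix, corestrictedMatrix, Matrix.of_apply, Matrix.map_apply,
    ← Algebra.smul_def, Finset.smul_sum, smul_smul]
  rw [Finset.sum_comm]
  refine Finset.sum_congr rfl fun x _ => ?_
  refine Eq.trans ?_ Finset.sum_smul
  rw [Fintype.sum_prod_type]
  refine congrArg₂ (· • ·) ?_ rfl
  set w : D.complement ι := ⟨K (ι (h.basis x.1) * e.basis s.1), hK.K_mem _⟩ with hw
  have h1 : K (ι (h.basis x.1) * e.basis s.1) = ∑ m, u.basis.repr w m • (u.basis m : A) := by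
    have := congrArg (fun z : D.complement ι => (z : A)) (u.basis.sum_repr w)
    simp only [AddSubmonoidClass.coe_finsetSum, SetLike.val_smul] at this
    exact this.symm
  rw [h1]
  simp only [map_sum, map_smul, Finsupp.finsetSum_apply, Finsupp.smul_apply, smul_eq_mul,
    inclusionMatrix, Matrix.of_apply, Finset.sum_mul, Finset.mul_sum]
  refine Finset.sum_congr rfl fun m _ => ?_
  rw [Finset.sum_eq_single r.2]
  · rw [if_pos rfl]; ring
  · intro b _ hb; rw [if_neg hb.symm]; ring
  · intro hr; exact absurd (Finset.mem_univ _) hr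

/-- Propagator times vertex is `K` applied to a product, by `propagator_mulVec` on the side of `𝒞`
and `gramLie_inv_mulVec` on that of `g`. -/
theorem corestrictedMatrix_mul_inclusionMatrix [DecidableEq 𝔞] (hκ : IsQuadraticForm κ)
    (hι : D.IsEmbedding ι) (hK : D.IsRelaxed ι K) :
    corestrictedMatrix T h u e hK *
        (inclusionMatrix (𝔞 := 𝔞) u e).map (algebraMap ℝ (FunH D h 𝔞)) =
      loopMatrix (X := J × 𝔞) (ghost (degTotal D h ι u 𝔞)) (propagatorTotal D κ T ι K u)
        (fun x y y' => interactionCoeff D κ T h ι u (Sum.inl x) (Sum.inr y) (Sum.inr y')) := by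
  refine Matrix.ext fun y w => ?_
  rw [Matrix.mul_apply]
  simp only [loopMatrix, corestrictedMatrix, Matrix.of_apply, Matrix.map_apply, quadCoeff,
    ← Algebra.commutes, ← Algebra.smul_def, Finset.smul_sum, smul_smul]
  rw [Finset.sum_comm]
  conv_rhs => rw [Finset.sum_comm]
  refine Finset.sum_congr rfl fun x _ => ?_
  rw [← Finset.sum_smul, ← Finset.sum_smul]
  refine congrArg (fun c : ℝ => c • (coord (ghost (degH D h 𝔞)) x : FunH D h 𝔞)) ?_
  set wv : A := (u.basis w.1 : A) with hwv
  set R : A → ℝ := fun a => u.basis.repr ⟨K (ι (h.basis x.1) * a), hK.K_mem _⟩ y.1 with hR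
  trans (-1 : ℝ) ^ ((h.deg x.1 + 1) * u.deg w.1) * (R wv * T.repr ⁅T x.2, T w.2⁆ y.2)
  · have hsum : R wv = ∑ i, e.basis.repr wv i * R (e.basis i) := by
      let Rl : A →ₗ[ℝ] ℝ := (Finsupp.lapply y.1 ∘ₗ u.basis.repr.toLinearMap) ∘ₗ
        (LinearMap.codRestrict (D.complement ι) K hK.K_mem ∘ₗ
          LinearMap.mulLeft ℝ (ι (h.basis x.1)))
      change Rl wv = ∑ i, e.basis.repr wv i * Rl (e.basis i)
      conv_lhs => rw [← e.basis.sum_repr wv, map_sum]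
      simp only [map_smul, smul_eq_mul]
    rw [hsum, Fintype.sum_prod_type, Finset.sum_mul, Finset.mul_sum]
    refine Finset.sum_congr rfl fun i _ => ?_
    rw [Finset.sum_eq_single w.2]
    · simp only [inclusionMatrix, Matrix.of_apply, if_true]
      by_cases h0 : e.basis.repr wv i = 0
      · rw [h0]; ring
      · rw [e.deg_eq (basis_mem D u w.1) h0]; ring
    · intro b _ hb
      simp only [inclusionMatrix, Matrix.of_apply, if_neg hb]; ring
    · intro hr; exact absurd (Finset.mem_univ _) hr
  · have h1 : R wv = _ := (propagator_mulVec u hK (ι (h.basis x.1) * wv) y.1).symm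
    have h2 := (@gramLie_inv_mulVec _ _ _ κ 𝔞 _ T (fun a b => Classical.propDecidable (a = b)) hκ
      ⁅T x.2, T w.2⁆ y.2).symm
    rw [h1, h2, Finset.sum_mul_sum, Fintype.sum_prod_type, Finset.mul_sum]
    refine Finset.sum_congr rfl fun k _ => ?_
    rw [Finset.mul_sum]
    refine Finset.sum_congr rfl fun a _ => ?_
    simp only [propagatorTotal, interactionCoeff, cubicCoeff, lieTotal, repTotal, Sum.elim_inl,
      Sum.elim_inr, degTotal]
    rw [← D.cyclic, hκ.invariant]
    by_cases h3 : h.deg x.1 + (u.deg w.1 + u.deg k) = 3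
    -- The sign of the super-matrix equals that of the vertex: total degree `3` determines `u.deg
    -- k`, and `p * (3 - p)` is even.
    · have h4 : (-1 : ℝ) ^ ((h.deg x.1 + 1) * u.deg w.1) = (-1) ^ (u.deg w.1 * (u.deg k + 1)) := by
        have h5 : u.deg w.1 * (u.deg k + 1) + 2 * (u.deg w.1 * (h.deg x.1)) =
            (h.deg x.1 + 1) * u.deg w.1 + (u.deg w.1 * (3 - u.deg w.1)) := by
          have : u.deg k = 3 - u.deg w.1 - h.deg x.1 := by omega
          have h6 : u.deg w.1 + h.deg x.1 ≤ 3 := by omega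
          generalize u.deg w.1 = p at *
          generalize h.deg x.1 = q at *
          rw [this]
          have hp : p ≤ 3 := by omega
          have hq : q ≤ 3 := by omega
          interval_cases p <;> interval_cases q <;> omega
        have h6 : Even (u.deg w.1 * (3 - u.deg w.1)) := by
          have hp : u.deg w.1 ≤ 3 := by omega
          generalize u.deg w.1 = p at *
          interval_cases p <;> decide
        have h7 := congrArg (fun n => (-1 : ℝ) ^ n) h5
        simp only [pow_add, h6.neg_one_pow, mul_one, pow_mul, neg_one_sq, one_pow] at h7
        rw [pow_mul, pow_mul, pow_add (-1 : ℝ) (h.deg x.1) 1, pow_add _ (u.deg k) 1, h7]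
      rw [h4, hwv]; ring
    · rw [D.pair_of_ne (hι.mem_of_basis h x.1)
        (SetLike.mul_mem_graded (basis_mem D u w.1) (basis_mem D u k)) h3]
      ring

/-- The shift of parity contributes a minus sign, which converts the `(-1)^v` of `gaussLog` into the
`(-1)^n`, `v = n + 1`, of the series of `log (1 + N)`. -/
theorem eps_par_ghost_self {Z : Type*} (deg : Z → ℕ) (z : Z) :
    eps (par (ghost deg) z) (par (ghost deg) z) = -(-1) ^ deg z := by
  rw [par_ghost, eps_natCast]
  have : (deg z + 1) * (deg z + 1) = deg z + 1 + deg z * (deg z + 1) := by ring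
  rw [this, pow_add, (Nat.even_mul_succ_self (deg z)).neg_one_pow, pow_succ]
  ring

theorem gaussLog_succ [DecidableEq 𝔞] [DecidableEq (I × 𝔞)] [DecidableEq (M × 𝔞)]
    (hκ : IsQuadraticForm κ)
    (hι : D.IsEmbedding ι) (hK : D.IsRelaxed ι K) (n : ℕ) :
    gaussLog (X := J × 𝔞) (ghost (degTotal D h ι u 𝔞)) (propagatorTotal D κ T ι K u)
      (fun x y y' => interactionCoeff D κ T h ι u (Sum.inl x) (Sum.inr y) (Sum.inr y')) (n + 1) =
    (1 / 2 : ℝ) • (((-1 : ℝ) ^ n / ((n : ℝ) + 1)) •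
      superTrace D h e (superMatrix D T h ι K e ^ (n + 1))) := by
  have h1 := superTrace_pow_succ (R := FunH D h 𝔞) (fun r : I × 𝔞 => (-1 : ℝ) ^ e.deg r.1)
    (fun y : M × 𝔞 => (-1 : ℝ) ^ u.deg y.1) (inclusionMatrix (𝔞 := 𝔞) u e) (fun r y => by
      rw [inclusionMatrix, Matrix.of_apply]
      by_cases h0 : e.basis.repr (u.basis y.1 : A) r.1 = 0
      · rw [h0]; ring
      · rw [e.deg_eq (basis_mem D u y.1) h0]; ring) (corestrictedMatrix T h u e hK) n
  rw [superTrace, superMatrix_eq T h u e hK, h1,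
    corestrictedMatrix_mul_inclusionMatrix T h u e hκ hι hK, gaussLog, Finset.smul_sum,
    Finset.smul_sum, Finset.smul_sum]
  refine Finset.sum_congr rfl fun y _ => ?_
  rw [eps_par_ghost_self, smul_smul, smul_smul, smul_smul]
  refine congrArg₂ (· • ·) ?_ rfl
  change _ * -(-1 : ℝ) ^ u.deg y.1 = _
  push_cast
  ring

theorem effectiveAction_one (hκ : IsQuadraticForm κ) (hι : D.IsEmbedding ι)
    (hhom : D.IsAlgHom ι) (hK : D.IsRelaxed ι K) :
    effectiveAction D κ T h ι K u 1 = halfStrLog D T h ι K e := by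
  classical
  -- The order `v = 0` is zero because `gaussLog` divides by `v` and division by zero gives zero;
  -- this permits the shift to `n + 1`.
  rw [effectiveAction_one_eq T h u hκ hι hhom hK, halfStrLog, formalSum_succ _ (by simp [gaussLog]),
    funext (gaussLog_succ T h u e hκ hι hK)]
  exact formalSum_smul _ _

end SuperTrace

/-! ## Variations of the super-traces in an algebra -/

section Abstract

/-- An abstract relaxed homotopy retraction `(D, K, P)` in a `ℤ/2`-graded ring, with grading
operator `Γ`, together with a Maurer--Cartan operator `L` commuting with the projection `P`. -/
structure IsTwistedRetract {R : Type*} [Ring R] (Γ D K P L : R) : Prop where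
  homotopy : D * K + K * D = 1 - P
  P_K : P * K = 0
  K_P : K * P = 0
  P_L : P * L = L * P
  L_L : L * L = 0
  D_L : D * L = -(L * D)
  Γ_D : Γ * D = -(D * Γ)
  Γ_K : Γ * K = -(K * Γ)
  Γ_L : Γ * L = -(L * Γ)

variable {R : Type*} [Ring R] {Γ D K P L : R} {τ : R →+ ℝ}

namespace IsTwistedRetract

theorem Γ_P (H : IsTwistedRetract Γ D K P L) : Γ * P = P * Γ := by
  have h1 : P = 1 - (D * K + K * D) := by rw [H.homotopy]; abel
  have h2 : Γ * (D * K) = D * K * Γ := by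
    rw [← mul_assoc, H.Γ_D, neg_mul, mul_assoc, H.Γ_K, mul_neg, neg_neg, mul_assoc]
  have h3 : Γ * (K * D) = K * D * Γ := by
    rw [← mul_assoc, H.Γ_K, neg_mul, mul_assoc, H.Γ_D, mul_neg, neg_neg, mul_assoc]
  rw [h1, mul_sub, sub_mul, mul_add, add_mul, h2, h3, mul_one, one_mul]

theorem Γ_pow (H : IsTwistedRetract Γ D K P L) (m : ℕ) : Γ * (K * L) ^ m = (K * L) ^ m * Γ := by
  have h : Commute Γ (K * L) := by
    rw [commute_iff_eq, ← mul_assoc, H.Γ_K, neg_mul, mul_assoc, H.Γ_L, mul_neg, neg_neg, mul_assoc]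
  exact (h.pow_right m).eq

theorem pow_L (H : IsTwistedRetract Γ D K P L) (m : ℕ) : (K * L) ^ (m + 1) * L = 0 := by
  rw [pow_succ, mul_assoc, mul_assoc, H.L_L, mul_zero, mul_zero]

theorem pow_P (H : IsTwistedRetract Γ D K P L) (m : ℕ) : (K * L) ^ (m + 1) * P = 0 := by
  rw [pow_succ, mul_assoc, mul_assoc, ← H.P_L, ← mul_assoc K, H.K_P, zero_mul, mul_zero]

theorem P_pow (H : IsTwistedRetract Γ D K P L) (m : ℕ) : P * (K * L) ^ (m + 1) = 0 := by
  rw [pow_succ', ← mul_assoc, ← mul_assoc, H.P_K, zero_mul, zero_mul]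

theorem D_mul (H : IsTwistedRetract Γ D K P L) : D * (K * L) = L - L * P + K * L * D := by
  have h1 : D * K = 1 - P - K * D := by rw [← H.homotopy]; abel
  rw [← mul_assoc, h1, sub_mul, sub_mul, one_mul, H.P_L, mul_assoc, H.D_L, mul_neg, sub_neg_eq_add,
    mul_assoc]

/-- Each passage of `D` over `K L` leaves `L - L P`, but only the leftmost one survives, since `(K
L) L = 0`. -/
theorem D_pow (H : IsTwistedRetract Γ D K P L) (m : ℕ) :
    D * (K * L) ^ (m + 1) = (L - L * P) * (K * L) ^ m + (K * L) ^ (m + 1) * D := by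
  induction m with
  | zero => simp [H.D_mul]
  | succ m ih =>
    rw [pow_succ (K * L) (m + 1), ← mul_assoc, ih, add_mul, mul_assoc, mul_assoc _ D, H.D_mul,
      mul_add, mul_sub, ← mul_assoc _ L P, H.pow_L, zero_mul, sub_zero, zero_add, pow_succ,
      mul_assoc _ (K * L) D]

/-- The boundary term of `D_pow` begins with `L` and is killed by the additional `L` in front. -/
theorem L_pow_D (H : IsTwistedRetract Γ D K P L) (m : ℕ) : D * (L * (K * L) ^ (m + 1)) = -(L * (K * L) ^ (m + 1) * D) := by
  rw [← mul_assoc, H.D_L, neg_mul, mul_assoc, H.D_pow, mul_add, ← mul_assoc L (L - L * P), mul_sub,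
    ← mul_assoc L L P, H.L_L, zero_mul, sub_zero, zero_mul, zero_add, mul_assoc]

theorem trace_D (H : IsTwistedRetract Γ D K P L)
    (hτ : ∀ a b, τ (a * b) = τ (b * a)) (a : R) : τ (Γ * (D * a)) = -τ (Γ * (a * D)) := by
  rw [← mul_assoc, H.Γ_D, neg_mul, map_neg, mul_assoc, hτ, mul_assoc]

/-- The super-trace of a variation of the chain homotopy against a closed operator vanishes. -/
theorem trace_variation (H : IsTwistedRetract Γ D K P L)
    (hτ : ∀ a b, τ (a * b) = τ (b * a)) {X B : R} (hX : P * X = (D * X + X * D) * K) (hB : D * B = -(B * D))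
    (hBP : B * P = 0) (hPB : P * B = 0) : τ (Γ * (X * B)) = 0 := by
  -- The identity `1 = D K + K D + P` is inserted to the right of `X`, and `hX` trades `X D K` for
  -- `P X - D X K`.
  have h1 : X = P * X - D * (X * K) + X * K * D + X * P := by
    have : X * (D * K + K * D) = X * (1 - P) := by rw [H.homotopy]
    rw [hX]
    rw [mul_add, mul_sub, mul_one] at this
    have h2 : X = X * (D * K) + X * (K * D) + X * P := by rw [this]; abel
    conv_lhs => rw [h2]
    noncomm_ring
  have h2 : X * B = P * (X * B) - D * (X * (K * B)) + X * K * D * B := by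
    conv_lhs => rw [h1]
    rw [add_mul, add_mul, sub_mul, mul_assoc X P B, hPB, mul_zero, add_zero]
    simp only [mul_assoc]
  have h3 : τ (Γ * (P * (X * B))) = 0 := by
    rw [← mul_assoc, H.Γ_P, mul_assoc, hτ, mul_assoc, mul_assoc, hBP, mul_zero, mul_zero, map_zero]
  rw [h2, mul_add, mul_sub, map_add, map_sub, h3, H.trace_D hτ, mul_assoc (X * K), hB]
  simp only [mul_neg, map_neg, mul_assoc]
  ring

/-- The exponent starts at one because `P` annihilates `L (K L)^(m+1)` on both sides but need not
annihilate `L` itself. -/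
theorem trace_homotopy_variation (H : IsTwistedRetract Γ D K P L)
    (hτ : ∀ a b, τ (a * b) = τ (b * a)) {X : R} (hX : P * X = (D * X + X * D) * K) (m : ℕ) :
    τ (Γ * (X * L * (K * L) ^ (m + 1))) = 0 := by
  rw [mul_assoc X]
  refine H.trace_variation hτ hX (H.L_pow_D m) ?_ ?_
  · rw [mul_assoc, H.pow_P, mul_zero]
  · rw [← mul_assoc, H.P_L, mul_assoc, H.P_pow, mul_zero]

/-- The super-trace of an exact variation of the Maurer--Cartan operator. -/
theorem trace_exact_variation (H : IsTwistedRetract Γ D K P L)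
    (hτ : ∀ a b, τ (a * b) = τ (b * a)) {B : R} (hB : Γ * B = B * Γ) (m : ℕ) :
    τ (Γ * (K * (D * B - B * D) * (K * L) ^ (m + 1))) =
      τ (Γ * (K * (L * B - B * L) * (K * L) ^ m)) := by
  -- One `D` is turned into `1 - P - D K`, the other is pushed to the far right by `D_pow`. The two
  -- terms with an outer `D` cancel under the super-trace.
  have h1 : K * (D * B - B * D) * (K * L) ^ (m + 1) =
      (1 - P) * B * (K * L) ^ (m + 1) - D * (K * B * (K * L) ^ (m + 1)) -
        K * B * ((L - L * P) * (K * L) ^ m) - K * B * (K * L) ^ (m + 1) * D := by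
    have h2 := H.D_pow m
    have h3 : K * D = 1 - P - D * K := by rw [← H.homotopy]; abel
    calc _ = K * D * B * (K * L) ^ (m + 1) - K * B * (D * (K * L) ^ (m + 1)) := by noncomm_ring
      _ = _ := by rw [h2, h3]; noncomm_ring
  have h2 : τ (Γ * (P * (B * (K * L) ^ (m + 1)))) = 0 := by
    rw [← mul_assoc, H.Γ_P, mul_assoc, hτ, mul_assoc, mul_assoc, H.pow_P, mul_zero, mul_zero,
      map_zero]
  -- The projection meets a `K` in either case: the next one in the power, or for `m = 0` the first
  -- one, by cyclicity.
  have h3 : τ (Γ * (K * B * (L * P * (K * L) ^ m))) = 0 := by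
    rcases m with _ | m
    · rw [pow_zero, mul_one, ← mul_assoc, ← mul_assoc, hτ, ← mul_assoc, ← mul_assoc,
        ← mul_assoc, ← H.Γ_P, mul_assoc Γ, H.P_K]
      simp
    · rw [mul_assoc L, H.P_pow, mul_zero, mul_zero, mul_zero, map_zero]
  have h4 : τ (Γ * (B * (K * L) ^ (m + 1))) = τ (Γ * (K * L * B * (K * L) ^ m)) := by
    have h5 : Γ * (K * L * B * (K * L) ^ m) = Γ * (K * L * B) * (K * L) ^ m := by noncomm_ring
    have h6 : (K * L) ^ m * (Γ * (K * L * B)) = Γ * (K * L) ^ (m + 1) * B := by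
      rw [← mul_assoc, ← H.Γ_pow, pow_succ]; noncomm_ring
    rw [h5, hτ (Γ * (K * L * B)), h6, ← mul_assoc, hB, mul_assoc, hτ B]
  have h7 : K * B * ((L - L * P) * (K * L) ^ m) =
      K * B * (L * (K * L) ^ m) - K * B * (L * P * (K * L) ^ m) := by noncomm_ring
  have h8 : (1 - P) * B * (K * L) ^ (m + 1) =
      B * (K * L) ^ (m + 1) - P * (B * (K * L) ^ (m + 1)) := by noncomm_ring
  have h9 : K * (L * B - B * L) * (K * L) ^ m =
      K * L * B * (K * L) ^ m - K * B * (L * (K * L) ^ m) := by noncomm_ring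
  rw [h1, h7, h8, h9]
  simp only [mul_sub, map_sub, h2, h3, H.trace_D hτ, h4]
  ring

theorem trace_exact_variation' (H : IsTwistedRetract Γ D K P L)
    (hτ : ∀ a b, τ (a * b) = τ (b * a)) {B B₁ B₂ : R} (hB : Γ * B = B * Γ)
    (h₁ : D * B = B₁ + B * D) (h₂ : L * B = B₂ + B * L) (m : ℕ) :
    τ (Γ * (K * B₁ * (K * L) ^ (m + 1))) = τ (Γ * (K * B₂ * (K * L) ^ m)) := by
  have := H.trace_exact_variation hτ hB m
  rwa [h₁, h₂, add_sub_cancel_right, add_sub_cancel_right] at this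

/-- The real structure serves only to divide `2 L² = 0` by two. -/
theorem of_add (homotopy : D * K + K * D + P = 1) (P_K : P * K = 0) (K_P : K * P = 0)
    (P_L : P * L = L * P) (L_L : L * L + L * L = 0) (D_L : D * L + L * D = 0)
    (Γ_D : Γ * D + D * Γ = 0) (Γ_K : Γ * K + K * Γ = 0) (Γ_L : Γ * L + L * Γ = 0)
    [Module ℝ R] : IsTwistedRetract Γ D K P L where
  homotopy := eq_sub_of_add_eq homotopy
  P_K := P_K
  K_P := K_P
  P_L := P_L
  L_L := by
    rw [← two_smul ℝ] at L_L
    exact (smul_eq_zero.1 L_L).resolve_left two_ne_zero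
  D_L := eq_neg_of_add_eq_zero_left D_L
  Γ_D := eq_neg_of_add_eq_zero_left Γ_D
  Γ_K := eq_neg_of_add_eq_zero_left Γ_K
  Γ_L := eq_neg_of_add_eq_zero_left Γ_L

theorem homotopy' (H : IsTwistedRetract Γ D K P L) : D * K + K * D + P = 1 := by
  rw [H.homotopy, sub_add_cancel]

theorem D_L' (H : IsTwistedRetract Γ D K P L) : D * L + L * D = 0 := by
  rw [H.D_L, neg_add_cancel]

end IsTwistedRetract

end Abstract

open scoped TensorProduct

/-! ## Operators on `𝒞 ⊗ g` -/

section LieTrace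

variable {g : Type*} [LieRing g] [LieAlgebra ℝ g] {κ : LinearMap.BilinForm ℝ g}

/-- Invariance makes `ad X` skew for `κ`, so its matrix is similar to minus its transpose. This
disposes of loops with a single vertex. -/
theorem trace_ad [FiniteDimensional ℝ g] (hκ : IsQuadraticForm κ) (X : g) :
    LinearMap.trace ℝ g (LieAlgebra.ad ℝ g X) = 0 := by
  classical
  let T := Module.finBasis ℝ g
  set G := gramLie κ T with hG
  set B := LinearMap.toMatrix T T (LieAlgebra.ad ℝ g X) with hB
  have hu := (Matrix.isUnit_iff_isUnit_det _).1 (gramLie_isUnit T hκ)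
  have hB' : ∀ a b, B a b = T.repr ⁅X, T b⁆ a := fun a b => by
    rw [hB, LinearMap.toMatrix_apply, LieAlgebra.ad_apply]
  have h1 : G * B = -(B.transpose * G) := by
    ext b c
    rw [Matrix.neg_apply, Matrix.mul_apply, Matrix.mul_apply]
    have h2 : ∑ a, G b a * B a c = κ (T b) ⁅X, T c⁆ := by
      conv_rhs => rw [← T.sum_repr ⁅X, T c⁆]
      simp only [map_sum, map_smul, smul_eq_mul, hB', hG, gramLie, Matrix.of_apply, mul_comm]
    have h3 : ∑ a, B.transpose b a * G a c = κ ⁅X, T b⁆ (T c) := by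
      conv_rhs => rw [← T.sum_repr ⁅X, T b⁆]
      simp only [map_sum, map_smul, LinearMap.sum_apply, LinearMap.smul_apply, smul_eq_mul,
        Matrix.transpose_apply, hB', hG, gramLie, Matrix.of_apply]
    rw [h2, h3, ← hκ.invariant, ← lie_skew, map_neg, LinearMap.neg_apply]
  have h2 : B = -(G⁻¹ * (B.transpose * G)) := by
    rw [← mul_neg, ← h1, ← mul_assoc, Matrix.nonsing_inv_mul _ hu, one_mul]
  have h3 : B.trace = -B.trace := by
    conv_lhs => rw [h2]
    rw [Matrix.trace_neg, Matrix.trace_mul_comm, mul_assoc, Matrix.mul_nonsing_inv _ hu, mul_one,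
      Matrix.trace_transpose]
  rw [LinearMap.trace_eq_matrix_trace ℝ T]
  linarith

end LieTrace

/-! ### The operators `l(γ, •)` and their graded identities -/

section Bracket

variable {A : Type*} [Ring A] [Algebra ℝ A] (𝒞 : ℕ → Submodule ℝ A) [GradedAlgebra 𝒞]
  {g : Type*} [LieRing g] [LieAlgebra ℝ g] {κ : LinearMap.BilinForm ℝ g}

/-- The operators `l(γ, •)` on `𝒞 ⊗ g`. -/
def bracket : A ⊗[ℝ] g →ₗ[ℝ] Module.End ℝ (A ⊗[ℝ] g) :=
  TensorProduct.homTensorHomMap (RingHom.id ℝ) A g A g ∘ₗ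
    TensorProduct.map (LinearMap.mul ℝ A) (LieAlgebra.ad ℝ g : g →ₗ[ℝ] Module.End ℝ g)

theorem bracket_tmul (a : A) (X : g) : bracket (a ⊗ₜ[ℝ] X) =
    TensorProduct.map (LinearMap.mulLeft ℝ a) (LieAlgebra.ad ℝ g X) := rfl

@[simp] theorem bracket_tmul_tmul (a b : A) (X Y : g) :
    bracket (a ⊗ₜ[ℝ] X) (b ⊗ₜ[ℝ] Y) = (a * b) ⊗ₜ[ℝ] ⁅X, Y⁆ := rfl

/-- The elements of degree `n` of `𝒞 ⊗ g`. -/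
def tensorDeg (g : Type*) [AddCommGroup g] [Module ℝ g] (n : ℕ) : Submodule ℝ (A ⊗[ℝ] g) :=
  Submodule.span ℝ {t | ∃ a ∈ 𝒞 n, ∃ X : g, a ⊗ₜ[ℝ] X = t}

variable {𝒞}

theorem tmul_mem_tensorDeg {n : ℕ} {a : A} (ha : a ∈ 𝒞 n) (X : g) :
    a ⊗ₜ[ℝ] X ∈ tensorDeg 𝒞 g n := Submodule.subset_span ⟨a, ha, X, rfl⟩

theorem rTensor_mem_tensorDeg {f : A →ₗ[ℝ] A} {n m : ℕ} (hf : ∀ a ∈ 𝒞 n, f a ∈ 𝒞 m)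
    {γ : A ⊗[ℝ] g} (hγ : γ ∈ tensorDeg 𝒞 g n) : f.rTensor g γ ∈ tensorDeg 𝒞 g m := by
  induction hγ using Submodule.span_induction with
  | mem t ht => obtain ⟨a, ha, X, rfl⟩ := ht; exact tmul_mem_tensorDeg (hf a ha) X
  | zero => rw [map_zero]; exact zero_mem _
  | add s t _ _ hs ht => rw [map_add]; exact add_mem hs ht
  | smul c t _ ht => rw [map_smul]; exact Submodule.smul_mem _ _ ht

theorem bracket_mem_tensorDeg {n m : ℕ} {γ β : A ⊗[ℝ] g} (hγ : γ ∈ tensorDeg 𝒞 g n)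
    (hβ : β ∈ tensorDeg 𝒞 g m) : bracket γ β ∈ tensorDeg 𝒞 g (n + m) := by
  induction hγ using Submodule.span_induction with
  | mem t ht =>
    obtain ⟨a, ha, X, rfl⟩ := ht
    induction hβ using Submodule.span_induction with
    | mem t ht =>
      obtain ⟨b, hb, Y, rfl⟩ := ht
      exact tmul_mem_tensorDeg (SetLike.mul_mem_graded ha hb) _
    | zero => rw [map_zero]; exact zero_mem _
    | add s t _ _ hs ht => rw [map_add]; exact add_mem hs ht
    | smul c t _ ht => rw [map_smul]; exact Submodule.smul_mem _ _ ht
  | zero => rw [map_zero]; exact zero_mem _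
  | add s t _ _ hs ht => rw [map_add]; exact add_mem hs ht
  | smul c t _ ht => rw [map_smul]; exact Submodule.smul_mem _ _ ht

theorem DGFrobenius.d_bracket (D : DGFrobenius 𝒞) {n : ℕ} {γ : A ⊗[ℝ] g} (hγ : γ ∈ tensorDeg 𝒞 g n) :
    D.d.rTensor g * bracket γ =
      bracket (D.d.rTensor g γ) + (-1 : ℝ) ^ n • (bracket γ * D.d.rTensor g) := by
  induction hγ using Submodule.span_induction with
  | mem t ht =>
    obtain ⟨a, ha, X, rfl⟩ := ht
    refine TensorProduct.ext' fun b Y => ?_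
    simp only [Module.End.mul_apply, bracket_tmul_tmul, LinearMap.rTensor_tmul,
      LinearMap.add_apply, LinearMap.smul_apply, D.leibniz b ha, TensorProduct.add_tmul,
      TensorProduct.smul_tmul']
  | zero => simp
  | add s t _ _ hs ht => rw [map_add, mul_add, hs, ht, map_add, map_add, add_mul, smul_add]; abel
  | smul c t _ ht =>
    rw [map_smul, mul_smul_comm, ht, map_smul, map_smul, smul_add, smul_mul_assoc, smul_comm c]

theorem signOp_bracket {n : ℕ} {γ : A ⊗[ℝ] g} (hγ : γ ∈ tensorDeg 𝒞 g n) :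
    (signOp 𝒞).rTensor g * bracket γ = (-1 : ℝ) ^ n • (bracket γ * (signOp 𝒞).rTensor g) := by
  induction hγ using Submodule.span_induction with
  | mem t ht =>
    obtain ⟨a, ha, X, rfl⟩ := ht
    refine TensorProduct.ext' fun b Y => ?_
    simp only [Module.End.mul_apply, bracket_tmul_tmul, LinearMap.rTensor_tmul,
      LinearMap.smul_apply, TensorProduct.smul_tmul']
    congr 1
    induction b using DirectSum.Decomposition.inductionOn 𝒞 with
    | zero => simp
    | @homogeneous j b =>
      rw [signOp_of_mem 𝒞 (SetLike.mul_mem_graded ha b.2), signOp_of_mem 𝒞 b.2, mul_smul_comm, smul_smul,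
        pow_add]
    | add b b' hb hb' => rw [mul_add, map_add, hb, hb', map_add, mul_add, smul_add]
  | zero => simp
  | add s t _ _ hs ht => rw [map_add, mul_add, hs, ht, add_mul, smul_add]
  | smul c t _ ht => rw [map_smul, mul_smul_comm, ht, smul_mul_assoc, smul_comm c]

theorem DGFrobenius.bracket_comm (D : DGFrobenius 𝒞) {n m : ℕ} {γ β : A ⊗[ℝ] g} (hγ : γ ∈ tensorDeg 𝒞 g n)
    (hβ : β ∈ tensorDeg 𝒞 g m) : bracket γ β = (-1 : ℝ) ^ (n * m + 1) • bracket β γ := by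
  induction hγ using Submodule.span_induction with
  | mem t ht =>
    obtain ⟨a, ha, X, rfl⟩ := ht
    induction hβ using Submodule.span_induction with
    | mem t ht =>
      obtain ⟨b, hb, Y, rfl⟩ := ht
      rw [bracket_tmul_tmul, bracket_tmul_tmul, D.graded_comm ha hb,
        show ⁅X, Y⁆ = (-1 : ℝ) • ⁅Y, X⁆ by rw [neg_one_smul, lie_skew], TensorProduct.tmul_smul,
        ← TensorProduct.smul_tmul', smul_smul, mul_comm, pow_succ]
    | zero => simp
    | add s t _ _ hs ht => rw [map_add, hs, ht, map_add, LinearMap.add_apply, smul_add]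
    | smul c t _ ht => rw [map_smul, ht, map_smul, LinearMap.smul_apply, smul_comm c]
  | zero => simp
  | add s t _ _ hs ht => rw [map_add, LinearMap.add_apply, hs, ht, map_add, smul_add]
  | smul c t _ ht => rw [map_smul, LinearMap.smul_apply, ht, map_smul, smul_comm c]

/-- The graded Jacobi identity. For `γ = β` of degree one it says that twice the square of `l(γ, •)`
is `l(l(γ, γ), •)`. -/
theorem DGFrobenius.bracket_bracket (D : DGFrobenius 𝒞) {n m : ℕ} {γ β : A ⊗[ℝ] g} (hγ : γ ∈ tensorDeg 𝒞 g n)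
    (hβ : β ∈ tensorDeg 𝒞 g m) :
    bracket γ * bracket β =
      bracket (bracket γ β) + (-1 : ℝ) ^ (n * m) • (bracket β * bracket γ) := by
  induction hγ using Submodule.span_induction with
  | mem t ht =>
    obtain ⟨a, ha, X, rfl⟩ := ht
    induction hβ using Submodule.span_induction with
    | mem t ht =>
      obtain ⟨b, hb, Y, rfl⟩ := ht
      refine TensorProduct.ext' fun c Z => ?_
      simp only [Module.End.mul_apply, bracket_tmul_tmul, LinearMap.add_apply,
        LinearMap.smul_apply, TensorProduct.smul_tmul']
      rw [← mul_assoc b, ← smul_mul_assoc, ← D.graded_comm ha hb, mul_assoc, lie_lie,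
        TensorProduct.tmul_sub, sub_add_cancel]
    | zero => simp
    | add s t _ _ hs ht =>
      rw [map_add, map_add, map_add, mul_add, add_mul, smul_add, hs, ht]; abel
    | smul c t _ ht =>
      rw [map_smul, map_smul, map_smul, mul_smul_comm, smul_mul_assoc, smul_comm _ c, ht, smul_add]
  | zero => simp
  | add s t _ _ hs ht =>
    rw [map_add, LinearMap.add_apply, map_add, mul_add, add_mul, smul_add, hs, ht]; abel
  | smul c t _ ht =>
    rw [map_smul, LinearMap.smul_apply, map_smul, mul_smul_comm, smul_mul_assoc, smul_comm _ c,
      ht, smul_add]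

/-- The trace on a pure tensor of operators factors, and the factor on `g` is the trace of some `ad
X`. -/
theorem trace_rTensor_mul_bracket [FiniteDimensional ℝ A] [FiniteDimensional ℝ g]
    (hκ : IsQuadraticForm κ) (F : Module.End ℝ A) (γ : A ⊗[ℝ] g) :
    LinearMap.trace ℝ (A ⊗[ℝ] g) (F.rTensor g * bracket γ) = 0 := by
  induction γ using TensorProduct.induction_on with
  | zero => simp
  | tmul a X =>
    have h1 : F.rTensor g * bracket (a ⊗ₜ[ℝ] X) =
        TensorProduct.map (F * LinearMap.mulLeft ℝ a) (LieAlgebra.ad ℝ g X) := by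
      refine TensorProduct.ext' fun b Y => ?_
      simp [bracket_tmul]
    rw [h1, LinearMap.trace_tensorProduct', trace_ad hκ, mul_zero]
  | add s t hs ht => rw [map_add, mul_add, map_add, hs, ht, add_zero]

theorem signOp_rTensor_anticomm {f : A →ₗ[ℝ] A} (hf : ∀ a, signOp 𝒞 (f a) = -f (signOp 𝒞 a)) :
    (signOp 𝒞).rTensor g * f.rTensor g + f.rTensor g * (signOp 𝒞).rTensor g = 0 := by
  refine TensorProduct.ext' fun b Y => ?_
  simp [hf, ← TensorProduct.add_tmul]

end Bracket

/-! ## Variations of induction data and the Maurer--Cartan equation -/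

section Variation

variable {A : Type*} [Ring A] [Algebra ℝ A] {𝒞 : ℕ → Submodule ℝ A} [GradedAlgebra 𝒞]
  {D : DGFrobenius 𝒞} {g : Type*} [LieRing g] [LieAlgebra ℝ g] {κ : LinearMap.BilinForm ℝ g}
  {ι : D.Cohomology →ₗ[ℝ] A} {K : A →ₗ[ℝ] A}

/-- The product of cohomology classes. -/
def DGFrobenius.hmul (D : DGFrobenius 𝒞) (x y : D.Cohomology) : D.Cohomology :=
  D.cls ⟨_, D.mul_mem_cocycles (Function.surjInv D.cls_surjective x).2
    (Function.surjInv D.cls_surjective y).2⟩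

theorem DGFrobenius.IsAlgHom.map_hmul (hι : D.IsAlgHom ι) (x y : D.Cohomology) :
    ι (D.hmul x y) = ι x * ι y := by
  rw [DGFrobenius.hmul, hι.map_mul, Function.surjInv_eq D.cls_surjective,
    Function.surjInv_eq D.cls_surjective]

theorem DGFrobenius.IsInfinitesimalDeformation.map_hmul {δι : D.Cohomology →ₗ[ℝ] A}
    {δK : A →ₗ[ℝ] A} (hδ : D.IsInfinitesimalDeformation ι K δι δK) (x y : D.Cohomology) :
    δι (D.hmul x y) = δι x * ι y + ι x * δι y := by
  rw [DGFrobenius.hmul, hδ.map_mul, Function.surjInv_eq D.cls_surjective,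
    Function.surjInv_eq D.cls_surjective]

theorem signOp_d (a : A) : signOp 𝒞 (D.d a) = -D.d (signOp 𝒞 a) := by
  induction a using DirectSum.Decomposition.inductionOn 𝒞 with
  | zero => simp
  | @homogeneous i a =>
    rw [signOp_of_mem 𝒞 a.2, signOp_of_mem 𝒞 (D.d_mem a.2), map_smul, pow_succ, mul_neg_one,
      neg_smul]
  | add a a' ha ha' => simp only [map_add, ha, ha', neg_add]

namespace DGFrobenius.IsRelaxed

theorem signOp_K (hK : D.IsRelaxed ι K) (a : A) : signOp 𝒞 (K a) = -K (signOp 𝒞 a) := by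
  induction a using DirectSum.Decomposition.inductionOn 𝒞 with
  | zero => simp
  | @homogeneous i a =>
    rw [signOp_of_mem 𝒞 a.2, map_smul]
    rcases i with _ | i
    · rw [hK.mem_zero a.2]; simp
    · rw [signOp_of_mem 𝒞 (hK.mem a.2), pow_succ, mul_neg_one, neg_smul, neg_neg]
  | add a a' ha ha' => simp only [map_add, ha, ha', neg_add]

theorem transpose_eq_zero (hι : D.IsEmbedding ι) (hK : D.IsRelaxed ι K) {a : A}
    (ha : a ∈ D.complement ι) : ι (hK.transpose a) = 0 :=
  hK.eq_zero_of_pair_embedding hι fun x => by rw [hK.pair_transpose, ha]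

theorem transpose_embedding (hι : D.IsEmbedding ι) (hK : D.IsRelaxed ι K) (x : D.Cohomology) :
    ι (hK.transpose (ι x)) = ι x := (hK.transpose_unique hι fun _ => rfl).symm

theorem transpose_d (hι : D.IsEmbedding ι) (hK : D.IsRelaxed ι K) (a : A) :
    ι (hK.transpose (D.d a)) = 0 := hK.transpose_eq_zero hι fun x => hι.pair_d x a

/-- Multiplication by `ι x` preserves `ι(H)` because `ι` is a homomorphism, and then also the
orthogonal complement by cyclicity; so it commutes with the projection. -/
theorem transpose_mul (hι : D.IsEmbedding ι) (hhom : D.IsAlgHom ι) (hK : D.IsRelaxed ι K)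
    (x : D.Cohomology) (a : A) :
    ι (hK.transpose (ι x * a)) = ι x * ι (hK.transpose a) := by
  have h1 : ι x * (a - ι (hK.transpose a)) ∈ D.complement ι := fun y => by
    obtain ⟨z, hz⟩ := hhom.exists_mul y x
    rw [D.pair_comm, D.cyclic, hz, D.pair_comm, hK.sub_transpose_mem a]
  have h2 := hK.transpose_eq_zero hι h1
  obtain ⟨z, hz⟩ := hhom.exists_mul x (hK.transpose a)
  rw [mul_sub, map_sub, map_sub, sub_eq_zero, hz, hK.transpose_embedding hι] at h2
  rw [h2, hz]

end DGFrobenius.IsRelaxed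

/-- The first-order consequences of a deformation of relaxed induction data. -/
structure DGFrobenius.IsVariation (D : DGFrobenius 𝒞) {ι : D.Cohomology →ₗ[ℝ] A} {K : A →ₗ[ℝ] A}
    (hK : D.IsRelaxed ι K) (δι : D.Cohomology →ₗ[ℝ] A) (δK : A →ₗ[ℝ] A) : Prop where
  embedding_mem : ∀ {n : ℕ} {x : D.Cohomology}, x ∈ D.cohomologyDeg n → δι x ∈ 𝒞 n
  represents : ∀ x, δι x ∈ LinearMap.range D.d
  map_hmul : ∀ x y, δι (D.hmul x y) = δι x * ι y + ι x * δι y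
  homotopy : ∀ a, ι (hK.transpose (δK a)) = D.d (δK (K a)) + δK (D.d (K a))

/-- The varied homotopy relation is needed only on the image of `K`, where the transpose vanishes.
There the term `ι δρ` is identified with `-P δK` by its pairings with `ι(H)`. -/
theorem DGFrobenius.IsInfinitesimalDeformation.isVariation (hι : D.IsEmbedding ι)
    (hK : D.IsRelaxed ι K) {δι : D.Cohomology →ₗ[ℝ] A} {δK : A →ₗ[ℝ] A}
    (hδ : D.IsInfinitesimalDeformation ι K δι δK) : D.IsVariation hK δι δK where
  embedding_mem := hδ.embedding_mem
  represents := hδ.represents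
  map_hmul := hδ.map_hmul
  homotopy a := by
    obtain ⟨ρ, δρ, h1, h2, h3⟩ := hδ.homotopy
    have h4 : ρ (K a) = 0 := by
      refine hι.injective ?_
      rw [map_zero]
      exact hK.eq_zero_of_pair_embedding hι fun x => by rw [h1, hK.pair_K_embedding]
    -- The transposed form of `δK ι + K δι = 0`.
    have h5 : ∀ a x, D.pair (δK a) (ι x) = -D.pair (K a) (δι x) := by
      intro a x
      have hx : δK (ι x) = -K (δι x) := eq_neg_of_add_eq_zero_left (hδ.comp_embedding x)
      induction a using DirectSum.Decomposition.inductionOn 𝒞 with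
      | zero => simp
      | homogeneous a => rw [hδ.symm _ a.2, hK.symm _ a.2, hx, map_neg, mul_neg]
      | add a a' ha ha' => simp only [map_add, LinearMap.add_apply, ha, ha', neg_add]
    have h6 : ι (hK.transpose (δK a) + δρ (K a)) = 0 := by
      refine hK.eq_zero_of_pair_embedding hι fun x => ?_
      have := h2 (K a) x
      rw [h4, map_zero, map_zero, zero_add, map_zero, LinearMap.zero_apply, add_zero] at this
      rw [map_add, map_add, LinearMap.add_apply, hK.pair_transpose, h5, this, neg_add_cancel]
    rw [h3, h4, map_zero, zero_add]
    rw [map_add] at h6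
    exact eq_neg_of_add_eq_zero_left h6

variable [FiniteDimensional ℝ A] [FiniteDimensional ℝ g]

/-- The trace on endomorphisms of `𝒞 ⊗ g`. -/
def traceHom (A g : Type*) [Ring A] [Algebra ℝ A] [LieRing g] [LieAlgebra ℝ g] :
    Module.End ℝ (A ⊗[ℝ] g) →+ ℝ := (LinearMap.trace ℝ (A ⊗[ℝ] g)).toAddMonoidHom

theorem traceHom_comm (a b : Module.End ℝ (A ⊗[ℝ] g)) :
    traceHom A g (a * b) = traceHom A g (b * a) := LinearMap.trace_mul_comm ℝ a b

theorem add_eq_zero_of_eq_smul {R : Type*} [AddCommMonoid R] [Module ℝ R] {a b : R}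
    (h : a = (-1 : ℝ) • b) : a + b = 0 := by
  have h1 : (-1 : ℝ) • b + (1 : ℝ) • b = 0 := by rw [← add_smul, neg_add_cancel, zero_smul]
  rwa [one_smul, ← h] at h1

/-- The Maurer-Cartan equation gives `L² = 0` through the Jacobi identity, closedness of `ι(H)`
gives the relation with `d`, and the homomorphism property the relation with `P`. -/
theorem isTwistedRetract (hι : D.IsEmbedding ι) (hhom : D.IsAlgHom ι) (hK : D.IsRelaxed ι K)
    (ξ : D.Cohomology ⊗[ℝ] g) (hω : ι.rTensor g ξ ∈ tensorDeg 𝒞 g 1)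
    (hMC : bracket (ι.rTensor g ξ) (ι.rTensor g ξ) = 0) :
    IsTwistedRetract ((signOp 𝒞).rTensor g) (D.d.rTensor g) (K.rTensor g)
      ((ι ∘ₗ hK.transpose).rTensor g) (bracket (ι.rTensor g ξ)) := by
  refine IsTwistedRetract.of_add ?_ ?_ ?_ ?_ ?_ ?_ (signOp_rTensor_anticomm signOp_d)
    (signOp_rTensor_anticomm hK.signOp_K) ?_
  · refine TensorProduct.ext' fun a X => ?_
    have := congrArg (fun b => b ⊗ₜ[ℝ] X) (eq_sub_iff_add_eq.1 (hK.homotopy_eq a))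
    simpa [TensorProduct.add_tmul] using this
  · refine TensorProduct.ext' fun a X => ?_
    simp [hK.transpose_eq_zero hι (hK.K_mem a)]
  · refine TensorProduct.ext' fun a X => ?_
    simp [hK.comp_embedding]
  · clear hω hMC
    induction ξ using TensorProduct.induction_on with
    | zero => simp
    | tmul x X =>
      refine TensorProduct.ext' fun a Y => ?_
      simp [hK.transpose_mul hι hhom]
    | add s t hs ht => simp only [map_add, mul_add, add_mul, hs, ht]
  · have h1 := D.bracket_bracket hω hω
    rw [hMC, map_zero, zero_add, mul_one, pow_one] at h1
    exact add_eq_zero_of_eq_smul h1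
  · have h1 := D.d_bracket hω
    have h2 : D.d.rTensor g (ι.rTensor g ξ) = 0 := by
      rw [← LinearMap.comp_apply, ← LinearMap.rTensor_comp,
        show D.d ∘ₗ ι = 0 from LinearMap.ext hι.d_apply]
      simp
    rw [h2, map_zero, zero_add, pow_one] at h1
    exact add_eq_zero_of_eq_smul h1
  · have h1 := signOp_bracket hω
    rw [pow_one] at h1
    exact add_eq_zero_of_eq_smul h1

variable {ξ : D.Cohomology ⊗[ℝ] g}

/-- Induction on the number of factors `K L`: `trace_exact_variation'` removes one of them and
replaces `β` by `K l(ω, β)`, which satisfies the same hypotheses. The last loop vanishes because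
`ad` is traceless. -/
theorem trace_exact_eq_zero (hκ : IsQuadraticForm κ) (hι : D.IsEmbedding ι) (hhom : D.IsAlgHom ι)
    (hK : D.IsRelaxed ι K) (hω : ι.rTensor g ξ ∈ tensorDeg 𝒞 g 1)
    (hMC : bracket (ι.rTensor g ξ) (ι.rTensor g ξ) = 0) (m : ℕ) {β : A ⊗[ℝ] g}
    (hβ : β ∈ tensorDeg 𝒞 g 0) (hPβ : (ι ∘ₗ hK.transpose).rTensor g β = 0)
    (hdβ : bracket (ι.rTensor g ξ) (D.d.rTensor g β) = 0) :
    traceHom A g ((signOp 𝒞).rTensor g * (K.rTensor g * bracket (D.d.rTensor g β) *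
      (K.rTensor g * bracket (ι.rTensor g ξ)) ^ m)) = 0 := by
  have H := isTwistedRetract hι hhom hK ξ hω hMC
  induction m generalizing β with
  | zero =>
    rw [pow_zero, mul_one, ← mul_assoc, ← LinearMap.rTensor_mul]
    exact trace_rTensor_mul_bracket hκ _ _
  | succ m ih =>
    set ω := ι.rTensor g ξ with hωdef
    have h1 : D.d.rTensor g * bracket β =
        bracket (D.d.rTensor g β) + bracket β * D.d.rTensor g := by
      have := D.d_bracket hβ
      rwa [pow_zero, one_smul] at this
    have h2 : bracket ω * bracket β = bracket (bracket ω β) + bracket β * bracket ω := by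
      have := D.bracket_bracket hω hβ
      rwa [mul_zero, pow_zero, one_smul] at this
    have h3 : (signOp 𝒞).rTensor g * bracket β = bracket β * (signOp 𝒞).rTensor g := by
      have := signOp_bracket hβ
      rwa [pow_zero, one_smul] at this
    -- `l(ω, β)` is closed because `l(ω, dβ) = 0`, and `P` kills it because `P β = 0`; the homotopy
    -- relation then exhibits it as exact.
    have h4 : D.d.rTensor g (K.rTensor g (bracket ω β)) = bracket ω β := by
      have h5 := LinearMap.congr_fun H.homotopy' (bracket ω β)
      have h6 := LinearMap.congr_fun H.P_L β
      have h7 := LinearMap.congr_fun H.D_L' β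
      simp only [LinearMap.add_apply, Module.End.mul_apply, LinearMap.zero_apply,
        Module.End.one_apply] at h5 h6 h7
      rw [hdβ, add_zero] at h7
      rw [h6, hPβ, h7, map_zero, map_zero, add_zero, add_zero] at h5
      exact h5
    have h8 := bracket_mem_tensorDeg hω hβ
    rw [add_zero] at h8
    have h9 : K.rTensor g (bracket ω β) ∈ tensorDeg 𝒞 g 0 :=
      rTensor_mem_tensorDeg (fun _ ha => hK.mem ha) h8
    have h10 := ih h9 (LinearMap.congr_fun H.P_K (bracket ω β))
    refine (H.trace_exact_variation' traceHom_comm h3 h1 h2 m).trans ?_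
    rw [h4] at h10
    exact h10 (LinearMap.congr_fun H.L_L β)

theorem DGFrobenius.IsVariation.trace_eq_zero (hκ : IsQuadraticForm κ) (hι : D.IsEmbedding ι)
    (hhom : D.IsAlgHom ι) {hK : D.IsRelaxed ι K} {δι : D.Cohomology →ₗ[ℝ] A} {δK : A →ₗ[ℝ] A}
    (hδ : D.IsVariation hK δι δK) (hω : ι.rTensor g ξ ∈ tensorDeg 𝒞 g 1)
    (hMC : bracket (ι.rTensor g ξ) (ι.rTensor g ξ) = 0) (hδω : δι.rTensor g ξ ∈ tensorDeg 𝒞 g 1)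
    (hδMC : bracket (ι.rTensor g ξ) (δι.rTensor g ξ) = 0) (m : ℕ) :
    traceHom A g ((signOp 𝒞).rTensor g * ((δK.rTensor g * bracket (ι.rTensor g ξ) +
      K.rTensor g * bracket (δι.rTensor g ξ)) *
        (K.rTensor g * bracket (ι.rTensor g ξ)) ^ m)) = 0 := by
  have H := isTwistedRetract hι hhom hK ξ hω hMC
  rw [add_mul, mul_add, map_add]
  have h1 : traceHom A g ((signOp 𝒞).rTensor g * (δK.rTensor g * bracket (ι.rTensor g ξ) *
      (K.rTensor g * bracket (ι.rTensor g ξ)) ^ m)) = 0 := by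
    -- The loop with a single vertex is not covered by `trace_homotopy_variation`; it vanishes
    -- because `ad` is traceless.
    rcases m with _ | m
    · rw [pow_zero, mul_one, ← mul_assoc, ← LinearMap.rTensor_mul]
      exact trace_rTensor_mul_bracket hκ _ _
    · refine H.trace_homotopy_variation traceHom_comm ?_ m
      refine TensorProduct.ext' fun a X => ?_
      simp [hδ.homotopy, TensorProduct.add_tmul]
  -- The variation of a representative is exact, so `K` provides a primitive, namely one that `P`
  -- annihilates.
  have h2 : D.d.rTensor g (K.rTensor g (δι.rTensor g ξ)) = δι.rTensor g ξ := by
    have h3 : D.d ∘ₗ K ∘ₗ δι = δι := by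
      refine LinearMap.ext fun x => ?_
      obtain ⟨c, hc⟩ := hδ.represents x
      have := hK.homotopy_eq (δι x)
      rw [← hc, D.d_d, map_zero, add_zero, hK.transpose_d hι, sub_zero, hc] at this
      exact this
    conv_rhs => rw [← h3]
    rw [LinearMap.rTensor_comp, LinearMap.rTensor_comp]
    rfl
  rw [h1, zero_add, ← h2]
  refine trace_exact_eq_zero hκ hι hhom hK hω hMC m
    (rTensor_mem_tensorDeg (fun a ha => hK.mem ha) hδω) ?_ ?_
  · exact LinearMap.congr_fun H.P_K _
  · rw [h2, hδMC]

end Variation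

/-! ## The strict chain homotopy `K d K` -/

section Strict

variable {A : Type*} [Ring A] [Algebra ℝ A] {𝒞 : ℕ → Submodule ℝ A} [GradedAlgebra 𝒞]
  {D : DGFrobenius 𝒞} {ι : D.Cohomology →ₗ[ℝ] A} {K : A →ₗ[ℝ] A}

/-- By `d K d = d`, replacing `K` by `K d K` changes neither `d K` nor `K d`, so the homotopy
relation is preserved. -/
theorem DGFrobenius.IsRelaxed.isStrict (hι : D.IsEmbedding ι) (hK : D.IsRelaxed ι K) :
    D.IsStrict ι (K ∘ₗ D.d ∘ₗ K) := by
  have h1 : ∀ a, D.d (K (D.d a)) = D.d a := fun a => by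
    have := hK.homotopy_eq (D.d a)
    rwa [D.d_d, map_zero, add_zero, hK.transpose_d hι, sub_zero] at this
  refine ⟨⟨?_, ?_, ?_, ?_, ?_⟩, ?_⟩
  · intro n a ha
    rcases n with _ | n
    · exact hK.mem (D.d_mem (hK.mem ha))
    · exact hK.mem (D.d_mem (hK.mem ha))
  · intro a ha
    simp [hK.mem_zero ha]
  · refine ⟨hK.transpose, hK.pair_transpose, fun a => ?_⟩
    simp only [LinearMap.comp_apply, h1]
    exact hK.homotopy_eq a
  · intro i a b ha
    simp only [LinearMap.comp_apply]
    rw [hK.pair_K, signOp_d, hK.signOp_K, map_neg D.d, neg_neg, D.pair_d, hK.signOp_K, map_neg,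
      LinearMap.neg_apply, neg_neg, signOp_signOp, hK.symm _ ha]
  · intro x
    simp [hK.comp_embedding]
  · intro a
    simp only [LinearMap.comp_apply]
    have h2 := hK.homotopy_eq (K (D.d (K a)))
    -- The element `b = K d K a` satisfies `K d b = b` and `P b = 0`, so the homotopy relation
    -- leaves `d K b = 0`.
    have h3 : D.d (K (K (D.d (K a)))) = 0 := by
      rwa [h1, hK.transpose_eq_zero hι (hK.K_mem _), sub_zero, add_eq_right] at h2
    rw [h3, map_zero]

end Strict

/-! ## Points of the Maurer--Cartan set -/

section MaurerCartan

variable {A : Type*} [Ring A] [Algebra ℝ A] {𝒞 : ℕ → Submodule ℝ A} [GradedAlgebra 𝒞]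
  {D : DGFrobenius 𝒞} {g : Type*} [LieRing g] [LieAlgebra ℝ g]
  {ι : D.Cohomology →ₗ[ℝ] A} {K : A →ₗ[ℝ] A} {𝔞 J : Type*} [Fintype 𝔞] [Fintype J]
  (T : Module.Basis 𝔞 ℝ g) (h : HomogeneousBasis D.cohomologyDeg J) {x : J × 𝔞 → ℝ}

/-- The components `αʲ = ∑ₐ x (j, a) T_a` of a point. -/
def component (x : J × 𝔞 → ℝ) (j : J) : g := ∑ a, x (j, a) • T a

/-- The element `∑ⱼ h_j ⊗ αʲ` given by a point. -/
def pointTensor (x : J × 𝔞 → ℝ) : D.Cohomology ⊗[ℝ] g :=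
  ∑ j, h.basis j ⊗ₜ[ℝ] component T x j

theorem rTensor_pointTensor (φ : D.Cohomology →ₗ[ℝ] A) :
    φ.rTensor g (pointTensor T h x) = ∑ j, φ (h.basis j) ⊗ₜ[ℝ] component T x j := by
  simp [pointTensor]

theorem component_eq_zero (hx : x ∈ MC D T h ι) {j : J} (hj : h.deg j ≠ 1) :
    component T x j = 0 :=
  Finset.sum_eq_zero fun a _ => by rw [hx.1 j a hj, zero_smul]

theorem rTensor_pointTensor_mem (hx : x ∈ MC D T h ι) {φ : D.Cohomology →ₗ[ℝ] A}
    (hφ : ∀ {n : ℕ} {y : D.Cohomology}, y ∈ D.cohomologyDeg n → φ y ∈ 𝒞 n) :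
    φ.rTensor g (pointTensor T h x) ∈ tensorDeg 𝒞 g 1 := by
  rw [rTensor_pointTensor]
  refine Submodule.sum_mem _ fun j _ => ?_
  by_cases hj : h.deg j = 1
  · refine tmul_mem_tensorDeg ?_ _
    rw [← hj]
    exact hφ (h.mem j)
  · rw [component_eq_zero T h hx hj, TensorProduct.tmul_zero]
    exact zero_mem _

/-- The Maurer--Cartan equation in cohomology. -/
theorem maurerCartan (hι : D.IsEmbedding ι) (hhom : D.IsAlgHom ι) (hK : D.IsRelaxed ι K)
    (hx : x ∈ MC D T h ι) : ∑ j, ∑ k, D.hmul (h.basis j) (h.basis k) ⊗ₜ[ℝ]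
      ⁅component T x j, component T x k⁆ = 0 := by
  have h1 : ∀ c, ∑ j, ∑ k, T.repr ⁅component T x j, component T x k⁆ c •
      D.hmul (h.basis j) (h.basis k) = 0 := by
    intro c
    refine hι.injective ?_
    rw [map_zero]
    refine hK.eq_zero_of_pair_embedding hι fun y => ?_
    rw [D.pair_comm, ← h.basis.sum_repr y, map_sum ι (fun i => h.basis.repr y i • h.basis i),
      map_sum D.pair, LinearMap.sum_apply]
    refine Finset.sum_eq_zero fun i _ => ?_
    rw [map_smul, map_smul, LinearMap.smul_apply]
    simp only [map_sum, map_smul, hhom.map_hmul]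
    -- The definition of `MC` tests only classes of degree one; against any other class the product
    -- of two elements of degree one pairs to zero.
    by_cases hi : h.deg i = 1
    · have h2 := congrArg (fun v => T.repr v c) (hx.2 i hi)
      simp only [map_sum, map_smul, Finsupp.finsetSum_apply, Finsupp.smul_apply, smul_eq_mul,
        map_zero, Finsupp.zero_apply] at h2
      refine smul_eq_zero_of_right _ (Eq.trans ?_ h2)
      refine Finset.sum_congr rfl fun j _ => Finset.sum_congr rfl fun k _ => ?_
      exact mul_comm _ _
    · refine smul_eq_zero_of_right _ (Finset.sum_eq_zero fun j _ => Finset.sum_eq_zero fun k _ => ?_)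
      by_cases hj : h.deg j = 1
      · by_cases hk : h.deg k = 1
        · rw [D.pair_of_ne (hι.mem_of_basis h i) (SetLike.mul_mem_graded (hι.mem_of_basis h j)
            (hι.mem_of_basis h k)) (by omega), smul_zero]
        · rw [component_eq_zero T h hx hk]; simp
      · rw [component_eq_zero T h hx hj]; simp
  have h2 : ∀ j k, D.hmul (h.basis j) (h.basis k) ⊗ₜ[ℝ] ⁅component T x j, component T x k⁆ =
      ∑ c, (T.repr ⁅component T x j, component T x k⁆ c •
        D.hmul (h.basis j) (h.basis k)) ⊗ₜ[ℝ] T c := by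
    intro j k
    conv_lhs => rw [← T.sum_repr ⁅component T x j, component T x k⁆, TensorProduct.tmul_sum]
    simp only [TensorProduct.tmul_smul, TensorProduct.smul_tmul']
  simp only [h2]
  rw [Finset.sum_congr rfl fun j _ => Finset.sum_comm, Finset.sum_comm]
  refine Finset.sum_eq_zero fun c _ => ?_
  simp only [← TensorProduct.sum_tmul, h1, TensorProduct.zero_tmul]

theorem bracket_pointTensor (φ ψ : D.Cohomology →ₗ[ℝ] A) :
    bracket (φ.rTensor g (pointTensor T h x)) (ψ.rTensor g (pointTensor T h x)) =
      ∑ j, ∑ k, (φ (h.basis j) * ψ (h.basis k)) ⊗ₜ[ℝ]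
        ⁅component T x j, component T x k⁆ := by
  rw [rTensor_pointTensor, rTensor_pointTensor]
  simp only [map_sum, LinearMap.sum_apply, bracket_tmul_tmul]
  exact Finset.sum_comm

/-- The equation in `H ⊗ g` does not mention an embedding, so it may be transported by another
homomorphism `φ` than the one defining the set, such as a later member of a family. -/
theorem bracket_pointTensor_self (hι : D.IsEmbedding ι) (hhom : D.IsAlgHom ι)
    (hK : D.IsRelaxed ι K) (hx : x ∈ MC D T h ι) {φ : D.Cohomology →ₗ[ℝ] A}
    (hφ : D.IsAlgHom φ) :
    bracket (φ.rTensor g (pointTensor T h x)) (φ.rTensor g (pointTensor T h x)) = 0 := by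
  have h1 := congrArg (φ.rTensor g) (maurerCartan T h hι hhom hK hx)
  simp only [map_sum, map_zero, LinearMap.rTensor_tmul, hφ.map_hmul] at h1
  rw [bracket_pointTensor, h1]

/-- Applying `δφ` to the equation in `H ⊗ g` gives `l(δω, ω) + l(ω, δω) = 0`. The bracket is
symmetric in degree one, so this is twice a single term. -/
theorem bracket_pointTensor_variation (hι : D.IsEmbedding ι) (hhom : D.IsAlgHom ι)
    (hK : D.IsRelaxed ι K) (hx : x ∈ MC D T h ι) {φ δφ : D.Cohomology →ₗ[ℝ] A}
    (hφ : ∀ {n : ℕ} {y : D.Cohomology}, y ∈ D.cohomologyDeg n → φ y ∈ 𝒞 n)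
    (hδφ : ∀ {n : ℕ} {y : D.Cohomology}, y ∈ D.cohomologyDeg n → δφ y ∈ 𝒞 n)
    (hmul : ∀ y z, δφ (D.hmul y z) = δφ y * φ z + φ y * δφ z) :
    bracket (φ.rTensor g (pointTensor T h x)) (δφ.rTensor g (pointTensor T h x)) = 0 := by
  have h1 := congrArg (δφ.rTensor g) (maurerCartan T h hι hhom hK hx)
  simp only [map_sum, map_zero, LinearMap.rTensor_tmul, hmul, TensorProduct.add_tmul,
    Finset.sum_add_distrib] at h1
  rw [← bracket_pointTensor, ← bracket_pointTensor,
    D.bracket_comm (rTensor_pointTensor_mem T h hx hδφ) (rTensor_pointTensor_mem T h hx hφ)] at h1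
  rw [mul_one] at h1
  norm_num at h1
  rw [← two_smul ℝ] at h1
  exact (smul_eq_zero.1 h1).resolve_left two_ne_zero

end MaurerCartan

/-! ## Restriction of formal functions to lines -/

section Restrict

variable {X : Type*} [Fintype X] {gh : X → ℤ}

open Classical in
theorem coeff_restrictLine (f : SFun gh) (x : X → ℝ) (n : ℕ) :
    PowerSeries.coeff n (restrictLine f x) =
      ∑ μ ∈ (Finset.univ : Finset {x : X // Even (gh x)}).finsuppAntidiag n,
        ExteriorAlgebra.algebraMapInv (MvPowerSeries.coeff μ f) * ∏ i, x i.1 ^ μ i := by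
  rw [restrictLine, PowerSeries.coeff_mk]

theorem restrictLine_add (f f' : SFun gh) (x : X → ℝ) :
    restrictLine (f + f') x = restrictLine f x + restrictLine f' x := by
  ext n
  simp only [coeff_restrictLine, map_add, add_mul, Finset.sum_add_distrib]

theorem restrictLine_smul (c : ℝ) (f : SFun gh) (x : X → ℝ) :
    restrictLine (c • f) x = c • restrictLine f x := by
  ext n
  simp only [coeff_restrictLine, PowerSeries.coeff_smul, Finset.smul_sum]
  refine Finset.sum_congr rfl fun μ _ => ?_
  rw [← smul_mul_assoc]
  congr 1
  exact map_smul (ExteriorAlgebra.algebraMapInv (R := ℝ) (M := {x : X // ¬ Even (gh x)} → ℝ)) c _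

theorem restrictLine_one (x : X → ℝ) : restrictLine (1 : SFun gh) x = 1 := by
  classical
  ext n
  rw [coeff_restrictLine, PowerSeries.coeff_one]
  simp only [MvPowerSeries.coeff_one]
  rcases n with _ | n
  · simp
  · refine Finset.sum_eq_zero fun μ hμ => ?_
    rw [if_neg, map_zero, zero_mul]
    rintro rfl
    simp at hμ

/-- Both sides are sums over pairs of exponents: the pair determines its sum `μ` on one side and its
two total degrees on the other. -/
theorem restrictLine_mul (f f' : SFun gh) (x : X → ℝ) :
    restrictLine (f * f') x = restrictLine f x * restrictLine f' x := by
  classical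
  ext n
  rw [coeff_restrictLine, PowerSeries.coeff_mul]
  simp only [coeff_restrictLine, MvPowerSeries.coeff_mul, map_sum, map_mul, Finset.sum_mul_sum]
  simp only [← Finset.sum_product', Finset.sum_mul]
  rw [Finset.sum_sigma', Finset.sum_sigma']
  refine Finset.sum_nbij' (fun s => ⟨(∑ i, s.2.1 i, ∑ i, s.2.2 i), s.2⟩)
    (fun s => ⟨s.2.1 + s.2.2, s.2⟩) ?_ ?_ ?_ ?_ ?_
  · rintro ⟨μ, p, q⟩ hs
    simp only [Finset.mem_sigma, Finset.mem_finsuppAntidiag, Finset.HasAntidiagonal.mem_antidiagonal,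
      Finset.mem_product] at hs ⊢
    refine ⟨?_, ⟨trivial, Finset.subset_univ _⟩, trivial, Finset.subset_univ _⟩
    rw [← hs.1.1, ← hs.2, ← Finset.sum_add_distrib]
    rfl
  · rintro ⟨ab, p, q⟩ hs
    simp only [Finset.mem_sigma, Finset.mem_finsuppAntidiag, Finset.HasAntidiagonal.mem_antidiagonal,
      Finset.mem_product] at hs ⊢
    refine ⟨⟨?_, Finset.subset_univ _⟩, trivial⟩
    rw [← hs.1, ← hs.2.1.1, ← hs.2.2.1, ← Finset.sum_add_distrib]
    rfl
  · rintro ⟨μ, p, q⟩ hs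
    simp only [Finset.mem_sigma, Finset.HasAntidiagonal.mem_antidiagonal] at hs
    simp [hs.2]
  · rintro ⟨ab, p, q⟩ hs
    simp only [Finset.mem_sigma, Finset.mem_finsuppAntidiag, Finset.mem_product] at hs
    simp [hs.2.1.1, hs.2.2.1]
  · rintro ⟨μ, p, q⟩ hs
    simp only [Finset.mem_sigma, Finset.HasAntidiagonal.mem_antidiagonal] at hs
    simp only [← hs.2, Finsupp.add_apply, pow_add, Finset.prod_mul_distrib]
    ring

/-- The restriction to a line as a ring homomorphism. -/
def restrictHom (x : X → ℝ) : SFun gh →+* PowerSeries ℝ where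
  toFun f := restrictLine f x
  map_one' := restrictLine_one x
  map_mul' f f' := restrictLine_mul f f' x
  map_add' f f' := restrictLine_add f f' x
  map_zero' := by
    have := restrictLine_smul (0 : ℝ) (0 : SFun gh) x
    rwa [zero_smul, zero_smul] at this

theorem restrictHom_apply (f : SFun gh) (x : X → ℝ) : restrictHom x f = restrictLine f x := rfl

theorem restrictLine_coord {x : X → ℝ} (hx : ∀ z, ¬ Even (gh z) → x z = 0) (z : X) :
    restrictLine (coord gh z) x = x z • PowerSeries.X := by
  classical
  ext n
  rw [coeff_restrictLine, PowerSeries.coeff_smul, PowerSeries.coeff_X]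
  by_cases hz : Even (gh z)
  · rw [coord_even hz]
    simp only [MvPowerSeries.coeff_X]
    by_cases hn : n = 1
    · rw [Finset.sum_eq_single (Finsupp.single ⟨z, hz⟩ 1)]
      · rw [if_pos rfl, map_one, one_mul, if_pos hn, Finset.prod_eq_single ⟨z, hz⟩]
        · simp
        · intro b _ hb
          rw [Finsupp.single_eq_of_ne hb, pow_zero]
        · intro h; exact absurd (Finset.mem_univ _) h
      · intro μ _ hμ
        rw [if_neg hμ, map_zero, zero_mul]
      · intro h
        refine absurd (Finset.mem_finsuppAntidiag.2 ⟨?_, Finset.subset_univ _⟩) h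
        rw [hn]
        simp [Finsupp.single_apply]
    · rw [if_neg hn, smul_zero]
      refine Finset.sum_eq_zero fun μ hμ => ?_
      rw [if_neg, map_zero, zero_mul]
      rintro rfl
      rw [Finset.mem_finsuppAntidiag] at hμ
      refine hn ?_
      rw [← hμ.1]
      simp [Finsupp.single_apply]
  · rw [coord_odd hz, hx z hz, zero_smul]
    refine Finset.sum_eq_zero fun μ _ => ?_
    rw [MvPowerSeries.coeff_C]
    split_ifs
    · rw [ExteriorAlgebra.algebraMapInv, ExteriorAlgebra.lift_ι_apply]
      simp
    · rw [map_zero, zero_mul]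

/-- The coefficients of a function of degree `n` at the monomials of degree `j`. -/
def homogeneousCoeff (V : Type*) [AddCommGroup V] [Module ℝ V] (n j : ℕ) :
    Submodule ℝ (ExteriorAlgebra ℝ V) :=
  if j ≤ n then LinearMap.range (ExteriorAlgebra.ι ℝ : V →ₗ[ℝ] _) ^ (n - j) else ⊥

theorem homogeneousCoeff_mul {V : Type*} [AddCommGroup V] [Module ℝ V] {n j m k : ℕ}
    {a b : ExteriorAlgebra ℝ V} (ha : a ∈ homogeneousCoeff V n j)
    (hb : b ∈ homogeneousCoeff V m k) : a * b ∈ homogeneousCoeff V (n + m) (j + k) := by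
  rw [homogeneousCoeff] at *
  split_ifs at ha with hj
  · split_ifs at hb with hk
    · rw [if_pos (by omega), show n + m - (j + k) = n - j + (m - k) by omega, pow_add]
      exact Submodule.mul_mem_mul ha hb
    · rw [(Submodule.mem_bot ℝ).1 hb, mul_zero]
      exact zero_mem _
  · rw [(Submodule.mem_bot ℝ).1 ha, zero_mul]
    exact zero_mem _

/-- No exterior monomial is longer than the dimension. Hence a given monomial in the even
coordinates meets only finitely many homogeneous degrees, and the formal sums are locally finite. -/
theorem homogeneousCoeff_eq_bot {V : Type*} [AddCommGroup V] [Module ℝ V] [FiniteDimensional ℝ V]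
    {n j : ℕ} (h : Module.finrank ℝ V + j < n) : homogeneousCoeff V n j = ⊥ := by
  rw [homogeneousCoeff, if_pos (by omega)]
  have h1 : Module.finrank ℝ (⋀[ℝ]^(n - j) V) = 0 := by
    rw [exteriorPower.finrank_eq, Nat.choose_eq_zero_of_lt (by omega)]
  exact Submodule.finrank_eq_zero.1 h1

/-- The formal functions which are homogeneous of degree `n`. -/
def homogeneousPart (gh : X → ℤ) (n : ℕ) : Submodule ℝ (SFun gh) where
  carrier := {f | ∀ μ : {x : X // Even (gh x)} →₀ ℕ, MvPowerSeries.coeff μ f ∈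
    homogeneousCoeff ({x : X // ¬ Even (gh x)} → ℝ) n (∑ i, μ i)}
  add_mem' hf hf' μ := by
    rw [map_add]
    exact add_mem (hf μ) (hf' μ)
  zero_mem' μ := by
    rw [map_zero]
    exact zero_mem _
  smul_mem' c f hf μ := Submodule.smul_mem _ c (hf μ)

theorem homogeneousPart_mul {n m : ℕ} {f f' : SFun gh} (hf : f ∈ homogeneousPart gh n)
    (hf' : f' ∈ homogeneousPart gh m) : f * f' ∈ homogeneousPart gh (n + m) := by
  classical
  intro μ
  rw [MvPowerSeries.coeff_mul]
  refine Submodule.sum_mem _ fun p hp => ?_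
  have := homogeneousCoeff_mul (hf p.1) (hf' p.2)
  rwa [← Finset.sum_add_distrib, show ∑ i, (p.1 i + p.2 i) = ∑ i, μ i by
    rw [← Finset.HasAntidiagonal.mem_antidiagonal.1 hp]; rfl] at this

theorem homogeneousPart_one : (1 : SFun gh) ∈ homogeneousPart gh 0 := by
  classical
  intro μ
  rw [MvPowerSeries.coeff_one]
  split_ifs with h
  · rw [h, homogeneousCoeff, if_pos (by simp)]
    simp
  · exact zero_mem _

theorem homogeneousPart_coord (z : X) : coord gh z ∈ homogeneousPart gh 1 := by
  classical
  intro μ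
  by_cases hz : Even (gh z)
  · rw [coord_even hz, MvPowerSeries.coeff_X]
    split_ifs with h
    · have : ∑ i, μ i = 1 := by rw [h]; simp [Finsupp.single_apply]
      rw [this, homogeneousCoeff, if_pos le_rfl]
      simp
    · exact zero_mem _
  · rw [coord_odd hz, MvPowerSeries.coeff_C]
    split_ifs with h
    · rw [h, homogeneousCoeff, if_pos (by simp)]
      simp
    · exact zero_mem _

theorem homogeneousPart_pow {R : Type*} [Fintype R] [DecidableEq R] {N : Matrix R R (SFun gh)}
    (hN : ∀ r s, N r s ∈ homogeneousPart gh 1) (n : ℕ) (r s : R) :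
    (N ^ n) r s ∈ homogeneousPart gh n := by
  induction n generalizing r s with
  | zero =>
    rw [pow_zero, Matrix.one_apply]
    split_ifs
    · exact homogeneousPart_one
    · exact zero_mem _
  | succ n ih =>
    rw [pow_succ, Matrix.mul_apply]
    exact Submodule.sum_mem _ fun k _ => homogeneousPart_mul (ih r k) (hN k s)

theorem coeff_restrictLine_formalSum {f : ℕ → SFun gh}
    (hf : ∀ k, f k ∈ homogeneousPart gh (k + 1)) (x : X → ℝ) (n : ℕ) :
    PowerSeries.coeff n (restrictLine (formalSum f) x) =
      ∑ k ∈ Finset.range (Fintype.card X + n), PowerSeries.coeff n (restrictLine (f k) x) := by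
  classical
  simp only [coeff_restrictLine]
  rw [Finset.sum_comm]
  refine Finset.sum_congr rfl fun μ hμ => ?_
  rw [← Finset.sum_mul, ← map_sum, coeff_formalSum]
  congr 2
  -- `f k` has degree `k + 1`, of which `n` comes from the even coordinates and at most `card X`
  -- from the odd ones; so every contributing `k` is below `card X + n`.
  refine finsum_eq_sum_of_support_subset _ fun k hk => ?_
  rw [Finset.coe_range, Set.mem_Iio]
  by_contra hle
  refine hk ?_
  have h1 := hf k μ
  rw [homogeneousCoeff_eq_bot] at h1
  · exact (Submodule.mem_bot ℝ).1 h1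
  · rw [(Finset.mem_finsuppAntidiag.1 hμ).1, Module.finrank_fintype_fun_eq_card]
    have := Fintype.card_subtype_le fun x : X => ¬ Even (gh x)
    omega

end Restrict

/-! ## The super-trace at a point -/

section PointTrace

theorem map_matrix_pow {R S Y : Type*} [Semiring R] [Semiring S] [Fintype Y] [DecidableEq Y]
    (f : R →+* S) (N : Matrix Y Y R) (n : ℕ) (r s : Y) : f ((N ^ n) r s) = (N.map f ^ n) r s := by
  have := map_pow f.mapMatrix N n
  exact congrFun (congrFun this r) s

variable {A : Type*} [Ring A] [Algebra ℝ A] {𝒞 : ℕ → Submodule ℝ A} [GradedAlgebra 𝒞]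
  {D : DGFrobenius 𝒞} {g : Type*} [LieRing g] [LieAlgebra ℝ g]
  {𝔞 J I : Type*} [Fintype 𝔞] [Fintype J] [Fintype I] (T : Module.Basis 𝔞 ℝ g)
  (h : HomogeneousBasis D.cohomologyDeg J) (ι : D.Cohomology →ₗ[ℝ] A) (K : A →ₗ[ℝ] A)
  (e : HomogeneousBasis 𝒞 I)

/-- The operator `K ∘ l(ι(α), •)` at a point `α`. -/
def pointOperator (x : J × 𝔞 → ℝ) : Module.End ℝ (A ⊗[ℝ] g) :=
  K.rTensor g * bracket (ι.rTensor g (pointTensor T h x))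

theorem pointOperator_eq (x : J × 𝔞 → ℝ) : pointOperator T h ι K x =
    ∑ j, (K ∘ₗ LinearMap.mulLeft ℝ (ι (h.basis j))).rTensor g ∘ₗ
      (LieAlgebra.ad ℝ g (component T x j)).lTensor A := by
  rw [pointOperator, rTensor_pointTensor, map_sum, Finset.mul_sum]
  refine Finset.sum_congr rfl fun j _ => TensorProduct.ext' fun a X => ?_
  simp

theorem toMatrix_pointOperator [DecidableEq (I × 𝔞)] (x : J × 𝔞 → ℝ) (r s : I × 𝔞) :
    LinearMap.toMatrix (e.basis.tensorProduct T) (e.basis.tensorProduct T)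
      (pointOperator T h ι K x) r s =
    ∑ y : J × 𝔞, x y * (e.basis.repr (K (ι (h.basis y.1) * e.basis s.1)) r.1 *
      T.repr ⁅T y.2, T s.2⁆ r.2) := by
  rw [LinearMap.toMatrix_apply, pointOperator_eq, LinearMap.sum_apply, map_sum,
    Finsupp.finsetSum_apply, Fintype.sum_prod_type]
  refine Finset.sum_congr rfl fun j _ => ?_
  rw [Module.Basis.tensorProduct_apply', LinearMap.comp_apply, LinearMap.lTensor_tmul,
    LinearMap.rTensor_tmul, Module.Basis.tensorProduct_repr_tmul_apply, LieAlgebra.ad_apply,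
    component, sum_lie, map_sum, Finsupp.finsetSum_apply, Finset.sum_smul]
  refine Finset.sum_congr rfl fun a _ => ?_
  rw [smul_lie, map_smul, Finsupp.smul_apply, smul_eq_mul, smul_eq_mul, LinearMap.comp_apply,
    LinearMap.mulLeft_apply]
  ring

theorem HomogeneousBasis.repr_signOp (a : A) (i : I) :
    e.basis.repr (signOp 𝒞 a) i = (-1 : ℝ) ^ e.deg i * e.basis.repr a i := by
  induction a using DirectSum.Decomposition.inductionOn 𝒞 with
  | zero => simp
  | homogeneous a =>
    rw [signOp_of_mem 𝒞 a.2, map_smul, Finsupp.smul_apply, smul_eq_mul]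
    by_cases h0 : e.basis.repr (a : A) i = 0
    · rw [h0, mul_zero, mul_zero]
    · rw [e.deg_eq a.2 h0]
  | add a a' ha ha' => rw [map_add, map_add, map_add, Finsupp.add_apply, Finsupp.add_apply, ha, ha',
      mul_add]

theorem repr_rTensor_signOp (v : A ⊗[ℝ] g) (r : I × 𝔞) :
    (e.basis.tensorProduct T).repr ((signOp 𝒞).rTensor g v) r =
      (-1 : ℝ) ^ e.deg r.1 * (e.basis.tensorProduct T).repr v r := by
  induction v using TensorProduct.induction_on with
  | zero => simp
  | tmul a X =>
    rw [LinearMap.rTensor_tmul, Module.Basis.tensorProduct_repr_tmul_apply,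
      Module.Basis.tensorProduct_repr_tmul_apply, e.repr_signOp, smul_eq_mul, smul_eq_mul]
    ring
  | add v w hv hw => rw [map_add, map_add, map_add, Finsupp.add_apply, Finsupp.add_apply, hv, hw,
      mul_add]

variable [FiniteDimensional ℝ A] [FiniteDimensional ℝ g]

theorem traceHom_signOp [DecidableEq (I × 𝔞)] (F : Module.End ℝ (A ⊗[ℝ] g)) :
    traceHom A g ((signOp 𝒞).rTensor g * F) = ∑ r : I × 𝔞, (-1 : ℝ) ^ e.deg r.1 *
      LinearMap.toMatrix (e.basis.tensorProduct T) (e.basis.tensorProduct T) F r r := by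
  change LinearMap.trace ℝ _ _ = _
  rw [LinearMap.trace_eq_matrix_trace ℝ (e.basis.tensorProduct T), Matrix.trace]
  refine Finset.sum_congr rfl fun r _ => ?_
  rw [Matrix.diag_apply, LinearMap.toMatrix_apply, LinearMap.toMatrix_apply, Module.End.mul_apply,
    repr_rTensor_signOp]

/-- The super-trace of the powers of `K ∘ l(ι(α), •)`. -/
def pointTrace (x : J × 𝔞 → ℝ) (n : ℕ) : ℝ :=
  traceHom A g ((signOp 𝒞).rTensor g * pointOperator T h ι K x ^ n)

/-- Only coordinates of degree one survive on the line. Their sign exponent is even, and each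
contributes one factor of the parameter. -/
theorem map_superMatrix [DecidableEq (I × 𝔞)] {x : J × 𝔞 → ℝ}
    (hx : ∀ p a, h.deg p ≠ 1 → x (p, a) = 0) :
    (superMatrix D T h ι K e).map (restrictHom x) = (PowerSeries.X : PowerSeries ℝ) •
      (LinearMap.toMatrix (e.basis.tensorProduct T) (e.basis.tensorProduct T)
        (pointOperator T h ι K x)).map (PowerSeries.C (R := ℝ)) := by
  refine Matrix.ext fun r s => ?_
  rw [Matrix.map_apply, Matrix.smul_apply, Matrix.map_apply, toMatrix_pointOperator, superMatrix,
    Matrix.of_apply, map_sum, map_sum, Finset.smul_sum]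
  refine Finset.sum_congr rfl fun y _ => ?_
  have hx' : ∀ z : J × 𝔞, ¬ Even (ghost (degH D h 𝔞) z) → x z = 0 := fun z hz =>
    hx z.1 z.2 fun hd => hz (by rw [ghost, degH, hd]; decide)
  rw [restrictHom_apply, restrictLine_smul, restrictLine_coord hx', smul_smul, smul_eq_mul,
    mul_comm PowerSeries.X, ← PowerSeries.smul_eq_C_mul]
  by_cases hd : h.deg y.1 = 1
  · congr 1
    rw [hd, pow_mul]
    norm_num
    ring
  · rw [hx y.1 y.2 hd, mul_zero, zero_mul]

theorem restrictLine_superTrace [DecidableEq (I × 𝔞)] {x : J × 𝔞 → ℝ}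
    (hx : ∀ p a, h.deg p ≠ 1 → x (p, a) = 0) (n : ℕ) :
    restrictLine (superTrace D h e (superMatrix D T h ι K e ^ n)) x =
      pointTrace T h ι K x n • (PowerSeries.X : PowerSeries ℝ) ^ n := by
  rw [pointTrace, traceHom_signOp T e, ← LinearMap.toMatrix_pow, superTrace, ← restrictHom_apply,
    map_sum, Finset.sum_smul]
  refine Finset.sum_congr rfl fun r _ => ?_
  rw [restrictHom_apply, restrictLine_smul, ← restrictHom_apply, map_matrix_pow,
    map_superMatrix T h ι K e hx,
    smul_pow, Matrix.smul_apply, mul_smul]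
  congr 1
  rw [smul_eq_mul, mul_comm, PowerSeries.smul_eq_C_mul]
  rw [map_matrix_pow]

theorem superMatrix_mem (r s : I × 𝔞) :
    superMatrix D T h ι K e r s ∈ homogeneousPart (ghost (degH D h 𝔞)) 1 :=
  Submodule.sum_mem _ fun y _ => Submodule.smul_mem _ _ (homogeneousPart_coord y)

theorem superTrace_mem [DecidableEq (I × 𝔞)] (n : ℕ) :
    superTrace D h e (superMatrix D T h ι K e ^ n) ∈ homogeneousPart (ghost (degH D h 𝔞)) n :=
  Submodule.sum_mem _ fun r _ => Submodule.smul_mem _ _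
    (homogeneousPart_pow (superMatrix_mem T h ι K e) n r r)

/-- Reduces every assertion about the restricted one-loop term to the numbers `pointTrace`. -/
theorem coeff_restrictLine_halfStrLog {x : J × 𝔞 → ℝ}
    (hx : ∀ p a, h.deg p ≠ 1 → x (p, a) = 0) (n : ℕ) :
    PowerSeries.coeff n (restrictLine (halfStrLog D T h ι K e) x) =
      (1 / 2 : ℝ) * ∑ k ∈ Finset.range (Fintype.card (J × 𝔞) + n), (-1 : ℝ) ^ k / ((k : ℝ) + 1) *
        (pointTrace T h ι K x (k + 1) * if n = k + 1 then 1 else 0) := by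
  classical
  have hmem : ∀ k : ℕ, ((-1 : ℝ) ^ k / ((k : ℝ) + 1)) •
      superTrace D h e (superMatrix D T h ι K e ^ (k + 1)) ∈
        homogeneousPart (ghost (degH D h 𝔞)) (k + 1) :=
    fun k => Submodule.smul_mem _ _ (superTrace_mem T h ι K e (k + 1))
  rw [halfStrLog, restrictLine_smul, PowerSeries.coeff_smul, smul_eq_mul]
  refine congrArg _ ((coeff_restrictLine_formalSum hmem x n).trans ?_)
  refine Finset.sum_congr rfl fun k _ => ?_
  rw [restrictLine_smul, restrictLine_superTrace T h ι K e hx, PowerSeries.coeff_smul,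
    PowerSeries.coeff_smul, PowerSeries.coeff_X_pow, smul_eq_mul, smul_eq_mul]

end PointTrace

/-! ## Weak derivatives of curves in real vector spaces -/

section WeakDeriv

/-- The curve `f` has derivative `f'` at `s` within `S`, tested against linear functionals. -/
def HasWeakDerivWithinAt {E : Type*} [AddCommMonoid E] [Module ℝ E] (f : ℝ → E) (f' : E) (S : Set ℝ) (s : ℝ) : Prop :=
  ∀ ψ : Module.Dual ℝ E, HasDerivWithinAt (fun t => ψ (f t)) (ψ f') S s

namespace HasWeakDerivWithinAt

theorem map {E F : Type*} [AddCommMonoid E] [Module ℝ E] [AddCommMonoid F] [Module ℝ F]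
    {f : ℝ → E} {f' : E} {S : Set ℝ} {s : ℝ} (hf : HasWeakDerivWithinAt f f' S s)
    (L : E →ₗ[ℝ] F) : HasWeakDerivWithinAt (fun t => L (f t)) (L f') S s := fun ψ => hf (ψ ∘ₗ L)

variable {E F G : Type*} [AddCommGroup E] [Module ℝ E] [AddCommGroup F] [Module ℝ F]
  [AddCommMonoid G] [Module ℝ G] {f f₁ : ℝ → E} {f' f₁' : E} {k : ℝ → F} {k' : F} {S : Set ℝ}
  {s : ℝ}

theorem add (hf : HasWeakDerivWithinAt f f' S s) (hf₁ : HasWeakDerivWithinAt f₁ f₁' S s) :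
    HasWeakDerivWithinAt (fun t => f t + f₁ t) (f' + f₁') S s := fun ψ => by
  simp only [map_add]
  exact (hf ψ).add (hf₁ ψ)

theorem const (c : E) : HasWeakDerivWithinAt (fun _ => c) 0 S s := fun ψ => by
  rw [map_zero]
  exact hasDerivWithinAt_const _ _ _

theorem unique (hf : HasWeakDerivWithinAt f f' S s) (hf₁ : HasWeakDerivWithinAt f₁ f₁' S s)
    (h : ∀ t ∈ S, f t = f₁ t) (hs : s ∈ S) (hS : UniqueDiffWithinAt ℝ S s) : f' = f₁' := by
  rw [← sub_eq_zero, ← Module.forall_dual_apply_eq_zero_iff ℝ]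
  intro ψ
  rw [map_sub, sub_eq_zero]
  exact hS.eq_deriv S (hf ψ) ((hf₁ ψ).congr (fun t ht => by rw [h t ht]) (by rw [h s hs]))

/-- The curve is zero in the quotient by `W`, hence so is its derivative. -/
theorem mem (hf : HasWeakDerivWithinAt f f' S s) {W : Submodule ℝ E} (h : ∀ t ∈ S, f t ∈ W)
    (hs : s ∈ S) (hS : UniqueDiffWithinAt ℝ S s) : f' ∈ W := by
  rw [← Submodule.Quotient.mk_eq_zero]
  exact (hf.map W.mkQ).unique (const 0) (fun t ht => (Submodule.Quotient.mk_eq_zero W).2 (h t ht))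
    hs hS

theorem bilin [FiniteDimensional ℝ E] [FiniteDimensional ℝ F] (B : E →ₗ[ℝ] F →ₗ[ℝ] G)
    (hf : HasWeakDerivWithinAt f f' S s) (hk : HasWeakDerivWithinAt k k' S s) :
    HasWeakDerivWithinAt (fun t => B (f t) (k t)) (B f' (k s) + B (f s) k') S s := by
  intro ψ
  have hB : ∀ v w, ψ (B v w) = ∑ i, ∑ j, (Module.finBasis ℝ E).coord i v *
      (Module.finBasis ℝ F).coord j w *
        ψ (B (Module.finBasis ℝ E i) (Module.finBasis ℝ F j)) := by
    intro v w
    conv_lhs => rw [← (Module.finBasis ℝ E).sum_repr v, ← (Module.finBasis ℝ F).sum_repr w]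
    simp only [map_sum, map_smul, LinearMap.sum_apply, LinearMap.smul_apply, Finset.smul_sum,
      smul_eq_mul, Module.Basis.coord_apply]
    rw [Finset.sum_comm]
    exact Finset.sum_congr rfl fun i _ => Finset.sum_congr rfl fun j _ => by ring
  rw [map_add, funext fun t => hB (f t) (k t), hB f' (k s), hB (f s) k', ← Finset.sum_add_distrib]
  simp only [← Finset.sum_add_distrib, ← add_mul]
  exact HasDerivWithinAt.fun_sum fun i _ => HasDerivWithinAt.fun_sum fun j _ =>
    ((hf _).mul (hk _)).mul_const _

theorem linearMap [FiniteDimensional ℝ E] {Φ : ℝ → E →ₗ[ℝ] F} {Φ' : E →ₗ[ℝ] F}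
    (h : ∀ a, HasWeakDerivWithinAt (fun t => Φ t a) (Φ' a) S s) :
    HasWeakDerivWithinAt Φ Φ' S s := by
  intro ψ
  have hΦ : ∀ φ : E →ₗ[ℝ] F, ψ φ = ∑ i, (ψ ∘ₗ LinearMap.smulRightₗ
      ((Module.finBasis ℝ E).coord i)) (φ (Module.finBasis ℝ E i)) := by
    intro φ
    simp only [LinearMap.comp_apply, ← map_sum]
    congr 1
    refine (Module.finBasis ℝ E).ext fun j => ?_
    simp [LinearMap.sum_apply, Finsupp.single_apply]
  simp only [hΦ]
  exact HasDerivWithinAt.fun_sum fun i _ => h _ _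

/-- The derivative at each vector is assembled in a basis of `F`; it depends linearly on the vector
by uniqueness of derivatives. -/
theorem exists_linearMap [FiniteDimensional ℝ F] {Φ : ℝ → E →ₗ[ℝ] F}
    (h : ∀ (ψ : Module.Dual ℝ F) (a : E), DifferentiableWithinAt ℝ (fun t => ψ (Φ t a)) S s)
    (hs : s ∈ S) (hS : UniqueDiffWithinAt ℝ S s) :
    ∃ Φ' : E →ₗ[ℝ] F, ∀ a, HasWeakDerivWithinAt (fun t => Φ t a) (Φ' a) S s := by
  have h1 : ∀ a, ∃ v : F, HasWeakDerivWithinAt (fun t => Φ t a) v S s := by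
    intro a
    refine ⟨∑ i, derivWithin (fun t => (Module.finBasis ℝ F).coord i (Φ t a)) S s •
      Module.finBasis ℝ F i, fun ψ => ?_⟩
    have hψ : ∀ v, ψ v = ∑ i, (Module.finBasis ℝ F).coord i v * ψ (Module.finBasis ℝ F i) := by
      intro v
      conv_lhs => rw [← (Module.finBasis ℝ F).sum_repr v, map_sum]
      simp only [map_smul, smul_eq_mul, Module.Basis.coord_apply]
    simp only [map_sum, map_smul, smul_eq_mul]
    simp only [hψ (Φ _ a)]
    exact HasDerivWithinAt.fun_sum fun i _ => ((h _ a).hasDerivWithinAt).mul_const _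
  choose v hv using h1
  refine ⟨⟨⟨v, fun a b => ?_⟩, fun c a => ?_⟩, hv⟩
  · exact (hv (a + b)).unique ((hv a).add (hv b)) (fun t _ => map_add _ _ _) hs hS
  · exact (hv (c • a)).unique ((hv a).map (LinearMap.lsmul ℝ F c)) (fun t _ => map_smul _ _ _) hs hS

/-- The derivative of the super-trace of a power vanishes if the derivative of the operator has
vanishing super-trace against its powers. -/
theorem trace_pow {R : Type*} [Ring R] [Algebra ℝ R] [FiniteDimensional ℝ R] {N : ℝ → R} {N' : R}
    (hN : HasWeakDerivWithinAt N N' S s) {τ : R →ₗ[ℝ] ℝ} (hτ : ∀ a b, τ (a * b) = τ (b * a))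
    {Γ : R} (hΓ : ∀ m, Γ * N s ^ m = N s ^ m * Γ) (h0 : ∀ m, τ (Γ * (N' * N s ^ m)) = 0) (n : ℕ) :
    HasDerivWithinAt (fun t => τ (Γ * N t ^ n)) 0 S s := by
  -- The induction needs the vanishing of the super-trace of the derivative of `N ^ n` against all
  -- powers of `N s`, not only against `1`.
  have h1 : ∃ p : R, HasWeakDerivWithinAt (fun t => N t ^ n) p S s ∧
      ∀ m, τ (Γ * (p * N s ^ m)) = 0 := by
    induction n with
    | zero => exact ⟨0, by simpa using const (1 : R), by simp⟩
    | succ n ih =>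
      obtain ⟨p, hp, hp'⟩ := ih
      refine ⟨p * N s + N s ^ n * N', ?_, fun m => ?_⟩
      · simp only [pow_succ]
        exact hp.bilin (LinearMap.mul ℝ R) hN
      · have h2 : τ (Γ * (N s ^ n * N' * N s ^ m)) = 0 := by
          have h3 : Γ * (N s ^ n * N' * N s ^ m) = N s ^ n * (Γ * (N' * N s ^ m)) := by
            rw [← mul_assoc, ← mul_assoc, hΓ]
            simp only [mul_assoc]
          rw [h3, hτ, mul_assoc, mul_assoc, ← pow_add, h0]
        rw [add_mul, mul_add, map_add, h2, add_zero, mul_assoc p, ← pow_succ', hp']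
  obtain ⟨p, hp, hp'⟩ := h1
  have h2 := hp (τ ∘ₗ LinearMap.mulLeft ℝ Γ)
  have h3 := hp' 0
  rw [pow_zero, mul_one] at h3
  simp only [LinearMap.comp_apply, LinearMap.mulLeft_apply, h3] at h2
  exact h2

end HasWeakDerivWithinAt

end WeakDeriv

/-! ## Invariance of the one-loop term on the Maurer--Cartan set -/

section Invariance

variable {A : Type*} [Ring A] [Algebra ℝ A] [FiniteDimensional ℝ A] {𝒞 : ℕ → Submodule ℝ A}
  [GradedAlgebra 𝒞] {D : DGFrobenius 𝒞} {g : Type*} [LieRing g] [LieAlgebra ℝ g]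
  [FiniteDimensional ℝ g] {κ : LinearMap.BilinForm ℝ g}
  {𝔞 J I : Type*} [Fintype 𝔞] [Fintype J] [Fintype I] (T : Module.Basis 𝔞 ℝ g)
  (h : HomogeneousBasis D.cohomologyDeg J) {ι : D.Cohomology →ₗ[ℝ] A} {K : A →ₗ[ℝ] A}
  {x : J × 𝔞 → ℝ} {S : Set ℝ} {s : ℝ} {ιs : ℝ → D.Cohomology →ₗ[ℝ] A} {Ks : ℝ → A →ₗ[ℝ] A}

theorem hasWeakDerivWithinAt_pointOperator {δι : D.Cohomology →ₗ[ℝ] A} {δK : A →ₗ[ℝ] A}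
    (hι' : ∀ y, HasWeakDerivWithinAt (fun t => ιs t y) (δι y) S s)
    (hK' : ∀ a, HasWeakDerivWithinAt (fun t => Ks t a) (δK a) S s) :
    HasWeakDerivWithinAt (fun t => pointOperator T h (ιs t) (Ks t) x)
      (δK.rTensor g * bracket ((ιs s).rTensor g (pointTensor T h x)) +
        (Ks s).rTensor g * bracket (δι.rTensor g (pointTensor T h x))) S s := by
  have h1 := (HasWeakDerivWithinAt.linearMap hK').map (LinearMap.rTensorHom g)
  have h2 := (HasWeakDerivWithinAt.linearMap hι').map
    (bracket ∘ₗ LinearMap.applyₗ (pointTensor T h x) ∘ₗ LinearMap.rTensorHom g)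
  exact HasWeakDerivWithinAt.bilin (E := Module.End ℝ (A ⊗[ℝ] g)) (F := Module.End ℝ (A ⊗[ℝ] g))
    (LinearMap.mul ℝ (Module.End ℝ (A ⊗[ℝ] g))) h1 h2

/-- The data with index `0` define the Maurer-Cartan set. The moving data are required only at `s`,
so the lemma also covers paths that are admissible merely to first order. -/
theorem hasDerivWithinAt_pointTrace (hκ : IsQuadraticForm κ) {ι₀ : D.Cohomology →ₗ[ℝ] A}
    {K₀ : A →ₗ[ℝ] A} (hι₀ : D.IsEmbedding ι₀) (hhom₀ : D.IsAlgHom ι₀) (hK₀ : D.IsRelaxed ι₀ K₀)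
    (hx : x ∈ MC D T h ι₀) (hι : D.IsEmbedding (ιs s)) (hhom : D.IsAlgHom (ιs s))
    (hK : D.IsRelaxed (ιs s) (Ks s)) {δι : D.Cohomology →ₗ[ℝ] A} {δK : A →ₗ[ℝ] A}
    (hδ : D.IsVariation hK δι δK)
    (hι' : ∀ y, HasWeakDerivWithinAt (fun t => ιs t y) (δι y) S s)
    (hK' : ∀ a, HasWeakDerivWithinAt (fun t => Ks t a) (δK a) S s) (n : ℕ) :
    HasDerivWithinAt (fun t => pointTrace T h (ιs t) (Ks t) x n) 0 S s := by
  have hω := rTensor_pointTensor_mem T h hx hι.mem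
  have hMC := bracket_pointTensor_self T h hι₀ hhom₀ hK₀ hx hhom
  have hδω := rTensor_pointTensor_mem T h hx hδ.embedding_mem
  have hδMC := bracket_pointTensor_variation T h hι₀ hhom₀ hK₀ hx hι.mem hδ.embedding_mem
    hδ.map_hmul
  exact HasWeakDerivWithinAt.trace_pow (R := Module.End ℝ (A ⊗[ℝ] g))
    (N := fun t => pointOperator T h (ιs t) (Ks t) x)
    (hasWeakDerivWithinAt_pointOperator T h hι' hK')
    (τ := LinearMap.trace ℝ (A ⊗[ℝ] g)) traceHom_comm (Γ := (signOp 𝒞).rTensor g)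
    (isTwistedRetract hι hhom hK _ hω hMC).Γ_pow
    (hδ.trace_eq_zero hκ hι hhom hω hMC hδω hδMC) n

/-- The derivative of a family of relaxed induction data is a variation. -/
theorem isVariation_of_hasWeakDerivWithinAt
    (hdata : ∀ t ∈ S, D.IsEmbedding (ιs t) ∧ D.IsAlgHom (ιs t) ∧ D.IsRelaxed (ιs t) (Ks t))
    (hs : s ∈ S) (hS : UniqueDiffWithinAt ℝ S s) {δι : D.Cohomology →ₗ[ℝ] A} {δK : A →ₗ[ℝ] A}
    (hι' : ∀ y, HasWeakDerivWithinAt (fun t => ιs t y) (δι y) S s)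
    (hK' : ∀ a, HasWeakDerivWithinAt (fun t => Ks t a) (δK a) S s) :
    D.IsVariation (hdata s hs).2.2 δι δK where
  embedding_mem hy := (hι' _).mem (fun t ht => (hdata t ht).1.mem hy) hs hS
  represents y := by
    obtain ⟨a, rfl⟩ := D.cls_surjective y
    have h1 := (hι' (D.cls a)).add (HasWeakDerivWithinAt.const (-(a : A)))
    rw [add_zero] at h1
    refine h1.mem (fun t ht => ?_) hs hS
    rw [← sub_eq_add_neg]
    exact (hdata t ht).1.represents a
  map_hmul y z := (hι' (D.hmul y z)).unique ((hι' y).bilin (LinearMap.mul ℝ A) (hι' z))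
    (fun t ht => (hdata t ht).2.1.map_hmul y z) hs hS
  homotopy a := by
    have hKK : ∀ {f : ℝ → A} {f' : A}, HasWeakDerivWithinAt f f' S s →
        HasWeakDerivWithinAt (fun t => Ks t (f t)) (δK (f s) + Ks s f') S s := fun hf =>
      (HasWeakDerivWithinAt.linearMap hK').bilin LinearMap.id hf
    have h1 := (hKK (hK' a)).map D.d
    have h2 := hKK ((hK' a).map D.d)
    -- The relation `(d K + K d) K = K` does not contain the transpose, so it can be differentiated
    -- directly. Subtracting the homotopy relation at `δK a` leaves the required identity.
    have h3 := (h1.add h2).unique (hK' a) (fun t ht => by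
      have h4 := (hdata t ht).2.2.homotopy_eq (Ks t a)
      rwa [(hdata t ht).2.2.transpose_eq_zero (hdata t ht).1 ((hdata t ht).2.2.K_mem a),
        sub_zero] at h4) hs hS
    have h4 := (hdata s hs).2.2.homotopy_eq (δK a)
    rw [map_add] at h3
    rw [eq_sub_iff_add_eq] at h4
    have h5 := h3.trans h4.symm
    have h6 : D.d (δK (Ks s a)) + δK (D.d (Ks s a)) + (D.d (Ks s (δK a)) + Ks s (D.d (δK a))) =
        ιs s ((hdata s hs).2.2.transpose (δK a)) +
          (D.d (Ks s (δK a)) + Ks s (D.d (δK a))) := by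
      rw [add_comm (ιs s _), ← h5]
      abel
    exact (add_right_cancel h6).symm

theorem pointTrace_eq_of_family (hκ : IsQuadraticForm κ)
    (hdata : ∀ t ∈ Set.Icc (0 : ℝ) 1,
      D.IsEmbedding (ιs t) ∧ D.IsAlgHom (ιs t) ∧ D.IsRelaxed (ιs t) (Ks t))
    (hι' : ∀ (ψ : Module.Dual ℝ A) (y : D.Cohomology),
      DifferentiableOn ℝ (fun t => ψ (ιs t y)) (Set.Icc 0 1))
    (hK' : ∀ (ψ : Module.Dual ℝ A) (a : A),
      DifferentiableOn ℝ (fun t => ψ (Ks t a)) (Set.Icc 0 1))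
    (hx : x ∈ MC D T h (ιs 0)) (n : ℕ) :
    pointTrace T h (ιs 1) (Ks 1) x n = pointTrace T h (ιs 0) (Ks 0) x n := by
  obtain ⟨hι₀, hhom₀, hK₀⟩ := hdata 0 (by simp)
  have hderiv : ∀ t ∈ Set.Icc (0 : ℝ) 1,
      HasDerivWithinAt (fun t => pointTrace T h (ιs t) (Ks t) x n) 0 (Set.Icc 0 1) t := by
    intro t ht
    have hS := uniqueDiffOn_Icc (zero_lt_one (α := ℝ)) t ht
    obtain ⟨δι, hδι⟩ := HasWeakDerivWithinAt.exists_linearMap (fun ψ y => hι' ψ y t ht) ht hS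
    obtain ⟨δK, hδK⟩ := HasWeakDerivWithinAt.exists_linearMap (fun ψ y => hK' ψ y t ht) ht hS
    exact hasDerivWithinAt_pointTrace T h hκ hι₀ hhom₀ hK₀ hx (hdata t ht).1 (hdata t ht).2.1
      (hdata t ht).2.2 (isVariation_of_hasWeakDerivWithinAt hdata ht hS hδι hδK) hδι hδK n
  exact constant_of_derivWithin_zero (fun t ht => (hderiv t ht).differentiableWithinAt)
    (fun t ht => (hderiv t (Set.Ico_subset_Icc_self ht)).derivWithin
      (uniqueDiffOn_Icc zero_lt_one t (Set.Ico_subset_Icc_self ht))) 1 (by simp)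

/-- The conditions on a relaxed homotopy for fixed `ι` are affine, so the segment from `K` to `K'`
consists of relaxed homotopies. The quadratic condition `K² = 0` need not persist along it, even
between strict ones. -/
theorem pointTrace_eq_of_relaxed (hκ : IsQuadraticForm κ) (hι : D.IsEmbedding ι)
    (hhom : D.IsAlgHom ι) (hK : D.IsRelaxed ι K) {K' : A →ₗ[ℝ] A} (hK' : D.IsRelaxed ι K')
    (hx : x ∈ MC D T h ι) (n : ℕ) : pointTrace T h ι K' x n = pointTrace T h ι K x n := by
  have hlin : ∀ t : ℝ, D.IsRelaxed ι (K + t • (K' - K)) := by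
    intro t
    refine ⟨fun ha => ?_, fun ha => ?_, ⟨hK.transpose, hK.pair_transpose, fun a => ?_⟩,
      fun b ha => ?_, fun y => ?_⟩
    · exact add_mem (hK.mem ha) (Submodule.smul_mem _ _ (sub_mem (hK'.mem ha) (hK.mem ha)))
    · simp [hK.mem_zero ha, hK'.mem_zero ha]
    · have h1 := hK.homotopy_eq a
      have h2 := hK'.homotopy_eq a
      rw [hK.transpose_unique hι (hK'.pair_transpose a), ← h1] at h2
      rw [← h1]
      simp only [LinearMap.add_apply, LinearMap.smul_apply, LinearMap.sub_apply, map_add, map_smul,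
        map_sub]
      have h3 : t • (D.d (K' a) - D.d (K a)) + t • (K' (D.d a) - K (D.d a)) = 0 := by
        rw [← smul_add, sub_add_sub_comm, h2, sub_self, smul_zero]
      rw [add_add_add_comm, h3, add_zero]
    · simp only [LinearMap.add_apply, LinearMap.smul_apply, LinearMap.sub_apply, map_add, map_smul,
        map_sub, hK.symm b ha, hK'.symm b ha, smul_eq_mul]
      ring
    · simp [hK.comp_embedding, hK'.comp_embedding]
  have h1 := pointTrace_eq_of_family T h (ιs := fun _ => ι) (Ks := fun t => K + t • (K' - K)) hκ
    (fun t _ => ⟨hι, hhom, hlin t⟩) (fun ψ y => differentiableOn_const _) (fun ψ a => by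
      simp only [LinearMap.add_apply, LinearMap.smul_apply, map_add, map_smul, smul_eq_mul]
      fun_prop) hx n
  simpa using h1

/-- The straight line in direction `(δι, δK)` is known to be admissible only at `ε = 0`, which
suffices for `hasDerivWithinAt_pointTrace`. -/
theorem hasDerivAt_pointTrace (hκ : IsQuadraticForm κ) (hι : D.IsEmbedding ι)
    (hhom : D.IsAlgHom ι) (hK : D.IsRelaxed ι K) (hx : x ∈ MC D T h ι)
    {δι : D.Cohomology →ₗ[ℝ] A} {δK : A →ₗ[ℝ] A}
    (hδ : D.IsInfinitesimalDeformation ι K δι δK) (n : ℕ) :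
    HasDerivAt (fun ε : ℝ => pointTrace T h (ι + ε • δι) (K + ε • δK) x n) 0 0 := by
  have hline : ∀ {E : Type _} [AddCommGroup E] [Module ℝ E] (a b : E),
      HasWeakDerivWithinAt (fun ε : ℝ => a + ε • b) b Set.univ 0 := by
    intro E _ _ a b ψ
    simp only [map_add, map_smul, smul_eq_mul]
    simpa using (((hasDerivWithinAt_id (0 : ℝ) Set.univ).mul_const (ψ b)).const_add (ψ a))
  have hι0 : ι + (0 : ℝ) • δι = ι := by rw [zero_smul, add_zero]
  have hK0 : K + (0 : ℝ) • δK = K := by rw [zero_smul, add_zero]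
  have hKr : D.IsRelaxed (ι + (0 : ℝ) • δι) (K + (0 : ℝ) • δK) := by rw [hι0, hK0]; exact hK
  have hι1 : D.IsEmbedding (ι + (0 : ℝ) • δι) := by rw [hι0]; exact hι
  have hδ1 : D.IsInfinitesimalDeformation (ι + (0 : ℝ) • δι) (K + (0 : ℝ) • δK) δι δK := by
    rw [hι0, hK0]; exact hδ
  rw [← hasDerivWithinAt_univ]
  exact hasDerivWithinAt_pointTrace T h (ιs := fun ε => ι + ε • δι) (Ks := fun ε => K + ε • δK)
    hκ hι hhom hK hx hι1 (by rw [hι0]; exact hhom) hKr (hδ1.isVariation hι1 hKr)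
    (fun y => hline _ _) (fun a => hline _ _) n

end Invariance

end AbstractCS

end

theorem proposition10 {A : Type*} [Ring A] [Algebra ℝ A] [FiniteDimensional ℝ A]
    (𝒞 : ℕ → Submodule ℝ A) [GradedAlgebra 𝒞] (D : DGFrobenius 𝒞)
    (hB₀ : Module.finrank ℝ (D.cohomologyDeg 0) = 1)
    {g : Type*} [LieRing g] [LieAlgebra ℝ g] [FiniteDimensional ℝ g]
    (κ : LinearMap.BilinForm ℝ g) (hκ : IsQuadraticForm κ)
    (ι : D.Cohomology →ₗ[ℝ] A) (hι : D.IsEmbedding ι) (hιhom : D.IsAlgHom ι)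
    (K : A →ₗ[ℝ] A) (hK : D.IsRelaxed ι K)
    {𝔞 J M I : Type*} [Fintype 𝔞] [Fintype J] [Fintype M] [Fintype I]
    (T : Module.Basis 𝔞 ℝ g) (h : HomogeneousBasis D.cohomologyDeg J)
    (u : HomogeneousBasis (D.complementDeg ι) M) (e : HomogeneousBasis 𝒞 I) :
    -- the form of the relaxed effective action
    (∀ l < 0, effectiveAction D κ T h ι K u l = 0) ∧
    effectiveAction D κ T h ι K u 0 = Wprod D κ T h ι ∧
    effectiveAction D κ T h ι K u 1 = halfStrLog D T h ι K e ∧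
    -- the restriction to the Maurer-Cartan set agrees with the strict one
    D.IsStrict ι (K ∘ₗ D.d ∘ₗ K) ∧
    (∀ K' : A →ₗ[ℝ] A, D.IsStrict ι K' → ∀ x ∈ MC D T h ι,
      restrictLine (effectiveAction D κ T h ι K u 1) x =
        restrictLine (effectiveAction D κ T h ι K' u 1) x) ∧
    -- invariance along differentiable families of relaxed data
    (∀ (ιs : ℝ → D.Cohomology →ₗ[ℝ] A) (Ks : ℝ → A →ₗ[ℝ] A), ιs 0 = ι → Ks 0 = K →
      (∀ s ∈ Set.Icc (0 : ℝ) 1,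
        D.IsEmbedding (ιs s) ∧ D.IsAlgHom (ιs s) ∧ D.IsRelaxed (ιs s) (Ks s)) →
      (∀ (ψ : Module.Dual ℝ A) (y : D.Cohomology),
        DifferentiableOn ℝ (fun s => ψ (ιs s y)) (Set.Icc 0 1)) →
      (∀ (ψ : Module.Dual ℝ A) (a : A),
        DifferentiableOn ℝ (fun s => ψ (Ks s a)) (Set.Icc 0 1)) →
      ∀ u₁ : HomogeneousBasis (D.complementDeg (ιs 1)) M, ∀ x ∈ MC D T h ι,
        restrictLine (effectiveAction D κ T h (ιs 1) (Ks 1) u₁ 1) x =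
          restrictLine (effectiveAction D κ T h ι K u 1) x) ∧
    -- invariance under infinitesimal deformations
    (∀ (δι : D.Cohomology →ₗ[ℝ] A) (δK : A →ₗ[ℝ] A),
      D.IsInfinitesimalDeformation ι K δι δK → ∀ x ∈ MC D T h ι, ∀ n : ℕ,
        HasDerivAt (fun ε : ℝ => PowerSeries.coeff n
          (restrictLine (halfStrLog D T h (ι + ε • δι) (K + ε • δK) e) x)) 0 0) := by
  classical
  -- The super-trace formula no longer refers to a complement or its basis, which makes the
  -- effective actions for different induction data comparable.
  have hκι : ∀ {ι' : D.Cohomology →ₗ[ℝ] A} {K' : A →ₗ[ℝ] A}, D.IsEmbedding ι' → D.IsAlgHom ι' →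
      D.IsRelaxed ι' K' → ∀ u' : HomogeneousBasis (D.complementDeg ι') M,
      effectiveAction D κ T h ι' K' u' 1 = halfStrLog D T h ι' K' e :=
    fun hι' hhom' hK' u' => effectiveAction_one T h u' e hκ hι' hhom' hK'
  refine ⟨fun l hl => effectiveAction_of_neg T h u hκ hι hιhom hK hl,
    effectiveAction_zero T h u hκ hι hιhom hK, hκι hι hιhom hK u, hK.isStrict hι, ?_, ?_, ?_⟩
  · intro K' hK' x hx
    rw [hκι hι hιhom hK u, hκι hι hιhom hK'.toIsRelaxed u]
    ext n
    simp only [coeff_restrictLine_halfStrLog T h _ _ e hx.1,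
      pointTrace_eq_of_relaxed T h hκ hι hιhom hK hK'.toIsRelaxed hx]
  · intro ιs Ks hι0 hK0 hdata hdι hdK u₁ x hx
    obtain ⟨hι₁, hhom₁, hK₁⟩ := hdata 1 (by simp)
    subst hι0 hK0
    rw [hκι hι hιhom hK u, hκι hι₁ hhom₁ hK₁ u₁]
    ext n
    simp only [coeff_restrictLine_halfStrLog T h _ _ e hx.1,
      pointTrace_eq_of_family T h hκ hdata hdι hdK hx]
  · intro δι δK hδ x hx n
    simp only [coeff_restrictLine_halfStrLog T h _ _ e hx.1]
    have h1 : ∀ k : ℕ, HasDerivAt (fun ε : ℝ => (-1 : ℝ) ^ k / ((k : ℝ) + 1) *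
        (pointTrace T h (ι + ε • δι) (K + ε • δK) x (k + 1) * if n = k + 1 then 1 else 0)) 0 0 := by
      intro k
      have h2 := hasDerivAt_pointTrace T h hκ hι hιhom hK hx hδ (k + 1)
      simpa using (h2.mul_const (if n = k + 1 then (1 : ℝ) else 0)).const_mul
        ((-1 : ℝ) ^ k / ((k : ℝ) + 1))
    have h3 := (HasDerivAt.fun_sum fun k (_ : k ∈ Finset.range (Fintype.card (J × 𝔞) + n)) =>
      h1 k).const_mul (1 / 2 : ℝ)
    simpa only [Finset.sum_const_zero, mul_zero] using h3
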